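/- **Setting.** Let $\Omega\subseteq\mathbb R^d$ (a $d$-dimensional real Hilbert space in orthonormal coordinates) and let $\mu$ be a nonzero finite Borel measure on $\mathbb R^d$ with $\mu(\mathbb R^d\setminus\Omega)=0$. For a polynomial $f$, $\mu$ is *balanced on $\Omega$ with bound $f$* if for every $\delta>0$ and $X\in\Omega$ the $\delta$-ball about $X$ has $\mu$-mass at least $e^{-f(\delta^{-1},d)}\,\mu(\mathbb R^d)$. A point $A$ is in the *$\eta$-interior* of a convex set $S$ ($\eta>0$) if $A$ lies in the affine hull of $S$ and every point of that affine hull at distance less than $\eta$ from $A$ lies in $S$. Put $$\mathcal E_\mu(Y)=\log\int_\Omega e^{-\langle Y,X\rangle}\,d\mu(X),\qquad F_A(Y)=\langle Y,A\rangle+\mathcal E_\mu(Y).$$ The affine hull of $\Omega$ is given by a linear system $\mathcal L(X)=B$ with rational data and linearly independent equations; $V_{\mathcal L}=\{Y:\mathcal L(Y)=0\}$. The dual program is to minimize $F_A$ over $V_{\mathcal L}$. A *strong counting oracle* for $\mathcal E_\mu$ receives a rational vector $Y$ and a number $p\in\mathbb N$ and returns integer multiples of $2^{-p}$ that approximate $\mathcal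 E_\mu(Y)$ and each coordinate of $\nabla\mathcal E_\mu(Y)$ to within $2^{-p}$. Algorithms are finite while-programs on a random access machine whose memory consists of arrays of integers. The elementary operations are $+,-,\cdot$, integer division, indexed reading and writing, tests, and oracle calls. Arithmetic is charged by the schoolbook bit cost, memory access by the bits of the address and of the content, and an oracle call by the bits of the question $(Y,p)$ plus $p+\sum_i\lceil|Y_i|\rceil$ (oracle answers are charged for when they are read). **Theorem.** For every polynomial $f$ in two variables there are a program and a polynomial $T$ such that the following holds for all $d$, all $\Omega\subseteq\mathbb R^d$, all $\mu$ balanced on $\Omega$ with bound $f$, and all $r$ such that $\Omega$ is contained in some closed ball of radius $r$. Let $(\mathcal L,B)$ be as above, let $A\in\mathbb Q^d$ be in the $\eta$-interior of $\mathrm{hull}(\Omega)$ with $\eta>0$, and let $\varepsilon>0$. Given $d$, the number of equations, $A$, $\mathcal L$, $B$, the rounded parameters $\lceil\eta^{-1}\rceil$, $\lceil\log_2^+\varepsilon^{-1}\rceil$, $\lceil\log_2^+ r\rceil$ (where $\log_2^+x=\log_2\max(1,x)$), and any strong counting oracle for $\mathcal E_\mu$, the program halts and outputs a rational $Y^\circ\in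 V_{\mathcal L}$ such that $$F_A(Y^\circ)\le F_A(Y^\star)+\varepsilon$$ for an optimum $Y^\star\in V_{\mathcal L}$ of the dual program (which exists). Its running time is at most $T$ evaluated at $d$, $\lceil\eta^{-1}\rceil$, $\lceil\log_2^+\varepsilon^{-1}\rceil$, $\lceil\log_2^+ r\rceil$ and the total number of bits of $A$, $\mathcal L$ and $B$. -/

import Mathlib

open MeasureTheory

namespace MaxEnt

/-! ### The measure-theoretic side -/

/-- The ambient Hilbert space of dimension `d`, in orthonormal coordinates. -/
abbrev Space (d : ℕ) : Type := EuclideanSpace ℝ (Fin d)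

/-- A rational coordinate vector, viewed as a point of the Hilbert space. -/
noncomputable def ofRat {d : ℕ} (v : Fin d → ℚ) : Space d :=
  WithLp.toLp 2 (fun i => (v i : ℝ))

/-- The affine space of all `X` with `𝓛(X) = B`, for a rational linear system `(𝓛, B)`.
For `B = 0` this is the linear space `V_𝓛`. -/
def solutions {d m : ℕ} (L : Matrix (Fin m) (Fin d) ℚ) (B : Fin m → ℚ) : Set (Space d) :=
  {X | ∀ i, ∑ j, (L i j : ℝ) * X j = (B i : ℝ)}

/-- `μ` is balanced on `Ω` with polynomial bound `f`: every `δ`-ball about a point of `Ω` carries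
at least the fraction `exp (-f(δ⁻¹, d))` of the total mass of `μ`. -/
def IsBalanced {d : ℕ} (f : MvPolynomial (Fin 2) ℝ) (μ : Measure (Space d))
    (Ω : Set (Space d)) : Prop :=
  ∀ δ : ℝ, 0 < δ → ∀ X ∈ Ω,
    Real.exp (-(MvPolynomial.eval ![δ⁻¹, (d : ℝ)] f)) * μ.real Set.univ
      ≤ μ.real (Metric.closedBall X δ)

/-- `A` lies in the (relative) `η`-interior of `S`: the part of the `η`-ball about `A` which lies
in the smallest affine subspace containing `S` is contained in `S`. -/
def InEtaInterior {d : ℕ} (η : ℝ) (S : Set (Space d)) (A : Space d) : Prop :=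
  A ∈ affineSpan ℝ S ∧ Metric.ball A η ∩ (affineSpan ℝ S : Set (Space d)) ⊆ S

/-- The exponential integral `ℰ_μ(Y) = log ∫_Ω exp(-⟨Y, X⟩) dμ(X)`. -/
noncomputable def expIntegral {d : ℕ} (μ : Measure (Space d)) (Ω : Set (Space d))
    (Y : Space d) : ℝ :=
  Real.log (∫ X in Ω, Real.exp (-(inner ℝ Y X)) ∂μ)

/-- The objective function `F_A(Y) = ⟨Y, A⟩ + ℰ_μ(Y)` of the dual program. -/
noncomputable def dualObjective {d : ℕ} (μ : Measure (Space d)) (Ω : Set (Space d))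
    (A Y : Space d) : ℝ :=
  inner ℝ Y A + expIntegral μ Ω Y

/-! ### Oracles -/

/-- An oracle receives a rational vector and a precision `p`, and answers with one integer
together with an integer vector, which are read as multiples of `2⁻ᵖ`. -/
abbrev Oracle (d : ℕ) : Type := (Fin d → ℚ) → ℕ → ℤ × (Fin d → ℤ)

/-- `O` is a strong counting/integration oracle for `ℰ_μ`: on input `Y` and `p` it returns
`ℰ_μ(Y)` and (coordinatewise) `∇ ℰ_μ(Y)` to within `2⁻ᵖ`. -/
def IsStrongCountingOracle {d : ℕ} (μ : Measure (Space d)) (Ω : Set (Space d))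
    (O : Oracle d) : Prop :=
  ∀ (y : Fin d → ℚ) (p : ℕ),
    |((O y p).1 : ℝ) / 2 ^ p - expIntegral μ Ω (ofRat y)| ≤ 1 / 2 ^ p ∧
    ∀ i, |((O y p).2 i : ℝ) / 2 ^ p - gradient (expIntegral μ Ω) (ofRat y) i| ≤ 1 / 2 ^ p

/-! ### The machine model: an oracle random access machine with logarithmic cost

The memory consists of arrays of integers, numbered by naturals.  A program is a fixed finite
`while`-program; every elementary step is charged according to the number of bits of the integers
that it handles. -/

/-- The number of bits of (the absolute value of) an integer. -/
def bits (z : ℤ) : ℕ := z.natAbs.size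

/-- Memory contents: `σ x i` is the content of cell `i` of array number `x`. -/
abbrev Store : Type := ℕ → ℤ → ℤ

/-- Integer expressions. -/
inductive Expr : Type
  | const (c : ℤ)
  | get (x : ℕ) (i : Expr)
  | add (a b : Expr)
  | sub (a b : Expr)
  | mul (a b : Expr)
  | div (a b : Expr)

/-- The value of an expression; `div` is integer division (with value `0` for divisor `0`). -/
def Expr.eval (σ : Store) : Expr → ℤ
  | .const c => c
  | .get x i => σ x (i.eval σ)
  | .add a b => a.eval σ + b.eval σ
  | .sub a b => a.eval σ - b.eval σ
  | .mul a b => a.eval σ * b.eval σ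
  | .div a b => a.eval σ / b.eval σ

/-- The time needed to evaluate an expression, in bit operations. Reading a cell is charged for the
bits of its address and of its content; an arithmetic operation is charged for the schoolbook
method. -/
def Expr.cost (σ : Store) : Expr → ℕ
  | .const c => 1 + bits c
  | .get x i => 1 + i.cost σ + bits (i.eval σ) + bits (σ x (i.eval σ))
  | .add a b => a.cost σ + b.cost σ + (1 + bits (a.eval σ)) * (1 + bits (b.eval σ))
  | .sub a b => a.cost σ + b.cost σ + (1 + bits (a.eval σ)) * (1 + bits (b.eval σ))
  | .mul a b => a.cost σ + b.cost σ + (1 + bits (a.eval σ)) * (1 + bits (b.eval σ))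
  | .div a b => a.cost σ + b.cost σ + (1 + bits (a.eval σ)) * (1 + bits (b.eval σ))

/-- Programs. `set x i e` is the assignment `x[i] := e`; `ite e` and `loop e` test `0 < e`;
`query q a` calls the oracle on the question stored in array `q` and puts the answer in array
`a`. -/
inductive Program : Type
  | skip
  | set (x : ℕ) (i e : Expr)
  | seq (P Q : Program)
  | ite (e : Expr) (P Q : Program)
  | loop (e : Expr) (P : Program)
  | query (q a : ℕ)

/-- The rational vector stored in array `x`: numerators in cells `0, …, d - 1`, and a common
denominator in cell `d`. -/
def readVec (d : ℕ) (σ : Store) (x : ℕ) : Fin d → ℚ :=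
  fun i => (σ x (i : ℤ) : ℚ) / (σ x (d : ℤ) : ℚ)

/-- The precision of an oracle question in array `q`, taken from cell `d + 1`. -/
def readPrec (d : ℕ) (σ : Store) (q : ℕ) : ℕ := (σ q ((d : ℤ) + 1)).toNat

/-- Memory after the assignment `x[i] := v`. -/
def Store.write (σ : Store) (x : ℕ) (i v : ℤ) : Store :=
  fun x' i' => if x' = x ∧ i' = i then v else σ x' i'

/-- Memory after the oracle has put its answer in array `a`: the vector in cells `0, …, d - 1`,
and the single integer in cell `d`. -/
def Store.writeAnswer {d : ℕ} (σ : Store) (a : ℕ) (w : ℤ × (Fin d → ℤ)) : Store :=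
  fun x i =>
    if x = a then
      if h : 0 ≤ i ∧ i < d then w.2 ⟨i.toNat, by omega⟩
      else if i = d then w.1 else σ x i
    else σ x i

/-- The charge for a call of the oracle: the bits of the question, the number `p` of bits of
precision asked for, and the magnitudes of the coordinates of `Y` (that is, up to a constant
factor, the number of bits of the integer parts of `e^{|Y i|}`). The answer is charged for when it
is read. -/
def queryCost (d : ℕ) (σ : Store) (q : ℕ) : ℕ :=
  1 + ∑ i ∈ Finset.range (d + 2), (1 + bits (σ q (i : ℤ)))
    + readPrec d σ q + ∑ i, ⌈|readVec d σ q i|⌉₊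

/-- `Exec O P σ σ' t`: with oracle `O`, started in memory `σ`, the program `P` halts in memory `σ'`
after time `t`. -/
inductive Exec {d : ℕ} (O : Oracle d) : Program → Store → Store → ℕ → Prop
  | skip (σ : Store) : Exec O .skip σ σ 1
  | set (σ : Store) (x : ℕ) (i e : Expr) :
      Exec O (.set x i e) σ (σ.write x (i.eval σ) (e.eval σ)) (1 + i.cost σ + e.cost σ)
  | seq {P Q : Program} {σ σ' σ'' : Store} {s t : ℕ} :
      Exec O P σ σ' s → Exec O Q σ' σ'' t → Exec O (.seq P Q) σ σ'' (s + t)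
  | ite_true {e : Expr} {P Q : Program} {σ σ' : Store} {t : ℕ} :
      0 < e.eval σ → Exec O P σ σ' t → Exec O (.ite e P Q) σ σ' (1 + e.cost σ + t)
  | ite_false {e : Expr} {P Q : Program} {σ σ' : Store} {t : ℕ} :
      ¬ 0 < e.eval σ → Exec O Q σ σ' t → Exec O (.ite e P Q) σ σ' (1 + e.cost σ + t)
  | loop_stop {e : Expr} {P : Program} {σ : Store} :
      ¬ 0 < e.eval σ → Exec O (.loop e P) σ σ (1 + e.cost σ)
  | loop_step {e : Expr} {P : Program} {σ σ' σ'' : Store} {s t : ℕ} :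
      0 < e.eval σ → Exec O P σ σ' s → Exec O (.loop e P) σ' σ'' t →
      Exec O (.loop e P) σ σ'' (1 + e.cost σ + s + t)
  | query (σ : Store) (q a : ℕ) :
      Exec O (.query q a) σ (σ.writeAnswer a (O (readVec d σ q) (readPrec d σ q)))
        (queryCost d σ q)

/-! ### Input and output conventions -/

/-- An array that holds the integer vector `v` in its first `n` cells, and zeros elsewhere. -/
def cells {n : ℕ} (v : Fin n → ℤ) : ℤ → ℤ :=
  fun i => if h : 0 ≤ i ∧ i < n then v ⟨i.toNat, by omega⟩ else 0

/-- The initial memory.  Array `0` holds `d`, `m` and three natural parameters; arrays `1` to `6`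
hold numerators and denominators of `A`, of `𝓛` (row by row) and of `B`; all else is zero. -/
def inputStore {d m : ℕ} (h e ρ : ℕ) (L : Matrix (Fin m) (Fin d) ℚ) (B : Fin m → ℚ)
    (A : Fin d → ℚ) : Store
  | 0 => cells ![(d : ℤ), (m : ℤ), (h : ℤ), (e : ℤ), (ρ : ℤ)]
  | 1 => cells (fun i => (A i).num)
  | 2 => cells (fun i => ((A i).den : ℤ))
  | 3 => cells (fun k : Fin (m * d) =>
      (L (finProdFinEquiv.symm k).1 (finProdFinEquiv.symm k).2).num)
  | 4 => cells (fun k : Fin (m * d) =>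
      ((L (finProdFinEquiv.symm k).1 (finProdFinEquiv.symm k).2).den : ℤ))
  | 5 => cells (fun i => (B i).num)
  | 6 => cells (fun i => ((B i).den : ℤ))
  | _ => fun _ => 0

/-- The number of the array from which the output vector is read. -/
def outputArray : ℕ := 7

/-- The number of bits of a rational number in lowest terms. -/
def ratBits (q : ℚ) : ℕ := bits q.num + bits (q.den : ℤ)

/-- The number of bits needed to represent `A`, `𝓛` and `B`. -/
def inputBits {d m : ℕ} (L : Matrix (Fin m) (Fin d) ℚ) (B : Fin m → ℚ) (A : Fin d → ℚ) : ℕ :=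
  ∑ i, ratBits (A i) + ∑ i, ∑ j, ratBits (L i j) + ∑ i, ratBits (B i)

/-- `1/η`, rounded up to a natural number. -/
noncomputable def ceilInv (η : ℝ) : ℕ := ⌈η⁻¹⌉₊

/-- `log₂ x`, rounded up to a natural number (`0` if `x ≤ 1`). -/
noncomputable def ceilLog (x : ℝ) : ℕ := ⌈Real.logb 2 (max 1 x)⌉₊

end MaxEnt

/-!
The program is a cutting plane method that works with simplices instead of ellipsoids, so that exact
integer arithmetic suffices, followed by an exact orthogonal projection onto `V_𝓛`.

**The optimum.** Let `h = ⌈η⁻¹⌉`. Since `A` is in the `η`-interior, for each `Y ≠ 0` in `V_𝓛` there is a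
point of `Ω` at least `3 / (4 h)` further in the direction of `-Y` than `A`. By balancedness the ball of
radius `1 / (4 h)` around it carries at least the share `exp (-f (4 h, d))` of the mass, and this alone
lifts the objective above its value at the origin when `‖Y‖` exceeds a polynomial bound
(`dualObjective_zero_lt_of_lt_norm`). The objective is
invariant under the orthogonal complement of `V_𝓛`, because all `A - X` with `X` in `Ω` lie in `V_𝓛`.
So its minimum over `V_𝓛` exists, is a minimum over the whole space, and is attained in a box of
polynomial radius (`exists_minimizer`). The constraint may therefore be ignored during the search.

**The search.** A simplex, given by integer numerators over a common denominator, contains the box. If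
its center is outside of the box, a side of the box cuts it off. Otherwise the oracle is asked for the
gradient at the center. Where it is small, the tangent bound shows that the center is nearly optimal
(`dualObjective_le_of_abs_le`). Where it is not small, a gradient step would lower the objective
noticeably (`norm_tiltedMean_sq_le`), so that the center is worse than all points near the minimizer, and
the cut by the approximate gradient keeps a fixed small simplex at the minimizer
(`abs_le_or_sum_mul_sub_neg`). After a cut, the edges at the vertex deepest inside are scaled by factors
rounded up to fractions with denominator `16 (d + 1) ^ 3`. The new simplex contains the side of the old
one that was kept, and its volume is smaller by the factor `exp (-1 / (16 (d + 1) ^ 2))` (`cut_step`,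
which rests on `inSimplex_scaleEdges` and `prod_scale_le`). A simplex inside another one has no larger
volume (`abs_det_homogMatrix_le`), so polynomially many rounds suffice (`SearchData.search_spec`).
No intermediate rounding of the vertices is needed, as each round adds `O(log d)` bits to them.

**The projection.** The orthogonal projection onto `V_𝓛`, multiplied by the Gram determinant, is an
integer matrix with small entries. It is updated row by row, with an exact division as in
fraction-free elimination (`IsProjectionData.step`). Projecting the point found does not change the
objective (`HoldsMatrix.dualObjective_projection`).

**Running time.** `Runs` is a calculus of total correctness in which a bound `M` for the rounds of each
loop and a bound `β` for the bits of all memory cells are fixed in advance. The time is then at most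
`(β + 1) ^ 2` times a polynomial in `M` read off from the program text (`Program.work`), and both bounds
are polynomials in the parameters (`isPolynomial_stepBound`, `isPolynomial_bitBound`). The total mass of
`μ` is not bounded by the parameters, hence neither is the oracle's answer for the value. The program
erases it unread, using gradients only (`Runs.query_erase`).
-/

namespace MaxEnt

/-! ### Bit lengths -/

theorem bits_le_iff {z : ℤ} {β : ℕ} : bits z ≤ β ↔ |z| < 2 ^ β := by
  rw [bits, Nat.size_le, Int.abs_eq_natAbs]
  exact_mod_cast Iff.rfl

theorem natAbs_lt_two_pow_bits (z : ℤ) : z.natAbs < 2 ^ bits z := Nat.lt_size_self _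

theorem bits_le_natAbs (z : ℤ) : bits z ≤ z.natAbs := Nat.size_le.2 Nat.lt_two_pow_self

theorem bits_add_le (a b : ℤ) : bits (a + b) ≤ bits a + bits b + 1 := by
  refine Nat.size_le.2 ((Int.natAbs_add_le a b).trans_lt ?_)
  have ha := natAbs_lt_two_pow_bits a
  have hb := natAbs_lt_two_pow_bits b
  have h1 : 2 ^ bits a ≤ 2 ^ (bits a + bits b) := Nat.pow_le_pow_right (by norm_num) (by omega)
  have h2 : 2 ^ bits b ≤ 2 ^ (bits a + bits b) := Nat.pow_le_pow_right (by norm_num) (by omega)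
  rw [pow_succ]
  omega

theorem bits_neg (a : ℤ) : bits (-a) = bits a := by simp [bits]

theorem bits_sub_le (a b : ℤ) : bits (a - b) ≤ bits a + bits b + 1 := by
  simpa [sub_eq_add_neg, bits_neg] using bits_add_le a (-b)

theorem bits_mul_le (a b : ℤ) : bits (a * b) ≤ bits a + bits b := by
  refine Nat.size_le.2 ?_
  rw [Int.natAbs_mul, pow_add]
  exact Nat.mul_lt_mul'' (natAbs_lt_two_pow_bits a) (natAbs_lt_two_pow_bits b)

theorem bits_ediv_le (a b : ℤ) : bits (a / b) ≤ bits a :=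
  Nat.size_le_size (Int.natAbs_ediv_le_natAbs a b)

/-! ### Syntactic cost bounds for expressions and programs -/

namespace Expr

/-- A syntactic factor for the bit length of the value of an expression: see
`Expr.bits_eval_le`. -/
def len : Expr → ℕ
  | const c => c.natAbs
  | get _ _ => 1
  | add a b => a.len + b.len + 1
  | sub a b => a.len + b.len + 1
  | mul a b => a.len + b.len + 1
  | div a b => a.len + b.len + 1

/-- A syntactic factor for the cost of an expression: see `Expr.cost_le`. -/
def weight : Expr → ℕ
  | const c => 1 + c.natAbs
  | get _ i => 2 + i.weight + i.len
  | add a b => a.weight + b.weight + (1 + a.len) * (1 + b.len)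
  | sub a b => a.weight + b.weight + (1 + a.len) * (1 + b.len)
  | mul a b => a.weight + b.weight + (1 + a.len) * (1 + b.len)
  | div a b => a.weight + b.weight + (1 + a.len) * (1 + b.len)

end Expr

/-- All memory cells hold integers of at most `β` bits. -/
def MemBound (β : ℕ) (σ : Store) : Prop := ∀ x i, bits (σ x i) ≤ β

/-- The bit length of the result of an operation is at most one more than the sum of the bit lengths of
its arguments, so the value of an expression is longer than the memory cells by a factor that depends
on the expression only. -/
theorem Expr.bits_eval_le {β : ℕ} {σ : Store} (hσ : MemBound β σ) (e : Expr) :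
    bits (e.eval σ) ≤ e.len * (β + 1) := by
  induction e with
  | const c =>
    have := bits_le_natAbs c
    simp only [eval, len]
    nlinarith
  | get x i _ =>
    have := hσ x (i.eval σ)
    simp only [eval, len]
    omega
  | add a b iha ihb =>
    have := bits_add_le (a.eval σ) (b.eval σ)
    simp only [eval, len]
    nlinarith
  | sub a b iha ihb =>
    have := bits_sub_le (a.eval σ) (b.eval σ)
    simp only [eval, len]
    nlinarith
  | mul a b iha ihb =>
    have := bits_mul_le (a.eval σ) (b.eval σ)
    simp only [eval, len]
    nlinarith
  | div a b iha ihb =>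
    have := bits_ediv_le (a.eval σ) (b.eval σ)
    simp only [eval, len]
    nlinarith

theorem one_add_mul_le_of_le {x y p q n : ℕ} (hx : x ≤ p * (n + 1)) (hy : y ≤ q * (n + 1)) :
    (1 + x) * (1 + y) ≤ (1 + p) * (1 + q) * (n + 1) ^ 2 := by
  calc (1 + x) * (1 + y) ≤ ((1 + p) * (n + 1)) * ((1 + q) * (n + 1)) :=
        Nat.mul_le_mul (by nlinarith) (by nlinarith)
    _ = _ := by ring

/-- The cost is quadratic in the bit length of the cells because multiplication and division are
charged by the product of the bit lengths. -/
theorem Expr.cost_le {β : ℕ} {σ : Store} (hσ : MemBound β σ) (e : Expr) :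
    e.cost σ ≤ e.weight * (β + 1) ^ 2 := by
  have hB : β + 1 ≤ (β + 1) ^ 2 := by nlinarith
  induction e with
  | const c =>
    have := bits_le_natAbs c
    simp only [cost, weight]
    nlinarith
  | get x i ih =>
    have h1 := hσ x (i.eval σ)
    have h2 := i.bits_eval_le hσ
    simp only [cost, weight]
    nlinarith [Nat.mul_le_mul_left i.len hB]
  | add a b iha ihb =>
    have := one_add_mul_le_of_le (a.bits_eval_le hσ) (b.bits_eval_le hσ)
    simp only [cost, weight]
    linarith
  | sub a b iha ihb =>
    have := one_add_mul_le_of_le (a.bits_eval_le hσ) (b.bits_eval_le hσ)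
    simp only [cost, weight]
    linarith
  | mul a b iha ihb =>
    have := one_add_mul_le_of_le (a.bits_eval_le hσ) (b.bits_eval_le hσ)
    simp only [cost, weight]
    linarith
  | div a b iha ihb =>
    have := one_add_mul_le_of_le (a.bits_eval_le hσ) (b.bits_eval_le hσ)
    simp only [cost, weight]
    linarith

namespace Program

/-- The number of elementary steps of a program, weighted by the sizes of the expressions, when
every loop is run through at most `M` times. It is stated over any commutative semiring, so that it
can be evaluated at a polynomial as well as at a number. -/
def work {S : Type*} [CommSemiring S] (M : S) : Program → S
  | skip => 1
  | set _ i e => ((1 + i.weight + e.weight : ℕ) : S)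
  | seq P Q => P.work M + Q.work M
  | ite e P Q => ((1 + e.weight : ℕ) : S) + P.work M + Q.work M
  | loop e P => M * (((1 + e.weight : ℕ) : S) + P.work M) + ((1 + e.weight : ℕ) : S)
  | query _ _ => 1 + 3 * M

theorem map_work {S S' : Type*} [CommSemiring S] [CommSemiring S'] (φ : S →+* S') (M : S)
    (P : Program) : φ (P.work M) = P.work (φ M) := by
  induction P with
  | skip => simp [work]
  | set => simp [work]
  | seq P Q hP hQ => simp [work, hP, hQ]
  | ite e P Q hP hQ => simp [work, hP, hQ]
  | loop e P hP => simp [work, hP]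
  | query => simp [work, map_ofNat]

/-- The arrays that a program may change. -/
def mods : Program → List ℕ
  | skip => []
  | set x _ _ => [x]
  | seq P Q => P.mods ++ Q.mods
  | ite _ P Q => P.mods ++ Q.mods
  | loop _ P => P.mods
  | query _ a => [a]

end Program

/-- A run leaves all arrays unchanged that the program does not write to. -/
theorem Exec.frame {d : ℕ} {O : Oracle d} {P : Program} {σ σ' : Store} {t : ℕ}
    (h : Exec O P σ σ' t) : ∀ x ∉ P.mods, σ' x = σ x := by
  induction h with
  | skip => intros; rfl
  | set σ x i e =>
    intro y hy
    funext j
    simp only [Program.mods, List.mem_singleton] at hy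
    simp [Store.write, hy]
  | seq _ _ ih1 ih2 =>
    intro y hy
    simp only [Program.mods, List.mem_append, not_or] at hy
    rw [ih2 y hy.2, ih1 y hy.1]
  | ite_true _ _ ih =>
    intro y hy
    simp only [Program.mods, List.mem_append, not_or] at hy
    exact ih y hy.1
  | ite_false _ _ ih =>
    intro y hy
    simp only [Program.mods, List.mem_append, not_or] at hy
    exact ih y hy.2
  | loop_stop => intros; rfl
  | loop_step _ _ _ ih1 ih2 =>
    intro y hy
    rw [ih2 y hy, ih1 y hy]
  | query σ q a =>
    intro y hy
    funext j
    simp only [Program.mods, List.mem_singleton] at hy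
    simp [Store.writeAnswer, hy]

/-! ### A total-correctness calculus with running times -/

/-- Started in `σ`, the program `P` halts in a memory with property `Q`; the number of weighted
steps is that of `P.work M`, and all integers in memory keep to `β` bits, so that each step
costs at most `(β + 1) ^ 2`. -/
def Runs {d : ℕ} (O : Oracle d) (M β : ℕ) (P : Program) (Q : Store → Prop) (σ : Store) : Prop :=
  MemBound β σ → ∃ σ' t, Exec O P σ σ' t ∧ t ≤ P.work M * (β + 1) ^ 2 ∧ MemBound β σ' ∧ Q σ'

namespace Runs

variable {d : ℕ} {O : Oracle d} {M β : ℕ}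

theorem imp {P : Program} {Q Q' : Store → Prop} {σ : Store} (h : Runs O M β P Q σ)
    (hQ : ∀ σ', (∀ x ∉ P.mods, σ' x = σ x) → Q σ' → Q' σ') : Runs O M β P Q' σ := by
  intro hσ
  obtain ⟨σ', t, h1, h2, h3, h4⟩ := h hσ
  exact ⟨σ', t, h1, h2, h3, hQ σ' h1.frame h4⟩

theorem skip {Q : Store → Prop} {σ : Store} (h : Q σ) : Runs O M β .skip Q σ := fun hσ =>
  ⟨σ, 1, .skip σ, by simp only [Program.work, one_mul]; exact Nat.one_le_pow _ _ (by omega), hσ, h⟩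

theorem memBound_write {σ : Store} (hσ : MemBound β σ) {x : ℕ} {i v : ℤ} (hv : bits v ≤ β) :
    MemBound β (σ.write x i v) := by
  intro y j
  unfold Store.write
  split_ifs
  exacts [hv, hσ y j]

theorem set {x : ℕ} {i e : Expr} {Q : Store → Prop} {σ : Store} (hb : |e.eval σ| < 2 ^ β)
    (h : Q (σ.write x (i.eval σ) (e.eval σ))) : Runs O M β (.set x i e) Q σ := by
  intro hσ
  refine ⟨_, _, .set σ x i e, ?_, memBound_write hσ (bits_le_iff.2 hb), h⟩
  have h1 := i.cost_le hσ
  have h2 := e.cost_le hσ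
  have h3 : 1 ≤ (β + 1) ^ 2 := Nat.one_le_pow _ _ (by omega)
  simp only [Program.work, Nat.cast_id]
  linarith

theorem seq {P P' : Program} {Q : Store → Prop} {σ : Store}
    (h : Runs O M β P (fun σ' => (∀ x ∉ P.mods, σ' x = σ x) → Runs O M β P' Q σ') σ) :
    Runs O M β (.seq P P') Q σ := by
  intro hσ
  obtain ⟨σ', t, h1, h2, h3, h4⟩ := h hσ
  obtain ⟨σ'', t', h1', h2', h3', h4'⟩ := h4 h1.frame h3
  refine ⟨σ'', t + t', .seq h1 h1', ?_, h3', h4'⟩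
  simp only [Program.work]
  linarith

theorem ite {e : Expr} {P P' : Program} {Q : Store → Prop} {σ : Store}
    (h : 0 < e.eval σ → Runs O M β P Q σ) (h' : ¬ 0 < e.eval σ → Runs O M β P' Q σ) :
    Runs O M β (.ite e P P') Q σ := by
  intro hσ
  have h1 := e.cost_le hσ
  have h3 : 1 ≤ (β + 1) ^ 2 := Nat.one_le_pow _ _ (by omega)
  have hP : 0 ≤ P.work M * (β + 1) ^ 2 := Nat.zero_le _
  have hP' : 0 ≤ P'.work M * (β + 1) ^ 2 := Nat.zero_le _
  by_cases hc : 0 < e.eval σ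
  · obtain ⟨σ', t, hE, ht, hr⟩ := h hc hσ
    refine ⟨σ', _, .ite_true hc hE, ?_, hr⟩
    simp only [Program.work, Nat.cast_id]
    linarith
  · obtain ⟨σ', t, hE, ht, hr⟩ := h' hc hσ
    refine ⟨σ', _, .ite_false hc hE, ?_, hr⟩
    simp only [Program.work, Nat.cast_id]
    linarith

/-- The rule for `while`-loops: `Inv t` describes the memory after `t` rounds, and `M` bounds the
number of rounds. -/
theorem loop {e : Expr} {P : Program} {Q : Store → Prop} {σ : Store} (Inv : ℕ → Store → Prop)
    (h0 : Inv 0 σ)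
    (hM : ∀ t σ', (∀ x ∉ P.mods, σ' x = σ x) → Inv t σ' → 0 < e.eval σ' → t < M)
    (hstep : ∀ t σ', (∀ x ∉ P.mods, σ' x = σ x) → Inv t σ' → 0 < e.eval σ' →
      Runs O M β P (Inv (t + 1)) σ')
    (hQ : ∀ t σ', (∀ x ∉ P.mods, σ' x = σ x) → Inv t σ' → ¬ 0 < e.eval σ' → Q σ') :
    Runs O M β (.loop e P) Q σ := by
  -- induction on the number `n` of rounds that the bound `M` still allows
  have key : ∀ n t σ', (∀ x ∉ P.mods, σ' x = σ x) → MemBound β σ' → Inv t σ' → t + n = M →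
      ∃ σ'' s, Exec O (.loop e P) σ' σ'' s ∧
        s ≤ (n * ((1 + e.weight) + P.work M) + (1 + e.weight)) * (β + 1) ^ 2 ∧
        MemBound β σ'' ∧ Q σ'' := by
    intro n
    have h3 : 1 ≤ (β + 1) ^ 2 := Nat.one_le_pow _ _ (by omega)
    induction n with
    | zero =>
      intro t σ' hf hb hI ht
      have hc : ¬ 0 < e.eval σ' := fun hc => by
        have := hM t σ' hf hI hc
        omega
      refine ⟨σ', _, Exec.loop_stop hc, ?_, hb, hQ t σ' hf hI hc⟩
      have h1 := e.cost_le hb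
      linarith
    | succ n ih =>
      intro t σ' hf hb hI ht
      have h1 := e.cost_le hb
      by_cases hc : 0 < e.eval σ'
      · obtain ⟨σ₁, s₁, hE₁, ht₁, hb₁, hI₁⟩ := hstep t σ' hf hI hc hb
        obtain ⟨σ₂, s₂, hE₂, ht₂, hb₂, hq⟩ := ih (t + 1) σ₁
          (fun x hx => (hE₁.frame x hx).trans (hf x hx)) hb₁ hI₁ (by omega)
        refine ⟨σ₂, _, .loop_step hc hE₁ hE₂, ?_, hb₂, hq⟩
        linarith
      · refine ⟨σ', _, Exec.loop_stop hc, ?_, hb, hQ t σ' hf hI hc⟩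
        have : 0 ≤ (n + 1) * ((1 + e.weight) + P.work M) * (β + 1) ^ 2 := Nat.zero_le _
        linarith
  intro hσ
  obtain ⟨σ', s, h1, h2, h3⟩ := key M 0 σ (fun _ _ => rfl) hσ h0 (by omega)
  exact ⟨σ', s, h1, by simpa [Program.work] using h2, h3⟩

/-- An oracle call. Since the oracle's approximation of the value may be arbitrarily large (the
mass of `μ` is not bounded), the value is erased before the memory is declared bounded. -/
theorem query_erase {q a : ℕ} {Q : Store → Prop} {σ : Store} (hd : d + 2 ≤ M)
    (hp : readPrec d σ q ≤ M) (hs : ∑ i, ⌈|readVec d σ q i|⌉₊ ≤ M)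
    (ha : ∀ i, |(O (readVec d σ q) (readPrec d σ q)).2 i| < 2 ^ β)
    (hσd : σ 0 0 = d) (ha0 : a ≠ 0)
    (h : Q ((σ.writeAnswer a (O (readVec d σ q) (readPrec d σ q))).write a d 0)) :
    Runs O M β (.seq (.query q a) (.set a (.get 0 (.const 0)) (.const 0))) Q σ := by
  intro hσ
  set w := O (readVec d σ q) (readPrec d σ q) with hw
  have hd0 : (σ.writeAnswer a w) 0 0 = d := by simp [Store.writeAnswer, hσd, Ne.symm ha0]
  have hd1 : Expr.eval (σ.writeAnswer a w) (.get 0 (.const 0)) = (d : ℤ) := by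
    simp [Expr.eval, hd0]
  have hdβ : bits (d : ℤ) ≤ β := hσd ▸ hσ 0 0
  -- the answer is `d` gradient coordinates, followed by the value in cell `d`, which is overwritten
  have hb : MemBound β ((σ.writeAnswer a w).write a d 0) := by
    intro y j
    simp only [Store.write, Store.writeAnswer]
    split_ifs with h1 h2 h3 h4
    · simp [bits]
    · exact bits_le_iff.2 (ha _)
    · exact absurd ⟨h2, h4⟩ h1
    · exact hσ y j
    · exact hσ y j
  refine ⟨_, _, .seq (.query σ q a) (.set _ a _ _), ?_, by rw [hd1]; exact hb, by rw [hd1]; exact h⟩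
  have hsum : ∑ i ∈ Finset.range (d + 2), (1 + bits (σ q (i : ℤ))) ≤ (d + 2) * (1 + β) := by
    calc _ ≤ ∑ i ∈ Finset.range (d + 2), (1 + β) :=
          Finset.sum_le_sum fun i _ => Nat.add_le_add_left (hσ q _) 1
      _ = _ := by simp
  have hc : Expr.cost (σ.writeAnswer a w) (.get 0 (.const 0)) ≤ 2 + β := by
    simp only [Expr.cost, Expr.eval, hd0]
    simp only [bits, Int.natAbs_zero, Nat.size_zero]
    have : (d : ℤ).natAbs.size ≤ β := hdβ
    omega
  simp only [Program.work, queryCost, Expr.weight, Expr.len]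
  have hc0 : Expr.cost (σ.writeAnswer a w) (.const 0) = 1 := by simp [Expr.cost, bits]
  rw [hc0]
  push_cast
  have h5 : (d + 2) * (1 + β) ≤ M * (1 + β) := Nat.mul_le_mul_right _ hd
  have h6 : M * (1 + β) ≤ M * (β + 1) ^ 2 := Nat.mul_le_mul_left _ (by nlinarith)
  have h7 : M ≤ M * (β + 1) ^ 2 := Nat.le_mul_of_pos_right _ (by positivity)
  have h8 : β + 1 ≤ (β + 1) ^ 2 := by nlinarith
  linarith

end Runs

namespace Expr

instance : Add Expr := ⟨add⟩
instance : Sub Expr := ⟨sub⟩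
instance : Mul Expr := ⟨mul⟩
instance : Div Expr := ⟨div⟩
instance (n : ℕ) : OfNat Expr n := ⟨const n⟩

/-- The scalar variable `x`: cell `0` of array `x`. -/
def var (x : ℕ) : Expr := get x (const 0)

variable (σ : Store)

@[simp] theorem eval_add (a b : Expr) : (a + b).eval σ = a.eval σ + b.eval σ := rfl
@[simp] theorem eval_sub (a b : Expr) : (a - b).eval σ = a.eval σ - b.eval σ := rfl
@[simp] theorem eval_mul (a b : Expr) : (a * b).eval σ = a.eval σ * b.eval σ := rfl
@[simp] theorem eval_div (a b : Expr) : (a / b).eval σ = a.eval σ / b.eval σ := rfl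
@[simp] theorem eval_ofNat (n : ℕ) [n.AtLeastTwo] :
    (ofNat(n) : Expr).eval σ = (ofNat(n) : ℤ) := rfl
@[simp] theorem eval_zero : (0 : Expr).eval σ = 0 := rfl
@[simp] theorem eval_one : (1 : Expr).eval σ = 1 := rfl
@[simp] theorem eval_var (x : ℕ) : (var x).eval σ = σ x 0 := rfl
@[simp] theorem eval_get (x : ℕ) (i : Expr) : (get x i).eval σ = σ x (i.eval σ) := rfl
@[simp] theorem eval_const (c : ℤ) : (const c).eval σ = c := rfl

end Expr

theorem Store.write_same (σ : Store) (x : ℕ) (i v : ℤ) : σ.write x i v x i = v := by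
  simp [Store.write]

theorem Store.write_ne_array (σ : Store) {x y : ℕ} (h : y ≠ x) (i v : ℤ) :
    σ.write x i v y = σ y := by
  funext j
  simp [Store.write, h]

theorem Store.write_ne_cell (σ : Store) (x : ℕ) {i j : ℤ} (h : j ≠ i) (v : ℤ) :
    σ.write x i v x j = σ x j := by
  simp [Store.write, h]

namespace Program

/-- The assignment of the scalar variable `x`. -/
def assign (x : ℕ) (e : Expr) : Program := set x 0 e

/-- `for x = 0, …, ub - 1` do `P`, where `x` is a scalar variable. -/
def forLoop (x : ℕ) (ub : Expr) (P : Program) : Program :=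
  seq (assign x 0) (loop (ub - .var x) (seq P (assign x (.var x + 1))))

/-- Start with `acc := init` and repeat `acc := step` for `x = 0, …, ub - 1`. -/
def accLoop (acc x : ℕ) (init ub step : Expr) : Program :=
  seq (assign acc init) (forLoop x ub (assign acc step))

end Program

namespace Runs

variable {d : ℕ} {O : Oracle d} {M β : ℕ}

theorem assign {x : ℕ} {e : Expr} {Q : Store → Prop} {σ : Store} (hb : |e.eval σ| < 2 ^ β)
    (h : Q (σ.write x 0 (e.eval σ))) : Runs O M β (.assign x e) Q σ := set hb h

/-- The rule for counting loops: `Inv k` describes the memory after `k` rounds. -/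
theorem forLoop {x : ℕ} {ub : Expr} {P : Program} {Q : Store → Prop} {σ : Store} (n : ℕ)
    (Inv : ℕ → Store → Prop) (hx : x ∉ P.mods) (hn : n ≤ M) (hnβ : (n : ℤ) < 2 ^ β)
    (hub : ∀ σ', (∀ y, y ≠ x → y ∉ P.mods → σ' y = σ y) → ub.eval σ' = n)
    (h0 : Inv 0 (σ.write x 0 0))
    (hstep : ∀ k < n, ∀ σ' : Store, (∀ y, y ≠ x → y ∉ P.mods → σ' y = σ y) → σ' x 0 = (k : ℤ) → Inv k σ' →
      Runs O M β P (fun σ'' => Inv (k + 1) (σ''.write x 0 (k + 1 : ℕ))) σ')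
    (hQ : ∀ σ', (∀ y, y ≠ x → y ∉ P.mods → σ' y = σ y) → Inv n σ' → Q σ') :
    Runs O M β (.forLoop x ub P) Q σ := by
  have hmods : ∀ y, y ≠ x → y ∉ P.mods →
      y ∉ (Program.seq P (.assign x (.var x + 1))).mods := by
    intro y h1 h2
    simp [Program.mods, Program.assign, h1, h2]
  refine seq (assign (by simp) fun _ => ?_)
  refine loop (fun k σ' => k ≤ n ∧ σ' x 0 = k ∧ Inv k σ') ⟨Nat.zero_le _, ?_, h0⟩ ?_ ?_ ?_
  · simp [Store.write_same]
  all_goals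
    intro t σ' hf hI hc
    have hf' : ∀ y, y ≠ x → y ∉ P.mods → σ' y = σ y := fun y h1 h2 => by
      rw [hf y (hmods y h1 h2), Store.write_ne_array _ h1]
    obtain ⟨htn, htx, hI⟩ := hI
    have hue := hub σ' hf'
    simp only [Expr.eval_sub, hue, Expr.eval_var, htx] at hc
  · omega
  · have htn : t < n := by omega
    refine seq ((hstep t htn σ' hf' htx hI).imp fun σ'' hf'' hI' hf3 => ?_)
    have hx'' : σ'' x 0 = t := by rw [hf'' x hx, htx]
    have he : (Expr.var x + 1).eval σ'' = (t + 1 : ℕ) := by simp [hx'']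
    refine assign ?_ ?_
    · rw [he, abs_of_nonneg (by positivity)]
      exact lt_of_le_of_lt (by exact_mod_cast htn) hnβ
    · rw [he]
      exact ⟨htn, by simp [Store.write_same], hI'⟩
  · obtain rfl : t = n := by omega
    exact hQ σ' hf' hI

/-- The rule for accumulating loops: `v k` is the accumulated value after `k` rounds. -/
theorem accLoop {acc x : ℕ} {init ub step : Expr} {Q : Store → Prop} {σ : Store} (n : ℕ)
    (v : ℕ → ℤ) (hx : acc ≠ x) (hn : n ≤ M) (hnβ : (n : ℤ) < 2 ^ β)
    (hub : ∀ σ', (∀ y, y ≠ x → y ≠ acc → σ' y = σ y) → ub.eval σ' = n)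
    (h0 : init.eval σ = v 0)
    (hstep : ∀ k < n, ∀ σ' : Store, (∀ y, y ≠ x → y ≠ acc → σ' y = σ y) → σ' x 0 = (k : ℤ) →
      σ' acc 0 = v k → step.eval σ' = v (k + 1))
    (hv : ∀ k ≤ n, |v k| < 2 ^ β)
    (hQ : ∀ σ', (∀ y, y ≠ x → y ≠ acc → σ' y = σ y) → σ' acc 0 = v n → Q σ') :
    Runs O M β (.accLoop acc x init ub step) Q σ := by
  refine seq (assign (by rw [h0]; exact hv 0 (Nat.zero_le _)) fun _ => ?_)
  have hf1 : ∀ σ' : Store, (∀ y, y ≠ x → y ∉ (Program.assign acc step).mods →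
      σ' y = (σ.write acc 0 (init.eval σ)) y) → ∀ y, y ≠ x → y ≠ acc → σ' y = σ y := by
    intro σ' hf y h1 h2
    rw [hf y h1 (by simp [Program.mods, Program.assign, h2]), Store.write_ne_array _ h2]
  refine forLoop n (fun k σ' => σ' acc 0 = v k) (by simp [Program.mods, Program.assign, hx.symm])
    hn hnβ (fun σ' hf => hub σ' (hf1 σ' hf)) ?_ ?_ (fun σ' hf h => hQ σ' (hf1 σ' hf) h)
  · rw [Store.write_ne_array _ hx, Store.write_same, h0]
  · intro k hk σ' hf hkx hI
    have := hstep k hk σ' (hf1 σ' hf) hkx hI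
    refine assign (by rw [this]; exact hv _ hk) ?_
    rw [Store.write_ne_array _ hx, Store.write_same, this]

end Runs

/-! ### Simplices and cuts -/

/-- The determinant of a matrix with nonnegative entries and row sums `1` is at most `1` in absolute
value: expand the product of the row sums and compare with the Leibniz formula. -/
theorem abs_det_le_one_of_stochastic {ι : Type*} [Fintype ι] [DecidableEq ι] (A : Matrix ι ι ℝ)
    (h0 : ∀ i j, 0 ≤ A i j) (h1 : ∀ i, ∑ j, A i j = 1) : |A.det| ≤ 1 := by
  rw [← Matrix.det_transpose, Matrix.det_apply]
  calc |∑ σ : Equiv.Perm ι, Equiv.Perm.sign σ • ∏ i, A.transpose (σ i) i|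
      ≤ ∑ σ : Equiv.Perm ι, |Equiv.Perm.sign σ • ∏ i, A.transpose (σ i) i| :=
        Finset.abs_sum_le_sum_abs _ _
    _ = ∑ σ : Equiv.Perm ι, ∏ i, A i (σ i) := by
        refine Finset.sum_congr rfl fun σ _ => ?_
        rcases Int.units_eq_one_or (Equiv.Perm.sign σ) with h | h <;>
          simp [h, Finset.abs_prod, abs_of_nonneg (h0 _ _)]
    _ ≤ ∑ f : ι → ι, ∏ i, A i (f i) := by
        rw [← Finset.sum_image (f := fun f : ι → ι => ∏ i, A i (f i))
          (g := fun σ : Equiv.Perm ι => (σ : ι → ι))]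
        · exact Finset.sum_le_sum_of_subset_of_nonneg (Finset.subset_univ _)
            fun f _ _ => Finset.prod_nonneg fun i _ => h0 _ _
        · intro σ _ τ _ h
          exact DFunLike.coe_injective h
    _ = ∏ i, ∑ j, A i j := by
        rw [Finset.prod_univ_sum (fun _ => Finset.univ) fun i j => A i j, Fintype.piFinset_univ]
    _ = 1 := by simp [h1]

/-- The points `v i` as rows, extended by a column of ones. Its determinant is, up to sign and the
factor `d!`, the volume of the simplex with vertices `v i`. -/
def homogMatrix {d : ℕ} (v : Fin (d + 1) → Fin d → ℝ) : Matrix (Fin (d + 1)) (Fin (d + 1)) ℝ :=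
  .of fun i => Fin.snoc (v i) 1

/-- `z` is a convex combination of the points `v i`. -/
def InSimplex {d : ℕ} (v : Fin (d + 1) → Fin d → ℝ) (z : Fin d → ℝ) : Prop :=
  ∃ l : Fin (d + 1) → ℝ, (∀ i, 0 ≤ l i) ∧ ∑ i, l i = 1 ∧ ∀ j, z j = ∑ i, l i * v i j

/-- A simplex has at least the volume of each simplex inside of it: the matrix of barycentric
coordinates is stochastic. -/
theorem abs_det_homogMatrix_le {d : ℕ} {v z : Fin (d + 1) → Fin d → ℝ}
    (h : ∀ k, InSimplex v (z k)) : |(homogMatrix z).det| ≤ |(homogMatrix v).det| := by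
  choose l h0 h1 h2 using h
  have : homogMatrix z = Matrix.of l * homogMatrix v := by
    ext k j
    rw [Matrix.mul_apply]
    refine Fin.lastCases ?_ (fun j => ?_) j
    · simp [homogMatrix, h1]
    · simp [homogMatrix, h2]
  rw [this, Matrix.det_mul, abs_mul]
  exact mul_le_of_le_one_left (abs_nonneg _) (abs_det_le_one_of_stochastic _ h0 h1)

/-- The simplex with vertices `x + s eᵢ` and `x`. -/
def cornerSimplex {d : ℕ} (x : Fin d → ℝ) (s : ℝ) (i : Fin (d + 1)) (j : Fin d) : ℝ :=
  x j + if (i : ℕ) = j then s else 0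

theorem det_cornerSimplex {d : ℕ} (x : Fin d → ℝ) (s : ℝ) :
    (homogMatrix (cornerSimplex x s)).det = s ^ d := by
  let B : Matrix (Fin (d + 1)) (Fin (d + 1)) ℝ := .of fun i =>
    if i = Fin.last d then Fin.snoc x 1 else Pi.single i s
  have hA : (homogMatrix (cornerSimplex x s)).det = B.det := by
    refine Matrix.det_eq_of_forall_row_eq_smul_add_const
      (fun i => if i = Fin.last d then 0 else 1) (Fin.last d) (by simp) fun i j => ?_
    refine Fin.lastCases ?_ (fun i => ?_) i
    · refine Fin.lastCases ?_ (fun j => ?_) j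
      · simp [homogMatrix, B]
      · simp [homogMatrix, B, cornerSimplex, j.isLt.ne']
    · refine Fin.lastCases ?_ (fun j => ?_) j
      · simp [homogMatrix, B, Fin.castSucc_ne_last]
      · simp [homogMatrix, B, cornerSimplex, Fin.castSucc_ne_last, add_comm]
        simp [Pi.single_apply, Fin.ext_iff, eq_comm]
  rw [hA, Matrix.det_of_isLowerTriangular]
  · rw [Fin.prod_univ_castSucc]
    simp [B, Fin.castSucc_ne_last]
  · intro i j hij
    have hij : i < j := hij
    have : i ≠ Fin.last d := (hij.trans_le (Fin.le_last j)).ne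
    simp [B, this, hij.ne']

/-- The box of radius `R` lies in the corner simplex at `(-R, …, -R)` with legs `2dR`. -/
theorem inSimplex_cornerSimplex_of_abs_le {d : ℕ} {R : ℝ} {z : Fin d → ℝ}
    (hz : ∀ j, |z j| ≤ R) : InSimplex (cornerSimplex (fun _ => -R) (2 * d * R)) z := by
  rcases Nat.eq_zero_or_pos d with rfl | hd
  · exact ⟨fun _ => 1, fun _ => zero_le_one, by simp, fun j => j.elim0⟩
  have hR : 0 ≤ R := (abs_nonneg _).trans (hz ⟨0, hd⟩)
  rcases hR.eq_or_lt with rfl | hR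
  · refine ⟨Pi.single (Fin.last d) 1, fun i => ?_, by simp, fun j => ?_⟩
    · by_cases h : i = Fin.last d
      · simp [h]
      · simp [h]
    · have := abs_nonpos_iff.1 (hz j)
      simp [this, cornerSimplex]
  have hd' : (0 : ℝ) < d := by exact_mod_cast hd
  have hpos : 0 < 2 * d * R := by positivity
  have hlo : ∀ j, 0 ≤ z j + R := fun j => by linarith [neg_abs_le (z j), hz j]
  refine ⟨Fin.snoc (fun j => (z j + R) / (2 * d * R)) (1 - ∑ j, (z j + R) / (2 * d * R)),
    fun i => ?_, ?_, fun j => ?_⟩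
  · refine Fin.lastCases ?_ (fun i => ?_) i
    · rw [Fin.snoc_last, ← Finset.sum_div, sub_nonneg, div_le_one hpos]
      calc ∑ j, (z j + R) ≤ ∑ _j : Fin d, (R + R) :=
            Finset.sum_le_sum fun j _ => by linarith [le_abs_self (z j), hz j]
        _ = 2 * d * R := by simp; ring
    · rw [Fin.snoc_castSucc]
      exact div_nonneg (hlo i) hpos.le
  · rw [Fin.sum_univ_castSucc]
    simp
  · rw [Fin.sum_univ_castSucc]
    simp only [Fin.snoc_castSucc, Fin.snoc_last, cornerSimplex, Fin.val_castSucc, Fin.val_last,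
      j.isLt.ne', if_false, mul_add, Finset.sum_add_distrib, ← Finset.sum_mul]
    have : ∑ i : Fin d, (z i + R) / (2 * d * R) * (if (i : ℕ) = j then 2 * d * R else 0)
        = z j + R := by
      rw [Finset.sum_eq_single j]
      · simp [hpos.ne']
      · intro i _ hij
        simp [Fin.val_ne_of_ne hij]
      · simp
    rw [this]
    ring

section Cut

variable {d : ℕ} (v : Fin (d + 1) → Fin d → ℝ) (i₀ : Fin (d + 1)) (s : Fin (d + 1) → ℝ)

/-- The simplex with the same apex `v i₀`, whose edges at the apex are scaled by the factors
`s i`. -/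
def scaleEdges (i : Fin (d + 1)) (j : Fin d) : ℝ := (1 - s i) * v i₀ j + s i * v i j

theorem det_scaleEdges (hs : s i₀ = 1) :
    (homogMatrix (scaleEdges v i₀ s)).det = (∏ i, s i) * (homogMatrix v).det := by
  rw [← Matrix.det_mul_column]
  refine Matrix.det_eq_of_forall_row_eq_smul_add_const (fun i => 1 - s i) i₀ (by simp [hs])
    fun i j => ?_
  refine Fin.lastCases ?_ (fun j => ?_) j
  · simp [homogMatrix, hs]
  · simp only [homogMatrix, scaleEdges, Matrix.of_apply, Fin.snoc_castSucc, hs]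
    ring

/-- The part of a simplex on which `∑ i, a i * lᵢ ≤ 0` (in barycentric coordinates `l`) stays
inside when the edges at the apex are scaled by factors `s i` with `1 / s i ≤ 1 + τ a i / m`, where
`a` is `-m` at the apex. -/
theorem inSimplex_scaleEdges {v : Fin (d + 1) → Fin d → ℝ} {i₀ : Fin (d + 1)}
    {s a l : Fin (d + 1) → ℝ} {m τ : ℝ} (hs : s i₀ = 1)
    (hm : 0 < m) (hτ0 : 0 < τ) (hτ1 : τ ≤ 1) (ha : a i₀ = -m)
    (hspos : ∀ i, 0 < s i) (hsi : ∀ i ≠ i₀, 1 / s i ≤ 1 + τ * (a i / m))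
    (hl0 : ∀ i, 0 ≤ l i) (hl1 : ∑ i, l i = 1) (hla : ∑ i, l i * a i ≤ 0)
    {z : Fin d → ℝ} (hz : ∀ j, z j = ∑ i, l i * v i j) : InSimplex (scaleEdges v i₀ s) z := by
  have hsum : ∑ i, l i / s i ≤ 1 + τ * l i₀ := by
    have h1 : ∀ i, l i / s i ≤ l i + τ / m * (l i * a i) + if i = i₀ then τ * l i₀ else 0 := by
      intro i
      by_cases h : i = i₀
      · subst h
        rw [if_pos rfl, hs, ha]
        have : τ / m * (l i * -m) = - (τ * l i) := by field_simp
        rw [this]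
        simp
      · rw [if_neg h]
        calc l i / s i = l i * (1 / s i) := by ring
          _ ≤ l i * (1 + τ * (a i / m)) := mul_le_mul_of_nonneg_left (hsi i h) (hl0 i)
          _ = _ := by ring
    calc ∑ i, l i / s i ≤ ∑ i, (l i + τ / m * (l i * a i) + if i = i₀ then τ * l i₀ else 0) :=
          Finset.sum_le_sum fun i _ => h1 i
      _ = 1 + τ / m * ∑ i, l i * a i + τ * l i₀ := by
          rw [Finset.sum_add_distrib, Finset.sum_add_distrib, hl1, ← Finset.mul_sum]
          simp
      _ ≤ 1 + τ * l i₀ := by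
          have : τ / m * ∑ i, l i * a i ≤ 0 :=
            mul_nonpos_of_nonneg_of_nonpos (by positivity) hla
          linarith
  have hl2 : τ * l i₀ ≤ l i₀ := mul_le_of_le_one_left (hl0 _) hτ1
  -- the new barycentric coordinates: `l i / s i`, and the apex takes what is missing to `1`
  refine ⟨fun i => l i / s i + if i = i₀ then 1 - ∑ i, l i / s i else 0, fun i => ?_, ?_,
    fun j => ?_⟩
  · by_cases h : i = i₀
    · subst h
      simp only [if_true, hs, div_one]
      linarith
    · simp only [h, if_false, add_zero]
      exact div_nonneg (hl0 i) (hspos i).le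
  · rw [Finset.sum_add_distrib]
    simp
  · have h1 : ∀ i, (l i / s i + if i = i₀ then 1 - ∑ i, l i / s i else 0) * scaleEdges v i₀ s i j
        = l i / s i * v i₀ j - l i * v i₀ j + l i * v i j
          + if i = i₀ then (1 - ∑ i, l i / s i) * v i₀ j else 0 := by
      intro i
      have := (hspos i).ne'
      by_cases h : i = i₀
      · subst h
        simp only [if_true, hs, scaleEdges]
        ring
      · simp only [h, if_false, scaleEdges]
        field_simp
        ring
    rw [Finset.sum_congr rfl fun i _ => h1 i, Finset.sum_add_distrib, Finset.sum_add_distrib,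
      Finset.sum_sub_distrib, ← Finset.sum_mul, ← Finset.sum_mul, hl1, hz]
    simp only [Finset.sum_ite_eq', Finset.mem_univ, if_true]
    ring

/-- The logarithm is at least `x - 2 x ^ 2` at `1 + x`, written with the exponential function. -/
theorem exp_sub_two_mul_sq_le {x : ℝ} (hx : -(1 / 2) ≤ x) : Real.exp (x - 2 * x ^ 2) ≤ 1 + x := by
  have h1 : 0 < 1 + x := by linarith
  rw [← Real.le_log_iff_exp_le h1]
  refine le_trans ?_ (Real.one_sub_inv_le_log_of_pos h1)
  rw [← sub_nonneg]
  have : 1 - (1 + x)⁻¹ - (x - 2 * x ^ 2) = x ^ 2 * (1 + 2 * x) / (1 + x) := by field_simp; ring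
  rw [this]
  exact div_nonneg (mul_nonneg (sq_nonneg _) (by linarith)) h1.le

/-- The decrease of volume in a cut: with `τ = 1 / (4 (d + 1) ^ 2)` the ideal factors
`1 / (1 + τ a i / m)` may be rounded up by `κ = 1 / (16 (d + 1) ^ 3)`. -/
theorem prod_scale_le {i₀ : Fin (d + 1)} {s a : Fin (d + 1) → ℝ} {m τ κ : ℝ} (hs : s i₀ = 1) (hm : 0 < m)
    (hτ : τ = 1 / (4 * ((d : ℝ) + 1) ^ 2)) (hκ : κ = 1 / (16 * ((d : ℝ) + 1) ^ 3))
    (ha0 : ∑ i, a i = 0) (ha : a i₀ = -m) (hmin : ∀ i, -m ≤ a i) (hspos : ∀ i, 0 < s i)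
    (hsi : ∀ i ≠ i₀, s i ≤ 1 / (1 + τ * (a i / m)) + κ) :
    ∏ i, s i ≤ Real.exp (-(1 / (16 * ((d : ℝ) + 1) ^ 2))) := by
  have hd : (0 : ℝ) < d + 1 := by positivity
  have hd1 : (1 : ℝ) ≤ d + 1 := by simp
  have hτ0 : 0 < τ := by rw [hτ]; positivity
  have hτ1 : τ ≤ 1 / 4 := by
    rw [hτ]
    exact one_div_le_one_div_of_le (by norm_num) (by nlinarith)
  have hκ0 : 0 < κ := by rw [hκ]; positivity
  set α : Fin (d + 1) → ℝ := fun i => a i / m with hα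
  have hα1 : ∀ i, -1 ≤ α i := fun i => by
    rw [hα]
    simp only
    rw [le_div_iff₀ hm]
    linarith [hmin i]
  have hle : ∀ i ∈ Finset.univ.erase i₀,
      s i ≤ Real.exp (-(τ * α i) + 2 * (τ * α i) ^ 2 + κ * (1 + τ * α i)) := by
    intro i hi
    have hi : i ≠ i₀ := Finset.ne_of_mem_erase hi
    have hx : -(1 / 2) ≤ τ * α i := by nlinarith [hα1 i]
    have hx0 : 0 < 1 + τ * α i := by linarith
    have h1 : 1 / (1 + τ * α i) ≤ Real.exp (-(τ * α i) + 2 * (τ * α i) ^ 2) := by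
      rw [show -(τ * α i) + 2 * (τ * α i) ^ 2 = -(τ * α i - 2 * (τ * α i) ^ 2) by ring, Real.exp_neg,
        one_div]
      exact inv_anti₀ (Real.exp_pos _) (exp_sub_two_mul_sq_le hx)
    calc s i ≤ 1 / (1 + τ * α i) + κ := hsi i hi
      _ = 1 / (1 + τ * α i) * (1 + κ * (1 + τ * α i)) := by field_simp
      _ ≤ Real.exp (-(τ * α i) + 2 * (τ * α i) ^ 2) * Real.exp (κ * (1 + τ * α i)) := by
          refine mul_le_mul h1 ?_ (by positivity) (Real.exp_pos _).le
          linarith [Real.add_one_le_exp (κ * (1 + τ * α i))]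
      _ = _ := by rw [← Real.exp_add]
  have hsumα : ∑ i ∈ Finset.univ.erase i₀, α i = 1 := by
    have h : ∑ i, α i = 0 := by rw [hα, ← Finset.sum_div, ha0, zero_div]
    have h2 := Finset.add_sum_erase Finset.univ α (Finset.mem_univ i₀)
    have h3 : α i₀ = -1 := by
      rw [hα]
      simp only [ha]
      field_simp
    linarith
  have hcard : (Finset.univ.erase i₀).card = d := by
    rw [Finset.card_erase_of_mem (Finset.mem_univ _)]
    simp
  -- the numbers `α i + 1` are nonnegative and sum to `d + 1`
  have hsq : ∑ i ∈ Finset.univ.erase i₀, α i ^ 2 ≤ ((d : ℝ) + 1) ^ 2 := by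
    have h1 : ∑ i ∈ Finset.univ.erase i₀, (α i + 1) ^ 2
        ≤ (∑ i ∈ Finset.univ.erase i₀, (α i + 1)) ^ 2 :=
      Finset.sum_sq_le_sq_sum_of_nonneg fun i _ => by linarith [hα1 i]
    have h2 : ∑ i ∈ Finset.univ.erase i₀, (α i + 1) = d + 1 := by
      rw [Finset.sum_add_distrib, hsumα]
      simp [hcard]
      ring
    have h3 : ∑ i ∈ Finset.univ.erase i₀, (α i + 1) ^ 2
        = ∑ i ∈ Finset.univ.erase i₀, α i ^ 2 + 2 + d := by
      have : ∀ i, (α i + 1) ^ 2 = α i ^ 2 + 2 * α i + 1 := fun i => by ring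
      simp only [this, Finset.sum_add_distrib, ← Finset.mul_sum, hsumα]
      simp [hcard]
    rw [h2] at h1
    have : (0 : ℝ) ≤ d := by positivity
    linarith
  calc ∏ i, s i = ∏ i ∈ Finset.univ.erase i₀, s i := by
        rw [← Finset.mul_prod_erase Finset.univ s (Finset.mem_univ i₀), hs, one_mul]
    _ ≤ ∏ i ∈ Finset.univ.erase i₀,
          Real.exp (-(τ * α i) + 2 * (τ * α i) ^ 2 + κ * (1 + τ * α i)) :=
        Finset.prod_le_prod (fun i _ => (hspos i).le) hle
    _ = Real.exp (∑ i ∈ Finset.univ.erase i₀,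
          (-(τ * α i) + 2 * (τ * α i) ^ 2 + κ * (1 + τ * α i))) := by rw [Real.exp_sum]
    _ ≤ _ := by
        rw [Real.exp_le_exp]
        have h1 : ∑ i ∈ Finset.univ.erase i₀,
            (-(τ * α i) + 2 * (τ * α i) ^ 2 + κ * (1 + τ * α i))
            = -τ + 2 * τ ^ 2 * ∑ i ∈ Finset.univ.erase i₀, α i ^ 2 + κ * (d + τ) := by
          have h2 : ∀ i, -(τ * α i) + 2 * (τ * α i) ^ 2 + κ * (1 + τ * α i)
              = (κ * τ - τ) * α i + 2 * τ ^ 2 * α i ^ 2 + κ := fun i => by ring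
          simp only [h2, Finset.sum_add_distrib, ← Finset.mul_sum, hsumα]
          simp [hcard]
          ring
        rw [h1]
        have h2 : 2 * τ ^ 2 * ∑ i ∈ Finset.univ.erase i₀, α i ^ 2
            ≤ 2 * τ ^ 2 * ((d : ℝ) + 1) ^ 2 := mul_le_mul_of_nonneg_left hsq (by positivity)
        have h3 : 2 * τ ^ 2 * ((d : ℝ) + 1) ^ 2 = τ / 2 := by
          rw [hτ]
          field_simp
          ring
        have h4 : κ * (d + τ) ≤ κ * (d + 1) := mul_le_mul_of_nonneg_left (by linarith) hκ0.le
        have h5 : κ * ((d : ℝ) + 1) = τ / 4 := by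
          rw [hτ, hκ]
          field_simp
          ring
        have h6 : 1 / (16 * ((d : ℝ) + 1) ^ 2) = τ / 4 := by
          rw [hτ]
          field_simp
          ring
        rw [h6]
        linarith

end Cut

/-! ### The objective function of the dual program -/

section Objective

open scoped RealInnerProductSpace

variable {d : ℕ} {μ : Measure (Space d)} [IsFiniteMeasure μ] {Ω : Set (Space d)} {A : Space d}
  {s : ℝ}

/-- The exponential of the objective function, `∫ exp ⟪y, A - X⟫ dμ(X)`. -/
noncomputable def partition (μ : Measure (Space d)) (A y : Space d) : ℝ :=
  ∫ X, Real.exp ⟪y, A - X⟫ ∂μ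

/-- The gradient of the objective function: the mean of `A - X` under the measure `μ` tilted by
`exp ⟪y, A - X⟫`. -/
noncomputable def tiltedMean (μ : Measure (Space d)) (A y : Space d) : Space d :=
  (partition μ A y)⁻¹ • ∫ X, Real.exp ⟪y, A - X⟫ • (A - X) ∂μ

theorem ae_mem_of_compl {ν : Measure (Space d)} (hΩ : ν Ωᶜ = 0) : ∀ᵐ X ∂ν, X ∈ Ω := hΩ

theorem inner_sub_le_of_norm_le (hb : ∀ X ∈ Ω, ‖A - X‖ ≤ s) (y : Space d) {X : Space d}
    (hX : X ∈ Ω) : |⟪y, A - X⟫| ≤ ‖y‖ * s :=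
  (abs_real_inner_le_norm _ _).trans (mul_le_mul_of_nonneg_left (hb X hX) (norm_nonneg _))

/-- A continuous function which is bounded on the support is integrable. -/
theorem integrable_of_continuous_of_bound {E : Type*} [NormedAddCommGroup E] [NormedSpace ℝ E]
    [SecondCountableTopology E] [MeasurableSpace E] [BorelSpace E] (hΩ : μ Ωᶜ = 0)
    {f : Space d → E} (hf : Continuous f) (C : ℝ) (hC : ∀ X ∈ Ω, ‖f X‖ ≤ C) : Integrable f μ :=
  Integrable.of_bound hf.aestronglyMeasurable C
    ((ae_mem_of_compl hΩ).mono fun X hX => hC X hX)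

theorem exp_inner_le (hb : ∀ X ∈ Ω, ‖A - X‖ ≤ s) (y : Space d) {X : Space d} (hX : X ∈ Ω) :
    Real.exp ⟪y, A - X⟫ ≤ Real.exp (‖y‖ * s) :=
  Real.exp_le_exp.2 ((le_abs_self _).trans (inner_sub_le_of_norm_le hb y hX))

theorem integrable_exp_inner (hΩ : μ Ωᶜ = 0) (hb : ∀ X ∈ Ω, ‖A - X‖ ≤ s) (y : Space d) :
    Integrable (fun X => Real.exp ⟪y, A - X⟫) μ :=
  integrable_of_continuous_of_bound hΩ (by fun_prop) (Real.exp (‖y‖ * s)) fun X hX => by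
    rw [Real.norm_eq_abs, Real.abs_exp]
    exact exp_inner_le hb y hX

theorem integrable_exp_smul (hΩ : μ Ωᶜ = 0) (hb : ∀ X ∈ Ω, ‖A - X‖ ≤ s) (y : Space d) :
    Integrable (fun X => Real.exp ⟪y, A - X⟫ • (A - X)) μ :=
  integrable_of_continuous_of_bound hΩ (by fun_prop) (Real.exp (‖y‖ * s) * s) fun X hX => by
    rw [norm_smul, Real.norm_eq_abs, Real.abs_exp]
    exact mul_le_mul (exp_inner_le hb y hX) (hb X hX) (norm_nonneg _) (Real.exp_pos _).le

theorem partition_pos (hμ : μ ≠ 0) (hΩ : μ Ωᶜ = 0) (hb : ∀ X ∈ Ω, ‖A - X‖ ≤ s) (y : Space d) :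
    0 < partition μ A y := by
  have : NeZero μ := ⟨hμ⟩
  exact integral_exp_pos (integrable_exp_inner hΩ hb y)

theorem integral_exp_mul_inner (hμ : μ ≠ 0) (hΩ : μ Ωᶜ = 0) (hb : ∀ X ∈ Ω, ‖A - X‖ ≤ s)
    (y h : Space d) :
    ∫ X, Real.exp ⟪y, A - X⟫ * ⟪h, A - X⟫ ∂μ = partition μ A y * ⟪h, tiltedMean μ A y⟫ := by
  rw [tiltedMean, inner_smul_right, ← integral_inner (integrable_exp_smul hΩ hb y),
    mul_inv_cancel_left₀ (partition_pos hμ hΩ hb y).ne']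
  simp only [inner_smul_right]

theorem integrable_exp_mul_inner (hΩ : μ Ωᶜ = 0) (hb : ∀ X ∈ Ω, ‖A - X‖ ≤ s)
    (y h : Space d) : Integrable (fun X => Real.exp ⟪y, A - X⟫ * ⟪h, A - X⟫) μ := by
  have := (integrable_exp_smul hΩ hb y).const_inner (𝕜 := ℝ) h
  simpa only [inner_smul_right] using this

/-- The tangent bound `exp u ≥ exp m (1 + u - m)` at the mean `m`, integrated. -/
theorem partition_add_ge (hμ : μ ≠ 0) (hΩ : μ Ωᶜ = 0) (hb : ∀ X ∈ Ω, ‖A - X‖ ≤ s)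
    (y h : Space d) :
    partition μ A y * Real.exp ⟪h, tiltedMean μ A y⟫ ≤ partition μ A (y + h) := by
  set m := ⟪h, tiltedMean μ A y⟫ with hm
  have h1 := (integrable_exp_inner hΩ hb y).const_mul (Real.exp m * (1 - m))
  have h2 := (integrable_exp_mul_inner hΩ hb y h).const_mul (Real.exp m)
  have h3 : ∫ X, (Real.exp m * (1 - m) * Real.exp ⟪y, A - X⟫
      + Real.exp m * (Real.exp ⟪y, A - X⟫ * ⟪h, A - X⟫)) ∂μ = partition μ A y * Real.exp m := by
    rw [integral_add h1 h2, integral_const_mul, integral_const_mul,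
      integral_exp_mul_inner hμ hΩ hb y h, ← hm, ← partition]
    ring
  rw [← h3]
  refine integral_mono (h1.add h2) (integrable_exp_inner hΩ hb _) fun X => ?_
  have h4 := Real.add_one_le_exp (⟪h, A - X⟫ - m)
  have h5 : Real.exp ⟪y + h, A - X⟫
      = Real.exp ⟪y, A - X⟫ * (Real.exp m * Real.exp (⟪h, A - X⟫ - m)) := by
    rw [← Real.exp_add, ← Real.exp_add, inner_add_left]
    ring_nf
  simp only
  rw [h5]
  have h6 := mul_le_mul_of_nonneg_left h4
    (mul_nonneg (Real.exp_pos ⟪y, A - X⟫).le (Real.exp_pos m).le)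
  linarith

/-- The bound `exp u ≤ 1 + u + u ^ 2` for `|u| ≤ 1`, integrated. -/
theorem partition_add_le (hμ : μ ≠ 0) (hΩ : μ Ωᶜ = 0) (hb : ∀ X ∈ Ω, ‖A - X‖ ≤ s)
    (y h : Space d) (hh : ‖h‖ * s ≤ 1) :
    partition μ A (y + h)
      ≤ partition μ A y * (1 + ⟪h, tiltedMean μ A y⟫ + (‖h‖ * s) ^ 2) := by
  have h1 := (integrable_exp_inner hΩ hb y).const_mul (1 + (‖h‖ * s) ^ 2)
  have h2 := integrable_exp_mul_inner hΩ hb y h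
  have h3 : ∫ X, ((1 + (‖h‖ * s) ^ 2) * Real.exp ⟪y, A - X⟫
      + Real.exp ⟪y, A - X⟫ * ⟪h, A - X⟫) ∂μ
      = partition μ A y * (1 + ⟪h, tiltedMean μ A y⟫ + (‖h‖ * s) ^ 2) := by
    rw [integral_add h1 h2, integral_const_mul, integral_exp_mul_inner hμ hΩ hb y h, ← partition]
    ring
  rw [← h3]
  refine integral_mono_ae (integrable_exp_inner hΩ hb _) (h1.add h2)
    ((ae_mem_of_compl hΩ).mono fun X hX => ?_)
  have h4 := inner_sub_le_of_norm_le hb h hX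
  have h5 := Real.abs_exp_sub_one_sub_id_le (h4.trans hh)
  have h6 : ⟪h, A - X⟫ ^ 2 ≤ (‖h‖ * s) ^ 2 := sq_le_sq' (by linarith [neg_abs_le ⟪h, A - X⟫])
    ((le_abs_self _).trans h4)
  have h7 : Real.exp ⟪h, A - X⟫ ≤ 1 + ⟪h, A - X⟫ + (‖h‖ * s) ^ 2 := by
    linarith [le_abs_self (Real.exp ⟪h, A - X⟫ - 1 - ⟪h, A - X⟫)]
  simp only
  rw [inner_add_left, Real.exp_add]
  have := mul_le_mul_of_nonneg_left h7 (Real.exp_pos ⟪y, A - X⟫).le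
  linarith

theorem norm_tiltedMean_le (hμ : μ ≠ 0) (hΩ : μ Ωᶜ = 0) (hb : ∀ X ∈ Ω, ‖A - X‖ ≤ s)
    (y : Space d) : ‖tiltedMean μ A y‖ ≤ s := by
  have hpos := partition_pos hμ hΩ hb y
  rw [tiltedMean, norm_smul, norm_inv, Real.norm_eq_abs, abs_of_pos hpos,
    inv_mul_le_iff₀ hpos, partition, ← integral_mul_const]
  refine norm_integral_le_of_norm_le ((integrable_exp_inner hΩ hb y).mul_const s)
    ((ae_mem_of_compl hΩ).mono fun X hX => ?_)
  rw [norm_smul, Real.norm_eq_abs, Real.abs_exp]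
  exact mul_le_mul_of_nonneg_left (hb X hX) (Real.exp_pos _).le

theorem dualObjective_eq_log_partition (hΩ : μ Ωᶜ = 0) (hμ : μ ≠ 0)
    (hb : ∀ X ∈ Ω, ‖A - X‖ ≤ s) (y : Space d) :
    dualObjective μ Ω A y = Real.log (partition μ A y) := by
  have hr : μ.restrict Ω = μ := Measure.restrict_eq_self_of_ae_mem (ae_mem_of_compl hΩ)
  have h1 : partition μ A y = Real.exp ⟪y, A⟫ * ∫ X, Real.exp (-⟪y, X⟫) ∂μ := by
    rw [partition, ← integral_const_mul]
    congr 1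
    funext X
    rw [← Real.exp_add, inner_sub_right]
    ring_nf
  have hpos := partition_pos hμ hΩ hb y
  have h2 : ∫ X, Real.exp (-⟪y, X⟫) ∂μ ≠ 0 := by
    intro h
    rw [h1, h, mul_zero] at hpos
    exact hpos.false
  rw [dualObjective, expIntegral, hr, h1, Real.log_mul (Real.exp_pos _).ne' h2, Real.log_exp]

/-- Convexity: the tangent at `y` lies below the objective. -/
theorem dualObjective_add_ge_tiltedMean (hμ : μ ≠ 0) (hΩ : μ Ωᶜ = 0)
    (hb : ∀ X ∈ Ω, ‖A - X‖ ≤ s) (y h : Space d) :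
    dualObjective μ Ω A y + ⟪h, tiltedMean μ A y⟫ ≤ dualObjective μ Ω A (y + h) := by
  simp only [dualObjective_eq_log_partition hΩ hμ hb]
  have hpos := partition_pos hμ hΩ hb y
  rw [← Real.log_exp ⟪h, tiltedMean μ A y⟫, ← Real.log_mul hpos.ne' (Real.exp_pos _).ne']
  exact Real.log_le_log (mul_pos hpos (Real.exp_pos _)) (partition_add_ge hμ hΩ hb y h)

/-- Smoothness: near `y` the objective exceeds its tangent by a quadratic term at most. -/
theorem dualObjective_add_le_tiltedMean (hμ : μ ≠ 0) (hΩ : μ Ωᶜ = 0)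
    (hb : ∀ X ∈ Ω, ‖A - X‖ ≤ s) (y h : Space d) (hh : ‖h‖ * s ≤ 1) :
    dualObjective μ Ω A (y + h)
      ≤ dualObjective μ Ω A y + ⟪h, tiltedMean μ A y⟫ + (‖h‖ * s) ^ 2 := by
  simp only [dualObjective_eq_log_partition hΩ hμ hb]
  have hpos := partition_pos hμ hΩ hb y
  have h1 := partition_add_le hμ hΩ hb y h hh
  have h2 : partition μ A (y + h)
      ≤ partition μ A y * Real.exp (⟪h, tiltedMean μ A y⟫ + (‖h‖ * s) ^ 2) :=
    h1.trans (mul_le_mul_of_nonneg_left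
      (by linarith [Real.add_one_le_exp (⟪h, tiltedMean μ A y⟫ + (‖h‖ * s) ^ 2)]) hpos.le)
  calc _ ≤ Real.log (partition μ A y * Real.exp (⟪h, tiltedMean μ A y⟫ + (‖h‖ * s) ^ 2)) :=
        Real.log_le_log (partition_pos hμ hΩ hb _) h2
    _ = _ := by
        rw [Real.log_mul hpos.ne' (Real.exp_pos _).ne', Real.log_exp]
        ring

/-- Differentiability is read off from the tangent bound below and the quadratic bound above. -/
theorem hasGradientAt_dualObjective (hμ : μ ≠ 0) (hΩ : μ Ωᶜ = 0) (hs : 0 < s)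
    (hb : ∀ X ∈ Ω, ‖A - X‖ ≤ s) (y : Space d) :
    HasGradientAt (dualObjective μ Ω A) (tiltedMean μ A y) y := by
  rw [hasGradientAt_iff_hasFDerivAt, hasFDerivAt_iff_isLittleO_nhds_zero]
  have h1 : (fun h : Space d => dualObjective μ Ω A (y + h) - dualObjective μ Ω A y
      - (InnerProductSpace.toDual ℝ (Space d)) (tiltedMean μ A y) h)
      =O[nhds 0] fun h => ‖h‖ ^ 2 := by
    refine Asymptotics.IsBigO.of_bound (s ^ 2) ?_
    have hball : Metric.ball (0 : Space d) (1 / s) ∈ nhds 0 :=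
      Metric.ball_mem_nhds _ (by positivity)
    filter_upwards [hball] with h hh
    rw [mem_ball_zero_iff, lt_div_iff₀ hs] at hh
    have h2 := dualObjective_add_ge_tiltedMean hμ hΩ hb y h
    have h3 := dualObjective_add_le_tiltedMean hμ hΩ hb y h hh.le
    rw [InnerProductSpace.toDual_apply_apply, real_inner_comm, Real.norm_eq_abs, Real.norm_eq_abs,
      abs_of_nonneg (by linarith), abs_of_nonneg (by positivity)]
    linarith [mul_pow ‖h‖ s 2, mul_comm (‖h‖ ^ 2) (s ^ 2)]
  refine h1.trans_isLittleO ?_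
  exact Asymptotics.isLittleO_norm_pow_id one_lt_two

/-- The gradient returned by the oracle is that of the objective, up to the shift by `A`. -/
theorem gradient_expIntegral (hμ : μ ≠ 0) (hΩ : μ Ωᶜ = 0) (hs : 0 < s)
    (hb : ∀ X ∈ Ω, ‖A - X‖ ≤ s) (y : Space d) :
    gradient (expIntegral μ Ω) y = tiltedMean μ A y - A := by
  have h1 := (hasGradientAt_dualObjective hμ hΩ hs hb y).hasFDerivAt
  have h2 : HasFDerivAt (fun y : Space d => ⟪A, y⟫) (innerSL ℝ A) y :=
    (innerSL ℝ A).hasFDerivAt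
  have h3 : expIntegral μ Ω = fun y => dualObjective μ Ω A y - ⟪A, y⟫ := by
    funext y
    rw [dualObjective, real_inner_comm]
    ring
  rw [h3]
  refine HasGradientAt.gradient (hasGradientAt_iff_hasFDerivAt.2 ?_)
  rw [map_sub]
  exact h1.sub h2

theorem continuous_dualObjective (hμ : μ ≠ 0) (hΩ : μ Ωᶜ = 0) (hs : 0 < s)
    (hb : ∀ X ∈ Ω, ‖A - X‖ ≤ s) : Continuous (dualObjective μ Ω A) :=
  continuous_iff_continuousAt.2 fun y =>
    (hasGradientAt_dualObjective hμ hΩ hs hb y).continuousAt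

/-- A small gradient near the minimum: one gradient step of length `1 / (2 s ^ 2)`
decreases the objective by `‖∇‖ ^ 2 / (4 s ^ 2)`. -/
theorem norm_tiltedMean_sq_le (hμ : μ ≠ 0) (hΩ : μ Ωᶜ = 0) (hs : 0 < s)
    (hb : ∀ X ∈ Ω, ‖A - X‖ ≤ s) (y : Space d) {F : ℝ} (hF : ∀ x, F ≤ dualObjective μ Ω A x) :
    ‖tiltedMean μ A y‖ ^ 2 ≤ 4 * s ^ 2 * (dualObjective μ Ω A y - F) := by
  set g := tiltedMean μ A y with hg
  have hgs : ‖g‖ ≤ s := norm_tiltedMean_le hμ hΩ hb y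
  have hn : ‖(-(1 / (2 * s ^ 2))) • g‖ = ‖g‖ / (2 * s ^ 2) := by
    rw [norm_smul, norm_neg, Real.norm_eq_abs, abs_of_pos (by positivity)]
    ring
  have h1 := dualObjective_add_le_tiltedMean hμ hΩ hb y ((-(1 / (2 * s ^ 2))) • g) (by
    rw [hn, div_mul_eq_mul_div, div_le_one (by positivity)]
    nlinarith)
  rw [← hg, hn, real_inner_smul_left, real_inner_self_eq_norm_sq] at h1
  have h2 : -(1 / (2 * s ^ 2)) * ‖g‖ ^ 2 + (‖g‖ / (2 * s ^ 2) * s) ^ 2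
      = -(‖g‖ ^ 2 / (4 * s ^ 2)) := by
    field_simp
    ring
  have h3 : ‖g‖ ^ 2 / (4 * s ^ 2) ≤ dualObjective μ Ω A y - F := by
    have := hF (y + (-(1 / (2 * s ^ 2))) • g)
    linarith
  rw [div_le_iff₀ (by positivity)] at h3
  linarith

/-- The objective does not change in directions orthogonal to all `A - X`. -/
theorem dualObjective_add_of_orthogonal (hμ : μ ≠ 0) (hΩ : μ Ωᶜ = 0)
    (hb : ∀ X ∈ Ω, ‖A - X‖ ≤ s) (y w : Space d) (hw : ∀ X ∈ Ω, ⟪w, A - X⟫ = 0) :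
    dualObjective μ Ω A (y + w) = dualObjective μ Ω A y := by
  simp only [dualObjective_eq_log_partition hΩ hμ hb]
  congr 1
  refine integral_congr_ae ((ae_mem_of_compl hΩ).mono fun X hX => ?_)
  simp only [inner_add_left, hw X hX, add_zero]

end Objective

/-! ### The optimum of the dual program -/

/-- A polynomial in two variables is dominated by a power of `x + y + 1` on the naturals. -/
theorem exists_eval_le_mul_pow (f : MvPolynomial (Fin 2) ℝ) :
    ∃ c k : ℕ, ∀ x y : ℕ,
      MvPolynomial.eval ![(x : ℝ), (y : ℝ)] f ≤ c * ((x : ℝ) + y + 1) ^ k := by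
  refine ⟨⌈∑ m ∈ f.support, |f.coeff m|⌉₊, f.totalDegree, fun x y => ?_⟩
  rw [MvPolynomial.eval_eq']
  have hbase : (1 : ℝ) ≤ x + y + 1 := by
    have : (0 : ℝ) ≤ x + y := by positivity
    linarith
  calc ∑ m ∈ f.support, f.coeff m * ∏ i, ![(x : ℝ), (y : ℝ)] i ^ m i
      ≤ ∑ m ∈ f.support, |f.coeff m| * ((x : ℝ) + y + 1) ^ f.totalDegree := by
        refine Finset.sum_le_sum fun m hm => ?_
        refine mul_le_mul (le_abs_self _) ?_ (Finset.prod_nonneg fun i _ => ?_) (abs_nonneg _)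
        · calc ∏ i, ![(x : ℝ), (y : ℝ)] i ^ m i ≤ ∏ i : Fin 2, ((x : ℝ) + y + 1) ^ m i := by
                refine Finset.prod_le_prod (fun i _ => ?_) fun i _ => ?_
                · fin_cases i <;> simp
                · refine pow_le_pow_left₀ ?_ ?_ _
                  · fin_cases i <;> simp
                  · have hx : (0 : ℝ) ≤ x := by positivity
                    have hy : (0 : ℝ) ≤ y := by positivity
                    fin_cases i
                    · simp
                      linarith
                    · simp
                      linarith
            _ = ((x : ℝ) + y + 1) ^ ∑ i, m i := Finset.prod_pow_eq_pow_sum _ _ _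
            _ ≤ _ := by
                refine pow_le_pow_right₀ hbase ?_
                have := MvPolynomial.le_totalDegree hm
                rwa [Finsupp.sum_fintype _ _ fun _ => rfl] at this
        · fin_cases i <;> simp
    _ = (∑ m ∈ f.support, |f.coeff m|) * ((x : ℝ) + y + 1) ^ f.totalDegree := by
        rw [Finset.sum_mul]
    _ ≤ _ := mul_le_mul_of_nonneg_right (Nat.le_ceil _) (by positivity)

section Optimum

open scoped RealInnerProductSpace

variable {d m : ℕ} {μ : Measure (Space d)} [IsFiniteMeasure μ] {Ω : Set (Space d)} {A : Space d}
  {s η : ℝ}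

/-- The linear space `V_𝓛` as a subspace. -/
def solutionSpace (L : Matrix (Fin m) (Fin d) ℚ) : Submodule ℝ (Space d) where
  carrier := solutions L 0
  zero_mem' := by simp [solutions]
  add_mem' {x y} hx hy i := by
    have h1 := hx i
    have h2 := hy i
    simp only [Pi.zero_apply, Rat.cast_zero] at h1 h2 ⊢
    simp only [PiLp.add_apply, mul_add, Finset.sum_add_distrib, h1, h2, add_zero]
  smul_mem' c x hx i := by
    have h1 := hx i
    simp only [Pi.zero_apply, Rat.cast_zero] at h1 ⊢
    simp only [PiLp.smul_apply, smul_eq_mul, mul_left_comm _ c, ← Finset.mul_sum, h1, mul_zero]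

theorem sub_mem_solutionSpace {L : Matrix (Fin m) (Fin d) ℚ} {B : Fin m → ℚ} {x y : Space d}
    (hx : x ∈ solutions L B) (hy : y ∈ solutions L B) : x - y ∈ solutionSpace L := fun i => by
  have h1 := hx i
  have h2 := hy i
  simp only [PiLp.sub_apply, mul_sub, Finset.sum_sub_distrib, h1, h2, sub_self, Pi.zero_apply,
    Rat.cast_zero]

theorem add_mem_solutions {L : Matrix (Fin m) (Fin d) ℚ} {B : Fin m → ℚ} {x y : Space d}
    (hx : x ∈ solutions L B) (hy : y ∈ solutionSpace L) : x + y ∈ solutions L B := fun i => by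
  have h1 := hx i
  have h2 := hy i
  simp only [Pi.zero_apply, Rat.cast_zero] at h2
  simp only [PiLp.add_apply, mul_add, Finset.sum_add_distrib, h1, h2, add_zero]

/-- A point of `Ω` that lies far in the direction of `-Y`, seen from the `η`-interior point `A`. -/
theorem exists_mem_inner_ge {L : Matrix (Fin m) (Fin d) ℚ} {B : Fin m → ℚ}
    (hL : (affineSpan ℝ Ω : Set (Space d)) = solutions L B)
    (hA : InEtaInterior η (convexHull ℝ Ω) A) {Y : Space d} (hY : Y ∈ solutionSpace L)
    (hY0 : Y ≠ 0) {τ : ℝ} (hτ0 : 0 ≤ τ) (hτ : τ < η) :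
    ∃ X ∈ Ω, τ * ‖Y‖ ≤ ⟪Y, A - X⟫ := by
  have hn : 0 < ‖Y‖ := norm_pos_iff.2 hY0
  obtain ⟨hA1, hA2⟩ := hA
  rw [affineSpan_convexHull] at hA1 hA2
  rw [hL] at hA2
  have hA1 : A ∈ solutions L B := by
    rw [← hL]
    exact hA1
  -- `Z` lies in the hull, so some point of `Ω` is at least as far in the direction of `-Y`
  set Z : Space d := A + (-(τ / ‖Y‖)) • Y with hZ
  have hZmem : Z ∈ convexHull ℝ Ω := by
    refine hA2 ⟨?_, add_mem_solutions hA1 (Submodule.smul_mem _ _ hY)⟩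
    rw [Metric.mem_ball, dist_eq_norm, hZ, add_sub_cancel_left, norm_smul, norm_neg,
      Real.norm_eq_abs, abs_of_nonneg (by positivity), div_mul_cancel₀ _ hn.ne']
    exact hτ
  by_contra! hcon
  have hsub : Ω ⊆ {X | ⟪Y, A⟫ - τ * ‖Y‖ < ⟪Y, X⟫} := fun X hX => by
    have := hcon X hX
    rw [inner_sub_right] at this
    simp only [Set.mem_ofPred_eq]
    linarith
  have hconv : Convex ℝ {X : Space d | ⟪Y, A⟫ - τ * ‖Y‖ < ⟪Y, X⟫} :=
    convex_halfSpace_gt ((innerₛₗ ℝ) Y).isLinear _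
  have h := convexHull_min hsub hconv hZmem
  simp only [Set.mem_ofPred_eq, hZ, inner_add_right, inner_smul_right,
    real_inner_self_eq_norm_sq] at h
  have : -(τ / ‖Y‖) * ‖Y‖ ^ 2 = -(τ * ‖Y‖) := by field_simp
  linarith

/-- Outside of a ball the objective exceeds its value at the origin: the part of `μ` in a ball of
radius `1 / (4 h)` about a point of `Ω` in the direction of `-Y` suffices for this. -/
theorem dualObjective_zero_lt_of_lt_norm {f : MvPolynomial (Fin 2) ℝ} (hμ : μ ≠ 0)
    (hΩ : μ Ωᶜ = 0) (hb : ∀ X ∈ Ω, ‖A - X‖ ≤ s) (hf : IsBalanced f μ Ω)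
    {L : Matrix (Fin m) (Fin d) ℚ} {B : Fin m → ℚ}
    (hL : (affineSpan ℝ Ω : Set (Space d)) = solutions L B)
    (hA : InEtaInterior η (convexHull ℝ Ω) A) {h : ℕ} (hh : 0 < h) (hη : 1 / (h : ℝ) ≤ η)
    {Y : Space d} (hY : Y ∈ solutionSpace L) (hY0 : Y ≠ 0)
    (hYn : 2 * h * MvPolynomial.eval ![((4 * h : ℕ) : ℝ), (d : ℝ)] f < ‖Y‖) :
    dualObjective μ Ω A 0 < dualObjective μ Ω A Y := by
  have hh' : (0 : ℝ) < h := by exact_mod_cast hh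
  have hn : 0 < ‖Y‖ := norm_pos_iff.2 hY0
  obtain ⟨X₀, hX₀, hin⟩ := exists_mem_inner_ge hL hA hY hY0 (τ := 3 / (4 * h)) (by positivity)
    (lt_of_lt_of_le (by rw [div_lt_div_iff₀ (by positivity) hh']; linarith) hη)
  have hδ : (0 : ℝ) < 1 / (4 * h) := by positivity
  have hball := hf (1 / (4 * h)) hδ X₀ hX₀
  set E := MvPolynomial.eval ![((4 * h : ℕ) : ℝ), (d : ℝ)] f with hE
  have hE' : MvPolynomial.eval ![((1 : ℝ) / (4 * h))⁻¹, (d : ℝ)] f = E := by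
    rw [hE]
    congr
    simp
  rw [hE'] at hball
  simp only [dualObjective_eq_log_partition hΩ hμ hb]
  refine Real.log_lt_log (partition_pos hμ hΩ hb 0) ?_
  have hI0 : partition μ A 0 = μ.real Set.univ := by simp [partition]
  have hU : 0 < μ.real Set.univ := by
    rw [← hI0]
    exact partition_pos hμ hΩ hb 0
  set b := Metric.closedBall X₀ (1 / (4 * h)) with hbdef
  -- by the choice of `X₀`, the exponent is at least `(3 / (4 h) - 1 / (4 h)) ‖Y‖` on the ball `b`
  have hlow : ∀ X ∈ b, Real.exp (‖Y‖ / (2 * h)) ≤ Real.exp ⟪Y, A - X⟫ := by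
    intro X hX
    rw [Real.exp_le_exp]
    have h1 : A - X = (A - X₀) + (X₀ - X) := by abel
    have h2 : |⟪Y, X₀ - X⟫| ≤ ‖Y‖ * (1 / (4 * h)) := by
      refine (abs_real_inner_le_norm _ _).trans (mul_le_mul_of_nonneg_left ?_ hn.le)
      rw [← dist_eq_norm, dist_comm]
      exact hX
    rw [h1, inner_add_right]
    have h3 : ‖Y‖ / (2 * h) = 3 / (4 * h) * ‖Y‖ - ‖Y‖ * (1 / (4 * h)) := by
      field_simp
      ring
    linarith [neg_abs_le ⟪Y, X₀ - X⟫]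
  have hint := integrable_exp_inner hΩ hb Y
  calc partition μ A 0 = μ.real Set.univ := hI0
    _ < Real.exp (‖Y‖ / (2 * h) - E) * μ.real Set.univ := by
        have : 0 < ‖Y‖ / (2 * h) - E := by
          rw [sub_pos, lt_div_iff₀ (by positivity)]
          linarith
        nlinarith [Real.add_one_lt_exp this.ne']
    _ = Real.exp (‖Y‖ / (2 * h)) * (Real.exp (-E) * μ.real Set.univ) := by
        rw [sub_eq_add_neg, Real.exp_add]
        ring
    _ ≤ Real.exp (‖Y‖ / (2 * h)) * μ.real b :=
        mul_le_mul_of_nonneg_left hball (Real.exp_pos _).le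
    _ = ∫ _X in b, Real.exp (‖Y‖ / (2 * h)) ∂μ := by
        rw [setIntegral_const, smul_eq_mul, mul_comm]
    _ ≤ ∫ X in b, Real.exp ⟪Y, A - X⟫ ∂μ :=
        setIntegral_mono_on integrableOn_const hint.integrableOn
          Metric.isClosed_closedBall.measurableSet hlow
    _ ≤ partition μ A Y :=
        setIntegral_le_integral hint (Filter.Eventually.of_forall fun X => (Real.exp_pos _).le)

/-- The dual program has an optimum of norm at most `R`, and it is a minimum over the whole space,
since the objective is invariant under the orthogonal complement of `V_𝓛`. -/
theorem exists_minimizer {f : MvPolynomial (Fin 2) ℝ} (hμ : μ ≠ 0)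
    (hΩ : μ Ωᶜ = 0) (hs : 0 < s) (hb : ∀ X ∈ Ω, ‖A - X‖ ≤ s) (hf : IsBalanced f μ Ω)
    {L : Matrix (Fin m) (Fin d) ℚ} {B : Fin m → ℚ}
    (hL : (affineSpan ℝ Ω : Set (Space d)) = solutions L B)
    (hA : InEtaInterior η (convexHull ℝ Ω) A) {h : ℕ} (hh : 0 < h) (hη : 1 / (h : ℝ) ≤ η)
    {R : ℝ} (hR0 : 0 ≤ R)
    (hR : 2 * h * MvPolynomial.eval ![((4 * h : ℕ) : ℝ), (d : ℝ)] f ≤ R) :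
    ∃ Y ∈ solutions L 0, ‖Y‖ ≤ R ∧ ∀ x, dualObjective μ Ω A Y ≤ dualObjective μ Ω A x := by
  have hcomp : IsCompact (Metric.closedBall (0 : Space d) R ∩ solutionSpace L) :=
    (isCompact_closedBall _ _).inter_right (solutionSpace L).closed_of_finiteDimensional
  obtain ⟨Y, ⟨hYb, hYL⟩, hmin⟩ := hcomp.exists_isMinOn ⟨0, by simpa using hR0⟩
    (continuous_dualObjective hμ hΩ hs hb).continuousOn
  have hYL' : ∀ x ∈ solutionSpace L, dualObjective μ Ω A Y ≤ dualObjective μ Ω A x := by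
    intro x hx
    by_cases hxR : ‖x‖ ≤ R
    · exact hmin ⟨by simpa using hxR, hx⟩
    · rw [not_le] at hxR
      have hx0 : x ≠ 0 := norm_pos_iff.1 (hR0.trans_lt hxR)
      have h0 : dualObjective μ Ω A Y ≤ dualObjective μ Ω A 0 :=
        hmin ⟨by simpa using hR0, Submodule.zero_mem _⟩
      exact h0.trans (dualObjective_zero_lt_of_lt_norm hμ hΩ hb hf hL hA hh hη hx hx0
        (hR.trans_lt hxR)).le
  have hAL : A ∈ solutions L B := by
    rw [← hL]
    have := hA.1
    rwa [affineSpan_convexHull] at this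
  refine ⟨Y, hYL, by simpa using hYb, fun x => ?_⟩
  set K := solutionSpace L
  have h1 : dualObjective μ Ω A (K.starProjection x + (x - K.starProjection x))
      = dualObjective μ Ω A (K.starProjection x) := by
    refine dualObjective_add_of_orthogonal hμ hΩ hb _ _ fun X hX => ?_
    have hXL : X ∈ solutions L B := by
      rw [← hL]
      exact subset_affineSpan ℝ Ω hX
    rw [real_inner_comm]
    exact (K.sub_starProjection_mem_orthogonal x) _ (sub_mem_solutionSpace hAL hXL)
  rw [add_sub_cancel] at h1
  rw [h1]
  exact hYL' _ (K.starProjection_apply_mem x)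

end Optimum

/-! ### Integer projection matrices -/

section Projection

open Matrix

variable {d : ℕ} {ι : Type*} [Fintype ι] [DecidableEq ι]

/-- `det (L Lᵀ)` times the orthogonal projection onto the kernel of `L`: an integer matrix. -/
def scaledProjection (L : Matrix ι (Fin d) ℤ) : Matrix (Fin d) (Fin d) ℤ :=
  (L * Lᵀ).det • 1 - Lᵀ * (L * Lᵀ).adjugate * L

theorem mul_scaledProjection (L : Matrix ι (Fin d) ℤ) : L * scaledProjection L = 0 := by
  rw [scaledProjection, Matrix.mul_sub, Matrix.mul_smul, Matrix.mul_one, ← Matrix.mul_assoc,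
    ← Matrix.mul_assoc, Matrix.mul_adjugate, Matrix.smul_mul, Matrix.one_mul, sub_self]

theorem transpose_scaledProjection (L : Matrix ι (Fin d) ℤ) :
    (scaledProjection L)ᵀ = scaledProjection L := by
  simp [scaledProjection, Matrix.transpose_mul, Matrix.adjugate_transpose, Matrix.mul_assoc]

theorem scaledProjection_mul_transpose (L : Matrix ι (Fin d) ℤ) :
    scaledProjection L * Lᵀ = 0 := by
  have := congrArg Matrix.transpose (mul_scaledProjection L)
  rwa [Matrix.transpose_mul, transpose_scaledProjection, Matrix.transpose_zero] at this

theorem mul_scaledProjection_of_mul_transpose {m : Type*} {L : Matrix ι (Fin d) ℤ}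
    {Q : Matrix m (Fin d) ℤ} (hQ : Q * Lᵀ = 0) :
    Q * scaledProjection L = (L * Lᵀ).det • Q := by
  rw [scaledProjection, Matrix.mul_sub, Matrix.mul_smul, Matrix.mul_one, ← Matrix.mul_assoc,
    ← Matrix.mul_assoc, hQ, Matrix.zero_mul, Matrix.zero_mul, sub_zero]

theorem scaledProjection_mul_of_mul {m : Type*} {L : Matrix ι (Fin d) ℤ}
    {X : Matrix (Fin d) m ℤ} (hX : L * X = 0) :
    scaledProjection L * X = (L * Lᵀ).det • X := by
  rw [scaledProjection, Matrix.sub_mul, Matrix.smul_mul, Matrix.one_mul, Matrix.mul_assoc, hX,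
    Matrix.mul_zero, sub_zero]

theorem scaledProjection_mul_self (L : Matrix ι (Fin d) ℤ) :
    scaledProjection L * scaledProjection L = (L * Lᵀ).det • scaledProjection L :=
  mul_scaledProjection_of_mul_transpose (scaledProjection_mul_transpose L)

theorem scaledProjection_symm (L : Matrix ι (Fin d) ℤ) (i j : Fin d) :
    scaledProjection L i j = scaledProjection L j i :=
  congrFun (congrFun (transpose_scaledProjection L) j) i

/-- The entries of an orthogonal projection are at most `1`: here `P ^ 2 = D P` bounds the rows. -/
theorem abs_scaledProjection_le (L : Matrix ι (Fin d) ℤ) (hD : 0 ≤ (L * Lᵀ).det) (i j : Fin d) :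
    |scaledProjection L i j| ≤ (L * Lᵀ).det := by
  set P := scaledProjection L with hP
  set D := (L * Lᵀ).det with hDdef
  have h1 : ∑ l, P i l ^ 2 = D * P i i := by
    have := congrFun (congrFun (scaledProjection_mul_self L) i) i
    rw [Matrix.mul_apply, Matrix.smul_apply, smul_eq_mul, ← hP] at this
    rw [← this]
    exact Finset.sum_congr rfl fun l _ => by
      rw [sq, show P l i = P i l from scaledProjection_symm L l i]
  have h2 : ∀ l, P i l ^ 2 ≤ D * P i i := fun l => by
    rw [← h1]
    exact Finset.single_le_sum (f := fun l => P i l ^ 2) (fun _ _ => sq_nonneg _)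
      (Finset.mem_univ l)
  have h3 : P i i ≤ D := by
    by_contra! h
    nlinarith [h2 i]
  exact abs_le_of_sq_le_sq (by nlinarith [h2 j]) hD

/-- `L` with one more row. -/
def addRow (L : Matrix ι (Fin d) ℤ) (a : Fin d → ℤ) : Matrix (ι ⊕ Unit) (Fin d) ℤ :=
  Matrix.fromRows L (Matrix.replicateRow Unit a)

/-- The Schur complement formula for the Gram determinant with one more row. -/
theorem det_addRow {L : Matrix ι (Fin d) ℤ} (hD : (L * Lᵀ).det ≠ 0) (a : Fin d → ℤ) :
    (addRow L a * (addRow L a)ᵀ).det = a ⬝ᵥ (scaledProjection L *ᵥ a) := by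
  set G := L * Lᵀ with hG
  set r : Matrix Unit (Fin d) ℤ := Matrix.replicateRow Unit a with hr
  have h1 : addRow L a * (addRow L a)ᵀ = Matrix.fromBlocks G (L * rᵀ) (r * Lᵀ) (r * rᵀ) := by
    rw [addRow, Matrix.transpose_fromRows, Matrix.fromRows_mul_fromCols]
  have h2 : Matrix.fromBlocks G (L * rᵀ) (r * Lᵀ) (r * rᵀ)
      * Matrix.fromBlocks 1 (-(G.adjugate * (L * rᵀ))) 0 (G.det • (1 : Matrix Unit Unit ℤ))
      = Matrix.fromBlocks G 0 (r * Lᵀ) (r * scaledProjection L * rᵀ) := by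
    rw [Matrix.fromBlocks_multiply]
    congr 1
    · simp
    · rw [Matrix.mul_neg, ← Matrix.mul_assoc, Matrix.mul_adjugate, Matrix.mul_smul,
        Matrix.smul_mul, Matrix.one_mul, Matrix.mul_one, neg_add_cancel]
    · simp
    · rw [scaledProjection, Matrix.mul_smul, Matrix.mul_one, Matrix.mul_sub, Matrix.sub_mul,
        Matrix.mul_smul, Matrix.mul_one, Matrix.smul_mul, ← hG, Matrix.mul_neg]
      simp only [Matrix.mul_assoc]
      abel
  have h3 := congrArg Matrix.det h2
  rw [Matrix.det_mul, Matrix.det_fromBlocks_zero₂₁, Matrix.det_fromBlocks_zero₁₂,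
    Matrix.det_one, one_mul, Matrix.det_smul, Matrix.det_one, Fintype.card_unit, pow_one, mul_one,
    mul_comm] at h3
  rw [h1, mul_left_cancel₀ hD h3, Matrix.det_unique, hr, Matrix.mul_apply]
  simp only [Matrix.transpose_apply, Matrix.replicateRow_apply, Matrix.mul_apply, dotProduct,
    Matrix.mulVec]
  rw [Finset.sum_congr rfl fun i _ => Finset.sum_mul _ _ _, Finset.sum_comm]
  exact Finset.sum_congr rfl fun i _ => by
    rw [Finset.mul_sum]
    exact Finset.sum_congr rfl fun j _ => by ring

/-- The rank-one update of the scaled projection, with an exact division: both sides have the same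
kernel and are multiples of the same projection. -/
theorem det_smul_scaledProjection_addRow {L : Matrix ι (Fin d) ℤ} (hD : (L * Lᵀ).det ≠ 0)
    (a : Fin d → ℤ) (hD' : a ⬝ᵥ (scaledProjection L *ᵥ a) ≠ 0) (i j : Fin d) :
    (L * Lᵀ).det * scaledProjection (addRow L a) i j
      = scaledProjection L i j * (a ⬝ᵥ (scaledProjection L *ᵥ a))
        - (scaledProjection L *ᵥ a) i * (scaledProjection L *ᵥ a) j := by
  set P := scaledProjection L with hP
  set D := (L * Lᵀ).det with hDdef
  set w := P *ᵥ a with hw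
  set D' := a ⬝ᵥ w with hD'def
  set W : Matrix (Fin d) (Fin d) ℤ := Matrix.vecMulVec w w with hW
  set Q : Matrix (Fin d) (Fin d) ℤ := D' • P - W with hQ
  have hdet : (addRow L a * (addRow L a)ᵀ).det = D' := det_addRow hD a
  have hwT : a ᵥ* P = w := by
    rw [hw, ← Matrix.vecMul_transpose, hP, transpose_scaledProjection]
  have hWX : ∀ X : Matrix (Fin d) (ι ⊕ Unit) ℤ, W * X = Matrix.vecMulVec w (a ᵥ* (P * X)) := by
    intro X
    rw [hW, Matrix.vecMulVec_mul, ← Matrix.vecMul_vecMul, hwT]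
  have h1 : Q * (addRow L a)ᵀ = 0 := by
    have hPL : P * Lᵀ = 0 := scaledProjection_mul_transpose L
    have hPa : P * (addRow L a)ᵀ = Matrix.fromCols 0 (Matrix.replicateCol Unit w) := by
      rw [addRow, Matrix.transpose_fromRows, Matrix.mul_fromCols, hPL]
      congr 1
    rw [hQ, Matrix.sub_mul, hWX, Matrix.smul_mul, hPa]
    ext x y
    rcases y with y | y
    · simp [Matrix.vecMulVec_apply]
    · change D' * w x - w x * D' = 0
      ring
  have h2 := mul_scaledProjection_of_mul_transpose h1
  have h3 := mul_scaledProjection (addRow L a)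
  have h4 : Q * scaledProjection (addRow L a) = (D' * D) • scaledProjection (addRow L a) := by
    have h5 : L * scaledProjection (addRow L a) = 0 := by
      have := congrArg Matrix.toRows₁ h3
      rw [addRow, Matrix.fromRows_mul, Matrix.toRows₁_fromRows] at this
      rw [addRow, this]
      rfl
    have h6 : a ᵥ* scaledProjection (addRow L a) = 0 := by
      have := congrArg Matrix.toRows₂ h3
      conv_lhs at this => rw [addRow, Matrix.fromRows_mul, Matrix.toRows₂_fromRows]
      funext y
      have h7 := congrFun (congrFun this ()) y
      simpa [Matrix.mul_apply, Matrix.vecMul, dotProduct, addRow] using h7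
    have h7 : P * scaledProjection (addRow L a) = D • scaledProjection (addRow L a) :=
      scaledProjection_mul_of_mul h5
    have h8 : w ᵥ* scaledProjection (addRow L a) = 0 := by
      rw [← hwT, Matrix.vecMul_vecMul, h7, Matrix.vecMul_smul, h6, smul_zero]
    rw [hQ, Matrix.sub_mul, Matrix.smul_mul, h7, hW, Matrix.vecMulVec_mul, h8, smul_smul]
    simp
  rw [h4, hdet] at h2
  have h5 := congrFun (congrFun h2 i) j
  simp only [Matrix.smul_apply, smul_eq_mul, mul_assoc] at h5
  have h6 := mul_left_cancel₀ hD' h5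
  rw [h6, hQ]
  simp only [Matrix.sub_apply, Matrix.smul_apply, smul_eq_mul, hW, Matrix.vecMulVec_apply]
  ring

theorem scaledProjection_mulVec_dotProduct_self (L : Matrix ι (Fin d) ℤ) (a : Fin d → ℤ) :
    (scaledProjection L *ᵥ a) ⬝ᵥ (scaledProjection L *ᵥ a)
      = (L * Lᵀ).det * (a ⬝ᵥ (scaledProjection L *ᵥ a)) := by
  set P := scaledProjection L with hP
  have hwT : a ᵥ* P = P *ᵥ a := by
    rw [← Matrix.vecMul_transpose, hP, transpose_scaledProjection]
  calc (P *ᵥ a) ⬝ᵥ (P *ᵥ a) = (a ᵥ* P) ⬝ᵥ (P *ᵥ a) := by rw [hwT]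
    _ = a ⬝ᵥ (P *ᵥ (P *ᵥ a)) := (Matrix.dotProduct_mulVec _ _ _).symm
    _ = _ := by
        rw [Matrix.mulVec_mulVec, hP, scaledProjection_mul_self, Matrix.smul_mulVec,
          dotProduct_smul, smul_eq_mul]

/-- `D` and `P` are the Gram determinant and the scaled projection of an integer matrix whose
kernel is the common kernel of the first `k` rows `a 0, …, a (k - 1)`. -/
def IsProjectionData (a : ℕ → Fin d → ℤ) (k : ℕ) (D : ℤ) (P : Fin d → Fin d → ℤ) : Prop :=
  ∃ (ι : Type) (_ : Fintype ι) (_ : DecidableEq ι) (L : Matrix ι (Fin d) ℤ),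
    0 < D ∧ (L * Lᵀ).det = D ∧ scaledProjection L = Matrix.of P ∧
      ∀ x : Fin d → ℝ, (∀ i, ∑ j, (L i j : ℝ) * x j = 0) ↔
        ∀ l < k, ∑ j, (a l j : ℝ) * x j = 0

variable {a : ℕ → Fin d → ℤ} {k : ℕ} {D : ℤ} {P : Fin d → Fin d → ℤ}

theorem isProjectionData_zero (a : ℕ → Fin d → ℤ) :
    IsProjectionData a 0 1 fun i j => if i = j then 1 else 0 := by
  refine ⟨Empty, inferInstance, inferInstance, 0, one_pos, by simp, ?_, by simp⟩
  ext i j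
  simp [scaledProjection, Matrix.one_apply]

theorem IsProjectionData.abs_le (h : IsProjectionData a k D P) (i j : Fin d) : |P i j| ≤ D := by
  obtain ⟨ι, _, _, L, hD, hdet, hP, -⟩ := h
  have := abs_scaledProjection_le L (by rw [hdet]; exact hD.le) i j
  rwa [hP, hdet] at this

theorem IsProjectionData.sum_row_eq_zero (h : IsProjectionData a k D P) {l : ℕ} (hl : l < k)
    (y : Fin d → ℤ) : ∑ i, a l i * ∑ j, P i j * y j = 0 := by
  obtain ⟨ι, _, _, L, hD, hdet, hP, hker⟩ := h
  have h1 : L *ᵥ (Matrix.of P *ᵥ y) = 0 := by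
    rw [Matrix.mulVec_mulVec, ← hP, mul_scaledProjection, Matrix.zero_mulVec]
  have h2 := (hker fun i => ((∑ j, P i j * y j : ℤ) : ℝ)).1 (fun i => by
    have := congrFun h1 i
    exact_mod_cast this) l hl
  exact_mod_cast h2

/-- The residue of the projection is orthogonal to the common kernel of the rows. -/
theorem IsProjectionData.sum_mul_sub_eq_zero (h : IsProjectionData a k D P) {x : Fin d → ℝ}
    (hx : ∀ l < k, ∑ j, (a l j : ℝ) * x j = 0) (y : Fin d → ℤ) :
    ∑ i, x i * ((D * y i - ∑ j, P i j * y j : ℤ) : ℝ) = 0 := by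
  obtain ⟨ι, _, _, L, hD, hdet, hP, hker⟩ := h
  have hx := (hker x).2 hx
  have h1 : ∀ i, D * y i - ∑ j, P i j * y j
      = ∑ l, L l i * (((L * Lᵀ).adjugate * L) *ᵥ y) l := by
    intro i
    have h2 : Matrix.of P *ᵥ y = D • y - Lᵀ *ᵥ (((L * Lᵀ).adjugate * L) *ᵥ y) := by
      rw [← hP, scaledProjection, hdet, Matrix.sub_mulVec, Matrix.smul_mulVec, Matrix.one_mulVec,
        Matrix.mulVec_mulVec, Matrix.mul_assoc]
    have h3 := congrFun h2 i
    simp only [Matrix.mulVec, dotProduct, Matrix.of_apply, Pi.sub_apply, Pi.smul_apply,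
      smul_eq_mul, Matrix.transpose_apply] at h3 ⊢
    rw [h3]
    ring
  simp only [h1]
  push_cast
  simp only [Finset.mul_sum]
  rw [Finset.sum_comm]
  refine Finset.sum_eq_zero fun l _ => ?_
  calc _ = (∑ j, (L l j : ℝ) * x j) * ((((L * Lᵀ).adjugate * L) *ᵥ y) l : ℤ) := by
        rw [Finset.sum_mul]
        exact Finset.sum_congr rfl fun i _ => by ring
    _ = 0 := by rw [hx l, zero_mul]

/-- The update of the projection data by one more row, not in the span of the previous rows. -/
theorem IsProjectionData.step (h : IsProjectionData a k D P)
    (hind : ∃ x : Fin d → ℝ, (∀ l < k, ∑ j, (a l j : ℝ) * x j = 0) ∧ ∑ j, (a k j : ℝ) * x j ≠ 0)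
    {w : Fin d → ℤ} (hw : ∀ i, w i = ∑ j, P i j * a k j) {D' : ℤ}
    (hD' : D' = ∑ i, a k i * w i) :
    IsProjectionData a (k + 1) D' fun i j => (P i j * D' - w i * w j) / D := by
  obtain ⟨ι, _, _, L, hD, hdet, hP, hker⟩ := h
  have hw' : w = scaledProjection L *ᵥ a k := by
    funext i
    rw [hw, hP]
    rfl
  have hD'' : D' = a k ⬝ᵥ (scaledProjection L *ᵥ a k) := by
    rw [← hw', hD']
    rfl
  have hww : ∑ i, w i * w i = D * D' := by
    have := scaledProjection_mulVec_dotProduct_self L (a k)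
    rwa [← hw', hdet, hw', ← hD'', ← hw'] at this
  have hnn : 0 ≤ ∑ i, w i * w i := Finset.sum_nonneg fun i _ => mul_self_nonneg _
  -- if `D' = 0` then the new row projects to `0`, so it vanishes on the kernel of the previous rows
  have hD'0 : D' ≠ 0 := by
    intro h0
    rw [h0, mul_zero, Finset.sum_eq_zero_iff_of_nonneg fun i _ => mul_self_nonneg _] at hww
    have hw0 : ∀ i, w i = 0 := fun i => mul_self_eq_zero.1 (hww i (Finset.mem_univ i))
    obtain ⟨x, hx, hxa⟩ := hind
    have h1 := IsProjectionData.sum_mul_sub_eq_zero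
      (⟨ι, _, _, L, hD, hdet, hP, hker⟩ : IsProjectionData a k D P) hx (a k)
    simp only [← hw, hw0, sub_zero] at h1
    push_cast at h1
    refine hxa ?_
    have h2 : (D : ℝ) * ∑ j, (a k j : ℝ) * x j = 0 := by
      rw [← h1, Finset.mul_sum]
      exact Finset.sum_congr rfl fun i _ => by ring
    rcases mul_eq_zero.1 h2 with h3 | h3
    · exact absurd (by exact_mod_cast h3) hD.ne'
    · exact h3
  have hD'pos : 0 < D' := by
    have : 0 ≤ D' := by
      by_contra! h
      nlinarith
    omega
  have hdet0 : (L * Lᵀ).det ≠ 0 := by rw [hdet]; exact hD.ne'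
  refine ⟨ι ⊕ Unit, inferInstance, inferInstance, addRow L (a k), hD'pos, ?_, ?_, ?_⟩
  · rw [det_addRow hdet0, hD'']
  · ext i j
    have h1 := det_smul_scaledProjection_addRow hdet0 (a k) (by rw [← hD'']; exact hD'0) i j
    rw [← hD'', ← hw', hdet, hP] at h1
    simp only [Matrix.of_apply] at h1 ⊢
    rw [← h1, Int.mul_ediv_cancel_left _ hD.ne']
  · intro x
    have h1 : (∀ i, ∑ j, (addRow L (a k) i j : ℝ) * x j = 0) ↔
        (∀ i, ∑ j, (L i j : ℝ) * x j = 0) ∧ ∑ j, (a k j : ℝ) * x j = 0 := by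
      simp [addRow, Sum.forall]
    rw [h1, hker]
    constructor
    · rintro ⟨h2, h3⟩ l hl
      rcases Nat.lt_succ_iff_lt_or_eq.1 hl with h | rfl
      · exact h2 l h
      · exact h3
    · exact fun h2 => ⟨fun l hl => h2 l (by omega), h2 k (by omega)⟩

theorem IsProjectionData.pos (h : IsProjectionData a k D P) : 0 < D := by
  obtain ⟨_, _, _, _, hD, _⟩ := h
  exact hD

end Projection

/-! ### Loops that compute sums and fill arrays -/

theorem abs_sum_range_le {F : ℕ → ℤ} {B : ℤ} {n k : ℕ} (hF : ∀ l < n, |F l| ≤ B) (hk : k ≤ n) :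
    |∑ l ∈ Finset.range k, F l| ≤ n * B := by
  rcases Nat.eq_zero_or_pos n with rfl | hn
  · obtain rfl : k = 0 := by omega
    simp
  have hB : 0 ≤ B := (abs_nonneg _).trans (hF 0 hn)
  calc |∑ l ∈ Finset.range k, F l| ≤ ∑ l ∈ Finset.range k, |F l| := Finset.abs_sum_le_sum_abs _ _
    _ ≤ ∑ l ∈ Finset.range k, B := Finset.sum_le_sum fun l hl =>
        hF l (by have := Finset.mem_range.1 hl; omega)
    _ = k * B := by simp
    _ ≤ n * B := mul_le_mul_of_nonneg_right (by exact_mod_cast hk) hB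

namespace Runs

variable {d : ℕ} {O : Oracle d} {M β : ℕ}

/-- An accumulating loop that computes a sum; the bound `B` on the terms bounds all partial sums. -/
theorem sumLoop {acc x : ℕ} {ub e : Expr} {Q : Store → Prop} {σ : Store} (n : ℕ)
    (F : ℕ → ℤ) (B : ℤ) (hx : acc ≠ x) (hn : n ≤ M) (hnβ : (n : ℤ) < 2 ^ β)
    (hub : ∀ σ', (∀ y, y ≠ x → y ≠ acc → σ' y = σ y) → ub.eval σ' = n)
    (he : ∀ k < n, ∀ σ' : Store, (∀ y, y ≠ x → y ≠ acc → σ' y = σ y) → σ' x 0 = (k : ℤ) →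
      e.eval σ' = F k)
    (hF : ∀ k < n, |F k| ≤ B) (hB : n * B < 2 ^ β)
    (hQ : ∀ σ', (∀ y, y ≠ x → y ≠ acc → σ' y = σ y) →
      σ' acc 0 = ∑ k ∈ Finset.range n, F k → Q σ') :
    Runs O M β (.accLoop acc x 0 ub (.var acc + e)) Q σ := by
  refine accLoop n (fun k => ∑ l ∈ Finset.range k, F l) hx hn hnβ hub (by simp) ?_ ?_ hQ
  · intro k hk σ' hf h1 h2
    rw [Expr.eval_add, Expr.eval_var, h2, he k hk σ' hf h1, Finset.sum_range_succ]
  · exact fun k hk => (abs_sum_range_le hF hk).trans_lt hB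

/-- A loop whose `k`-th round changes array `y` in cell `cell k` only. -/
theorem fill {x y : ℕ} {ub : Expr} {P : Program} {Q : Store → Prop} {σ : Store} (n : ℕ)
    (cell val : ℕ → ℤ) (hcell : ∀ k l, k < n → l < k → cell k ≠ cell l)
    (hyx : y ≠ x) (hx : x ∉ P.mods) (hn : n ≤ M) (hnβ : (n : ℤ) < 2 ^ β)
    (hub : ∀ σ', (∀ y, y ≠ x → y ∉ P.mods → σ' y = σ y) → ub.eval σ' = n)
    (hstep : ∀ k < n, ∀ σ' : Store, (∀ y, y ≠ x → y ∉ P.mods → σ' y = σ y) →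
      σ' x 0 = (k : ℤ) → (∀ i, (∀ l < k, i ≠ cell l) → σ' y i = σ y i) →
      Runs O M β P (fun σ'' => σ'' y (cell k) = val k ∧ ∀ i ≠ cell k, σ'' y i = σ' y i) σ')
    (hQ : ∀ σ', (∀ y, y ≠ x → y ∉ P.mods → σ' y = σ y) → (∀ k < n, σ' y (cell k) = val k) →
      (∀ i, (∀ k < n, i ≠ cell k) → σ' y i = σ y i) → Q σ') :
    Runs O M β (.forLoop x ub P) Q σ := by
  refine forLoop n (fun k σ' => (∀ l < k, σ' y (cell l) = val l) ∧
    ∀ i, (∀ l < k, i ≠ cell l) → σ' y i = σ y i) hx hn hnβ hub ?_ ?_ ?_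
  · rw [Store.write_ne_array _ hyx]
    simp
  · intro k hk σ' hf hkx hI
    refine (hstep k hk σ' hf hkx hI.2).imp fun σ'' _ h => ?_
    rw [Store.write_ne_array _ hyx]
    refine ⟨fun l hl => ?_, fun i hi => ?_⟩
    · rcases Nat.lt_succ_iff_lt_or_eq.1 hl with h' | rfl
      · rw [h.2 _ (hcell k l hk h').symm, hI.1 l h']
      · exact h.1
    · rw [h.2 i (hi k (by omega)), hI.2 i fun l hl => hi l (by omega)]
  · exact fun σ' hf h => hQ σ' hf h.1 h.2

/-- Different rows of a matrix with rows of length `w` occupy different cells. -/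
theorem row_cell_ne {w k l i j : ℕ} (hi : i < w) (hj : j < w) (hkl : k ≠ l) :
    (k : ℤ) * w + i ≠ (l : ℤ) * w + j := by
  intro h
  apply hkl
  have h : k * w + i = l * w + j := by exact_mod_cast h
  have h1 : (k * w + i) / w = k := by
    rw [mul_comm, Nat.mul_add_div (by omega), Nat.div_eq_of_lt hi, add_zero]
  have h2 : (l * w + j) / w = l := by
    rw [mul_comm, Nat.mul_add_div (by omega), Nat.div_eq_of_lt hj, add_zero]
  rw [← h1, ← h2, h]

/-- A loop whose `k`-th round changes, in array `y`, the `k`-th row of a matrix with rows of length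
`w`. -/
theorem fillRows {x y : ℕ} {ub : Expr} {P : Program} {Q : Store → Prop} {σ : Store} (n w : ℕ)
    (val : ℕ → ℕ → ℤ) (hyx : y ≠ x) (hx : x ∉ P.mods) (hn : n ≤ M) (hnβ : (n : ℤ) < 2 ^ β)
    (hub : ∀ σ', (∀ y, y ≠ x → y ∉ P.mods → σ' y = σ y) → ub.eval σ' = n)
    (hstep : ∀ k < n, ∀ σ' : Store, (∀ y, y ≠ x → y ∉ P.mods → σ' y = σ y) →
      σ' x 0 = (k : ℤ) → (∀ j < w, σ' y (k * w + j) = σ y (k * w + j)) →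
      Runs O M β P (fun σ'' => (∀ j < w, σ'' y (k * w + j) = val k j) ∧
        ∀ l ≠ k, ∀ j < w, σ'' y (l * w + j) = σ' y (l * w + j)) σ')
    (hQ : ∀ σ', (∀ y, y ≠ x → y ∉ P.mods → σ' y = σ y) →
      (∀ k < n, ∀ j < w, σ' y (k * w + j) = val k j) → Q σ') :
    Runs O M β (.forLoop x ub P) Q σ := by
  refine forLoop n (fun k σ' => (∀ l < k, ∀ j < w, σ' y (l * w + j) = val l j) ∧
    ∀ l, k ≤ l → ∀ j < w, σ' y (l * w + j) = σ y (l * w + j)) hx hn hnβ hub ?_ ?_ ?_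
  · rw [Store.write_ne_array _ hyx]
    simp
  · intro k hk σ' hf hkx hI
    refine (hstep k hk σ' hf hkx (hI.2 k le_rfl)).imp fun σ'' _ h => ?_
    rw [Store.write_ne_array _ hyx]
    refine ⟨fun l hl j hj => ?_, fun l hl j hj => ?_⟩
    · rcases Nat.lt_succ_iff_lt_or_eq.1 hl with h' | rfl
      · rw [h.2 l h'.ne j hj, hI.1 l h' j hj]
      · exact h.1 j hj
    · rw [h.2 l (by omega) j hj, hI.2 l (by omega) j hj]
  · exact fun σ' hf h => hQ σ' hf h.1

end Runs

/-! ### The program -/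

/- The arrays used by the program, besides the input `0`, …, `6` and the output `7`. Scalars are
kept in cell `0`.
* `8`: the radius `R` of the box; `34`: the exponent of the gradient threshold; `9`: the precision
  `p`; `10`: `2 ^ p`; `11`: the threshold, scaled by `2 ^ p`;
* `12`: the common denominator of the vertices; `14`: the numerators of the `d + 1` vertices, row by
  row; `15`: the oracle question, made from the center of the simplex; `16`: the oracle answer;
* `13`: whether the gradient was small; `23`: whether the center is outside of the box; `17`: the
  normal vector of the cut; `18`: its values at the vertices; `19`, `20`: their minimum and its
  index; `21`: the apex; `22`: the scaling factor of an edge;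
* `28`, `29`: common denominator and integer multiple of a row of `𝓛`; `30`, `32`: scaled projection
  matrix and Gram determinant; `31`, `33`: image of the row and next Gram determinant;
* `24`, `25`, `27`: loop counters; `26`: an accumulator. -/

namespace Program

/-- The dimension `d`. -/
def dimE : Expr := .var 0

/-- The constant `H = 4 (d + 1) ^ 2`. -/
def flatE : Expr := 4 * ((dimE + 1) * (dimE + 1))

/-- The denominator `K = 16 (d + 1) ^ 3` of the scaling factors. -/
def denE : Expr := 4 * (dimE + 1) * flatE

/-- The `k`-th power of an expression. -/
def powE (e : Expr) : ℕ → Expr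
  | 0 => 1
  | k + 1 => powE e k * e

/-- The radius `2 h c (4 h + d + 1) ^ k + 2` of the box. -/
def radiusE (c k : ℕ) : Expr :=
  2 * .get 0 2 * (.const c * powE (4 * .get 0 2 + dimE + 1) k) + 2

/-- Entry `(i, j)` of a matrix with rows of length `d`, stored in array `x`, where `i` and `j`
are scalar variables. -/
def cellE (i j : ℕ) : Expr := .var i * dimE + .var j

/-- Computes the box, the precision and the first simplex. -/
def setup (c k : ℕ) : Program :=
  seq (assign 8 (radiusE c k)) <|
  seq (assign 34 (.get 0 3 + dimE * .var 8 + 2)) <|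
  seq (assign 9 (2 * .var 34 + 2 * .get 0 4 + dimE * .var 8 + 9)) <|
  seq (accLoop 10 27 1 (.var 9) (2 * .var 10)) <|
  seq (accLoop 11 27 1 (.var 9 - .var 34) (2 * .var 11)) <|
  seq (assign 12 1) <|
  seq (forLoop 24 (dimE + 1) (forLoop 25 dimE (set 14 (cellE 24 25) (0 - .var 8)))) <|
  forLoop 25 dimE (set 14 (cellE 25 25) (2 * dimE * .var 8 - .var 8))

/-- Computes the center of the simplex and prepares the oracle question. -/
def center : Program :=
  seq (forLoop 25 dimE <|
    seq (accLoop 26 24 0 (dimE + 1) (.var 26 + .get 14 (cellE 24 25))) (set 15 (.var 25) (.var 26))) <|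
  seq (set 15 dimE ((dimE + 1) * .var 12)) <|
  set 15 (dimE + 1) (.var 9)

/-- Finds the coordinates in which the center is outside of the box. -/
def boxCut : Program :=
  seq (assign 23 0) <|
  forLoop 25 dimE <|
    ite (.get 15 (.var 25) - .var 8 * .get 15 dimE)
      (seq (set 17 (.var 25) 1) (assign 23 1))
      (ite (0 - .get 15 (.var 25) - .var 8 * .get 15 dimE)
        (seq (set 17 (.var 25) (0 - 1)) (assign 23 1))
        (set 17 (.var 25) 0))

/-- Asks the oracle for the gradient at the center and tests whether it is small. -/
def gradientCut : Program :=
  seq (seq (query 15 16) (set 16 (.get 0 (.const 0)) (.const 0))) <|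
  seq (assign 13 1) <|
  forLoop 25 dimE <|
    seq (set 17 (.var 25) (.var 10 * .get 1 (.var 25) / .get 2 (.var 25) + .get 16 (.var 25))) <|
    ite (.get 17 (.var 25) - .var 11) (assign 13 0) <|
    ite (0 - .get 17 (.var 25) - .var 11) (assign 13 0) skip

/-- Evaluates the cut at the vertices and finds the vertex deepest inside. -/
def apex : Program :=
  seq (forLoop 24 (dimE + 1) <|
    seq (accLoop 26 25 0 dimE (.var 26 + .get 17 (.var 25) *
      ((dimE + 1) * .get 14 (cellE 24 25) - .get 15 (.var 25))))
    (set 18 (.var 24) (.var 26))) <|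
  seq (assign 19 0) <|
  seq (assign 20 0) <|
  forLoop 24 (dimE + 1) <|
    ite (.var 19 - .get 18 (.var 24)) (seq (assign 19 (.get 18 (.var 24))) (assign 20 (.var 24))) skip

/-- Scales the edges at the apex. -/
def scale : Program :=
  seq (forLoop 25 dimE (set 21 (.var 25) (.get 14 (cellE 20 25)))) <|
  seq (forLoop 24 (dimE + 1) <|
    seq (assign 22
      (denE * (0 - .var 19) * flatE / (flatE * (0 - .var 19) + .get 18 (.var 24)) + 1)) <|
    forLoop 25 dimE (set 14 (cellE 24 25)
      ((denE - .var 22) * .get 21 (.var 25) + .var 22 * .get 14 (cellE 24 25)))) <|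
  assign 12 (denE * .var 12)

/-- One round of the cutting plane method. -/
def round : Program :=
  seq center <|
  seq boxCut <|
  seq (ite (1 - .var 23) gradientCut skip) <|
  ite (1 - .var 13) (seq apex scale) skip

/-- Makes the projection matrix for one more row of `𝓛`. -/
def projectRow : Program :=
  seq (accLoop 28 25 1 dimE (.var 28 * .get 4 (cellE 27 25))) <|
  seq (forLoop 25 dimE
    (set 29 (.var 25) (.get 3 (cellE 27 25) * (.var 28 / .get 4 (cellE 27 25))))) <|
  seq (forLoop 24 dimE <|
    seq (accLoop 26 25 0 dimE (.var 26 + .get 30 (cellE 24 25) * .get 29 (.var 25)))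
      (set 31 (.var 24) (.var 26))) <|
  seq (accLoop 33 25 0 dimE (.var 33 + .get 29 (.var 25) * .get 31 (.var 25))) <|
  seq (forLoop 24 dimE <| forLoop 25 dimE <| set 30 (cellE 24 25)
    ((.get 30 (cellE 24 25) * .var 33 - .get 31 (.var 24) * .get 31 (.var 25)) / .var 32)) <|
  assign 32 (.var 33)

/-- Computes the scaled projection onto `V_𝓛`. -/
def projection : Program :=
  seq (assign 32 1) <|
  seq (forLoop 24 dimE (set 30 (cellE 24 24) 1)) <|
  forLoop 27 (.get 0 1) projectRow

/-- Writes the projection of the last center as the output. -/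
def output : Program :=
  seq (forLoop 24 dimE <|
    seq (accLoop 26 25 0 dimE (.var 26 + .get 30 (cellE 24 25) * .get 15 (.var 25)))
      (set 7 (.var 24) (.var 26))) <|
  set 7 dimE (.var 32 * .get 15 dimE)

/-- The whole program. The numbers `c` and `k` depend on the polynomial `f`. -/
def dualSolver (c k : ℕ) : Program :=
  seq (setup c k) <| seq (loop (1 - .var 13) round) <| seq projection output

end Program

/-! ### The parts of a round -/

/-- Coordinate of the normal vector that separates a center with coordinate `c / q` from the
interval `[-R, R]`. -/
def boxNormal (R q c : ℤ) : ℤ :=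
  if R * q < c then 1 else if R * q < -c then -1 else 0

theorem boxNormal_eq_zero_iff {R q c : ℤ} : boxNormal R q c = 0 ↔ |c| ≤ R * q := by
  rw [boxNormal, abs_le]
  generalize R * q = t
  split_ifs
  · simp only [one_ne_zero, false_iff, not_and]
    omega
  · simp only [false_iff, not_and]
    omega
  · simp only [true_iff]
    omega

namespace Runs

variable {d : ℕ} {O : Oracle d} {M β : ℕ} {σ : Store} {Q : Store → Prop}

theorem natCast_ne_of_lt {k l : ℕ} (h : l < k) : (k : ℤ) ≠ l := by
  exact_mod_cast h.ne'

/-- The center of the simplex, multiplied by `d + 1` and the common denominator, is the sum of the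
numerators of the vertices. -/
theorem center_spec (hdM : d + 2 ≤ M) (hM : (M : ℤ) < 2 ^ β) (hd0 : σ 0 0 = d) {W : ℤ}
    (hW : ∀ i < d + 1, ∀ j < d, |σ 14 ((i : ℤ) * d + (j : ℤ))| ≤ W) (hWβ : (d + 1) * W < 2 ^ β)
    (hden : |(d + 1) * σ 12 0| < 2 ^ β) (hp : |σ 9 0| < 2 ^ β)
    (hQ : ∀ σ' : Store, (∀ y ∉ Program.center.mods, σ' y = σ y) →
      (∀ j < d, σ' 15 (j : ℤ) = ∑ i ∈ Finset.range (d + 1), σ 14 ((i : ℤ) * d + (j : ℤ))) →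
      σ' 15 d = (d + 1) * σ 12 0 → σ' 15 (d + 1) = σ 9 0 → Q σ') :
    Runs O M β .center Q σ := by
  have hdβ : (d : ℤ) < 2 ^ β := lt_of_le_of_lt (by exact_mod_cast (by omega : d ≤ M)) hM
  have hdβ' : ((d + 1 : ℕ) : ℤ) < 2 ^ β :=
    lt_of_le_of_lt (by exact_mod_cast (by omega : d + 1 ≤ M)) hM
  suffices h : Runs O M β .center (fun σ' =>
      (∀ j < d, σ' 15 (j : ℤ) = ∑ i ∈ Finset.range (d + 1), σ 14 ((i : ℤ) * d + (j : ℤ))) ∧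
      σ' 15 d = (d + 1) * σ 12 0 ∧ σ' 15 (d + 1) = σ 9 0) σ from
    h.imp fun σ' hf h => hQ σ' hf h.1 h.2.1 h.2.2
  refine seq (fill (y := 15) d (fun k => k)
    (fun j => ∑ i ∈ Finset.range (d + 1), σ 14 ((i : ℤ) * d + (j : ℤ)))
    (fun k l _ h => natCast_ne_of_lt h) (by decide) (by decide) (by omega) hdβ
    (fun σ' hf => by simp [Program.dimE, hf 0 (by decide) (by decide), hd0]) ?_ ?_)
  · intro k hk σ' hf hkx _
    have h0 : σ' 0 0 = d := by rw [hf 0 (by decide) (by decide), hd0]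
    have h14 : σ' 14 = σ 14 := hf 14 (by decide) (by decide)
    refine seq (sumLoop (d + 1) (fun i => σ 14 ((i : ℤ) * d + (k : ℤ))) W (by decide)
      (by omega) hdβ' (fun σ₁ hf₁ => ?_) (fun i hi σ₁ hf₁ hi₁ => ?_) (fun i hi => hW i hi k hk)
      (by exact_mod_cast hWβ) fun σ₁ hf₁ hs hf₂ => ?_)
    · simp [Program.dimE, hf₁ 0 (by decide) (by decide), h0]
    · simp [Program.dimE, Program.cellE, hf₁ 0 (by decide) (by decide),
        hf₁ 14 (by decide) (by decide), hf₁ 25 (by decide) (by decide), h0, h14, hkx, hi₁]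
    · have hkx₁ : σ₁ 25 0 = k := by rw [hf₁ 25 (by decide) (by decide), hkx]
      refine set ?_ ?_
      · rw [Expr.eval_var, hs]
        refine (abs_sum_range_le (fun i hi => hW i hi k hk) le_rfl).trans_lt ?_
        exact_mod_cast hWβ
      · simp only [Expr.eval_var, hkx₁, hs]
        refine ⟨Store.write_same _ _ _ _, fun i hi => ?_⟩
        rw [Store.write_ne_cell _ _ hi, hf₁ 15 (by decide) (by decide)]
  · intro σ₁ _ hs _ hf
    have h0 : σ₁ 0 0 = d := by rw [hf 0 (by decide), hd0]
    have h12 : σ₁ 12 0 = σ 12 0 := by rw [hf 12 (by decide)]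
    have h9 : σ₁ 9 0 = σ 9 0 := by rw [hf 9 (by decide)]
    refine seq (set (by simpa [Program.dimE, h0, h12] using hden) fun hf₁ => ?_)
    refine set ?_ ?_
    · simpa [Program.dimE, Store.write, h9] using hp
    · simp only [Store.write, Program.dimE, Expr.eval_var, h0, h12, h9, Expr.eval_add,
        Expr.eval_mul, Expr.eval_one]
      refine ⟨fun j hj => ?_, ?_, ?_⟩
      · have h1 : (j : ℤ) ≠ d + 1 := by omega
        have h2 : (j : ℤ) ≠ d := by omega
        simp [h1, h2, hs j hj]
      · simp
      · simp

/-- The flag `23` tells whether the center is outside of the box, and array `17` separates it from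
the box in this case. -/
theorem boxCut_spec (hdM : d + 2 ≤ M) (hM : (M : ℤ) < 2 ^ β) (hd0 : σ 0 0 = d)
    (hQ : ∀ σ' : Store, (∀ y ∉ Program.boxCut.mods, σ' y = σ y) →
      (∀ j < d, σ' 17 (j : ℤ) = boxNormal (σ 8 0) (σ 15 d) (σ 15 (j : ℤ))) →
      (σ' 23 0 = 0 ∨ σ' 23 0 = 1) →
      (σ' 23 0 = 0 ↔ ∀ j < d, |σ 15 (j : ℤ)| ≤ σ 8 0 * σ 15 d) → Q σ') :
    Runs O M β .boxCut Q σ := by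
  have hdβ : (d : ℤ) < 2 ^ β := lt_of_le_of_lt (by exact_mod_cast (by omega : d ≤ M)) hM
  have h1β : (1 : ℤ) < 2 ^ β := lt_of_le_of_lt (by exact_mod_cast (by omega : 1 ≤ M)) hM
  suffices h : Runs O M β .boxCut (fun σ' =>
      (∀ j < d, σ' 17 (j : ℤ) = boxNormal (σ 8 0) (σ 15 d) (σ 15 (j : ℤ))) ∧
      (σ' 23 0 = 0 ∨ σ' 23 0 = 1) ∧
      (σ' 23 0 = 0 ↔ ∀ j < d, boxNormal (σ 8 0) (σ 15 d) (σ 15 (j : ℤ)) = 0)) σ from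
    h.imp fun σ' hf h => hQ σ' hf h.1 h.2.1
      (h.2.2.trans (forall₂_congr fun j _ => boxNormal_eq_zero_iff))
  refine seq (assign (by simp) fun hf₀ => ?_)
  refine forLoop d (fun k σ' =>
      (∀ j < k, σ' 17 (j : ℤ) = boxNormal (σ 8 0) (σ 15 d) (σ 15 (j : ℤ))) ∧
      (σ' 23 0 = 0 ∨ σ' 23 0 = 1) ∧
      (σ' 23 0 = 0 ↔ ∀ j < k, boxNormal (σ 8 0) (σ 15 d) (σ 15 (j : ℤ)) = 0))
    (by decide) (by omega) hdβ
    (fun σ' hf => by simp [Program.dimE, hf 0 (by decide) (by decide), Store.write, hd0])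
    (by simp [Store.write]) ?_ (fun _ _ h => h)
  intro k hk σ' hf hkx ⟨hI1, hI2, hI3⟩
  have h0 : σ' 0 0 = d := by rw [hf 0 (by decide) (by decide), hf₀ 0 (by decide), hd0]
  have h8 : σ' 8 0 = σ 8 0 := by rw [hf 8 (by decide) (by decide), hf₀ 8 (by decide)]
  have h15 : σ' 15 = σ 15 := by rw [hf 15 (by decide) (by decide), hf₀ 15 (by decide)]
  have hne : ∀ l : ℕ, l < k → (l : ℤ) ≠ k := fun l hl => (natCast_ne_of_lt hl).symm
  have hnext : ∀ (v : ℤ) (σ₁ : Store), boxNormal (σ 8 0) (σ 15 d) (σ 15 (k : ℤ)) = v →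
      σ₁ 17 = (fun i => if i = (k : ℤ) then v else σ' 17 i) →
      (σ₁ 23 0 = if v = 0 then σ' 23 0 else 1) →
      (∀ j < k + 1, σ₁ 17 (j : ℤ) = boxNormal (σ 8 0) (σ 15 d) (σ 15 (j : ℤ))) ∧
      (σ₁ 23 0 = 0 ∨ σ₁ 23 0 = 1) ∧
      (σ₁ 23 0 = 0 ↔ ∀ j < k + 1, boxNormal (σ 8 0) (σ 15 d) (σ 15 (j : ℤ)) = 0) := by
    intro v σ₁ hv h17 h23
    refine ⟨fun j hj => ?_, ?_, ?_⟩
    · rw [h17]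
      rcases Nat.lt_succ_iff_lt_or_eq.1 hj with h | rfl
      · simp [hne j h, hI1 j h]
      · simp [hv]
    · rw [h23]
      split_ifs
      exacts [hI2, Or.inr rfl]
    · rw [h23, Nat.forall_lt_succ_right, ← hI3, hv]
      split_ifs with h
      · simp [h]
      · simp [h]
  have hc : (Expr.get 15 (.var 25) - .var 8 * .get 15 Program.dimE).eval σ'
      = σ 15 k - σ 8 0 * σ 15 d := by simp [Program.dimE, h0, h8, h15, hkx]
  have hc' : (0 - Expr.get 15 (.var 25) - .var 8 * .get 15 Program.dimE).eval σ'
      = - σ 15 k - σ 8 0 * σ 15 d := by simp [Program.dimE, h0, h8, h15, hkx]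
  refine ite (fun h => ?_) fun h => ite (fun h' => ?_) fun h' => ?_
  · rw [hc] at h
    refine seq (set (by simpa using h1β) fun _ => assign (by simpa using h1β) ?_)
    refine hnext 1 _ (by rw [boxNormal, if_pos (by linarith)]) ?_ (by simp [Store.write])
    funext i
    simp [Store.write, hkx]
  · rw [hc] at h
    rw [hc'] at h'
    refine seq (set (by simpa using h1β) fun _ => assign (by simpa using h1β) ?_)
    refine hnext (-1) _ (by rw [boxNormal, if_neg (by linarith), if_pos (by linarith)]) ?_
      (by simp [Store.write])
    funext i
    simp [Store.write, hkx]
  · rw [hc] at h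
    rw [hc'] at h'
    refine set (by simp) ?_
    refine hnext 0 _ (by rw [boxNormal, if_neg (by linarith), if_neg (by linarith)]) ?_
      (by simp [Store.write])
    funext i
    simp [Store.write, hkx]

/-- The flag `13` tells whether the approximate gradient `G` is small in all coordinates; `G` is
stored as the normal vector of the next cut. -/
theorem gradientCut_spec (hdM : d + 2 ≤ M) (hM : (M : ℤ) < 2 ^ β) (hd0 : σ 0 0 = d)
    (hp : readPrec d σ 15 ≤ M) (hs : ∑ i, ⌈|readVec d σ 15 i|⌉₊ ≤ M)
    (ha : ∀ i, |(O (readVec d σ 15) (readPrec d σ 15)).2 i| < 2 ^ β) {G : ℕ → ℤ}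
    (hG : ∀ j : Fin d, G j = σ 10 0 * σ 1 (j : ℕ) / σ 2 (j : ℕ)
      + (O (readVec d σ 15) (readPrec d σ 15)).2 j)
    (hGβ : ∀ j < d, |G j| < 2 ^ β)
    (hQ : ∀ σ' : Store, (∀ y ∉ Program.gradientCut.mods, σ' y = σ y) →
      (∀ j < d, σ' 17 (j : ℤ) = G j) → (σ' 13 0 = 0 ∨ σ' 13 0 = 1) →
      (σ' 13 0 = 1 ↔ ∀ j < d, |G j| ≤ σ 11 0) → Q σ') :
    Runs O M β .gradientCut Q σ := by
  have hdβ : (d : ℤ) < 2 ^ β := lt_of_le_of_lt (by exact_mod_cast (by omega : d ≤ M)) hM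
  have h1β : (1 : ℤ) < 2 ^ β := lt_of_le_of_lt (by exact_mod_cast (by omega : 1 ≤ M)) hM
  suffices h : Runs O M β .gradientCut (fun σ' =>
      (∀ j < d, σ' 17 (j : ℤ) = G j) ∧ (σ' 13 0 = 0 ∨ σ' 13 0 = 1) ∧
      (σ' 13 0 = 1 ↔ ∀ j < d, |G j| ≤ σ 11 0)) σ from
    h.imp fun σ' hf h => hQ σ' hf h.1 h.2.1 h.2.2
  refine seq (query_erase hdM hp hs ha hd0 (by decide) fun hf₀ => ?_)
  set w := O (readVec d σ 15) (readPrec d σ 15) with hw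
  set σ₀ := (σ.writeAnswer 16 w).write 16 d 0 with hσ₀
  have h16 : ∀ j : Fin d, σ₀ 16 (j : ℕ) = w.2 j := by
    intro j
    have h1 : ((j : ℕ) : ℤ) ≠ d := by
      have := j.isLt
      omega
    simp [hσ₀, Store.write, Store.writeAnswer, h1]
  refine seq (assign (by simpa using h1β) fun hf₁ => ?_)
  refine forLoop d (fun k σ' => (∀ j < k, σ' 17 (j : ℤ) = G j) ∧
      (σ' 13 0 = 0 ∨ σ' 13 0 = 1) ∧ (σ' 13 0 = 1 ↔ ∀ j < k, |G j| ≤ σ 11 0))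
    (by decide) (by omega) hdβ
    (fun σ' hf => by
      simp [Program.dimE, hf 0 (by decide) (by decide), Store.write, ← hf₀ 0 (by decide), ← hd0])
    (by simp [Store.write]) ?_ (fun _ _ h => h)
  intro k hk σ' hf hkx ⟨hI1, hI2, hI3⟩
  have hfr : ∀ y, y ≠ 25 → y ∉ [13, 16, 17] → σ' y = σ y := by
    intro y hy hy'
    simp only [List.mem_cons, List.not_mem_nil, or_false, not_or] at hy'
    rw [hf y hy (by simp [Program.mods, Program.assign, hy'.1, hy'.2.2]),
      hf₁ y (by simp [Program.mods, Program.assign, hy'.1]),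
      hf₀ y (by simp [Program.mods, hy'.2.1])]
  have h10 := hfr 10 (by decide) (by decide)
  have h11 := hfr 11 (by decide) (by decide)
  have h1 := hfr 1 (by decide) (by decide)
  have h2 := hfr 2 (by decide) (by decide)
  have h16' : σ' 16 (k : ℤ) = w.2 ⟨k, hk⟩ := by
    rw [hf 16 (by decide) (by decide), hf₁ 16 (by decide)]
    exact h16 ⟨k, hk⟩
  have hval : (Expr.var 10 * .get 1 (.var 25) / .get 2 (.var 25) + .get 16 (.var 25)).eval σ'
      = G k := by
    rw [hG ⟨k, hk⟩]
    simp [h10, h1, h2, hkx, h16']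
  have hne : ∀ l : ℕ, l < k → (l : ℤ) ≠ k := fun l hl => (natCast_ne_of_lt hl).symm
  refine seq (set (by rw [hval]; exact hGβ k hk) fun hf₂ => ?_)
  rw [hval, Expr.eval_var, hkx]
  have hnext : ∀ σ₁ : Store, σ₁ 17 = (fun i => if i = (k : ℤ) then G k else σ' 17 i) →
      (σ₁ 13 0 = if |G k| ≤ σ 11 0 then σ' 13 0 else 0) →
      (∀ j < k + 1, σ₁ 17 (j : ℤ) = G j) ∧ (σ₁ 13 0 = 0 ∨ σ₁ 13 0 = 1) ∧
      (σ₁ 13 0 = 1 ↔ ∀ j < k + 1, |G j| ≤ σ 11 0) := by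
    intro σ₁ h17 h13
    refine ⟨fun j hj => ?_, ?_, ?_⟩
    · rw [h17]
      rcases Nat.lt_succ_iff_lt_or_eq.1 hj with h | rfl
      · simp [hne j h, hI1 j h]
      · simp
    · rw [h13]
      split_ifs
      exacts [hI2, Or.inl rfl]
    · rw [h13, Nat.forall_lt_succ_right, ← hI3]
      split_ifs with h
      · simp [h]
      · simp [h]
  have hc : (Expr.get 17 (.var 25) - .var 11).eval (σ'.write 17 k (G k)) = G k - σ 11 0 := by
    simp [Store.write, hkx, h11]
  have hc' : (0 - Expr.get 17 (.var 25) - .var 11).eval (σ'.write 17 k (G k))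
      = - G k - σ 11 0 := by
    simp [Store.write, hkx, h11]
  refine ite (fun h => ?_) fun h => ite (fun h' => ?_) fun h' => ?_
  · rw [hc] at h
    refine assign (by simp) (hnext _ ?_ ?_)
    · funext i
      simp [Store.write]
    · rw [if_neg (fun h' => by linarith [le_abs_self (G k)])]
      simp [Store.write]
  · rw [hc'] at h'
    refine assign (by simp) (hnext _ ?_ ?_)
    · funext i
      simp [Store.write]
    · rw [if_neg (fun h' => by linarith [neg_abs_le (G k)])]
      simp [Store.write]
  · rw [hc] at h
    rw [hc'] at h'
    refine skip (hnext _ ?_ ?_)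
    · funext i
      simp [Store.write]
    · rw [if_pos (abs_le.2 ⟨by linarith, by linarith⟩)]
      simp [Store.write]

/-- The values `a i` of the cut at the vertices (up to a positive factor) sum to zero, so their minimum
is negative unless all of them vanish; the search for it may therefore start with the value `0`. -/
theorem apex_spec (hdM : d + 2 ≤ M) (hM : (M : ℤ) < 2 ^ β) (hd0 : σ 0 0 = d) {a : ℕ → ℤ}
    (ha : ∀ i < d + 1, a i = ∑ j ∈ Finset.range d,
      σ 17 (j : ℤ) * ((d + 1) * σ 14 ((i : ℤ) * d + (j : ℤ)) - σ 15 (j : ℤ)))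
    {W : ℤ} (hW : ∀ i < d + 1, ∀ j < d,
      |σ 17 (j : ℤ) * ((d + 1) * σ 14 ((i : ℤ) * d + (j : ℤ)) - σ 15 (j : ℤ))| ≤ W)
    (hWβ : d * W < 2 ^ β)
    (hQ : ∀ σ' : Store, (∀ y ∉ Program.apex.mods, σ' y = σ y) →
      (∀ i < d + 1, σ' 18 (i : ℤ) = a i) → σ' 19 0 ≤ 0 → (∀ i < d + 1, σ' 19 0 ≤ a i) →
      (σ' 19 0 < 0 → ∃ i < d + 1, σ' 20 0 = i ∧ a i = σ' 19 0) → Q σ') :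
    Runs O M β .apex Q σ := by
  have hdβ : (d : ℤ) < 2 ^ β := lt_of_le_of_lt (by exact_mod_cast (by omega : d ≤ M)) hM
  have hdβ' : ((d + 1 : ℕ) : ℤ) < 2 ^ β :=
    lt_of_le_of_lt (by exact_mod_cast (by omega : d + 1 ≤ M)) hM
  have haβ : ∀ i < d + 1, |a i| < 2 ^ β := by
    intro i hi
    rw [ha i hi]
    exact (abs_sum_range_le (fun j hj => hW i hi j hj) le_rfl).trans_lt hWβ
  suffices h : Runs O M β .apex (fun σ' =>
      (∀ i < d + 1, σ' 18 (i : ℤ) = a i) ∧ σ' 19 0 ≤ 0 ∧ (∀ i < d + 1, σ' 19 0 ≤ a i) ∧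
      (σ' 19 0 < 0 → ∃ i < d + 1, σ' 20 0 = i ∧ a i = σ' 19 0)) σ from
    h.imp fun σ' hf h => hQ σ' hf h.1 h.2.1 h.2.2.1 h.2.2.2
  refine seq (fill (y := 18) (d + 1) (fun k => k) a
    (fun k l _ h => natCast_ne_of_lt h) (by decide) (by decide) (by omega) hdβ'
    (fun σ' hf => by simp [Program.dimE, hf 0 (by decide) (by decide), hd0]) ?_ ?_)
  · intro k hk σ' hf hkx _
    have h0 : σ' 0 0 = d := by rw [hf 0 (by decide) (by decide), hd0]
    have h14 : σ' 14 = σ 14 := hf 14 (by decide) (by decide)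
    have h15 : σ' 15 = σ 15 := hf 15 (by decide) (by decide)
    have h17 : σ' 17 = σ 17 := hf 17 (by decide) (by decide)
    refine seq (sumLoop d (fun j => σ 17 (j : ℤ) *
      ((d + 1) * σ 14 ((k : ℤ) * d + (j : ℤ)) - σ 15 (j : ℤ))) W (by decide)
      (by omega) hdβ (fun σ₁ hf₁ => ?_) (fun j hj σ₁ hf₁ hj₁ => ?_) (fun j hj => hW k hk j hj)
      hWβ fun σ₁ hf₁ hs hf₂ => ?_)
    · simp [Program.dimE, hf₁ 0 (by decide) (by decide), h0]
    · simp [Program.dimE, Program.cellE, hf₁ 0 (by decide) (by decide),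
        hf₁ 14 (by decide) (by decide), hf₁ 24 (by decide) (by decide),
        hf₁ 15 (by decide) (by decide), hf₁ 17 (by decide) (by decide), h0, h14, h15, h17, hkx, hj₁]
    · have hkx₁ : σ₁ 24 0 = k := by rw [hf₁ 24 (by decide) (by decide), hkx]
      rw [← ha k hk] at hs
      refine set ?_ ?_
      · rw [Expr.eval_var, hs]
        exact haβ k hk
      · simp only [Expr.eval_var, hkx₁, hs]
        refine ⟨Store.write_same _ _ _ _, fun i hi => ?_⟩
        rw [Store.write_ne_cell _ _ hi, hf₁ 18 (by decide) (by decide)]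
  · intro σ₁ _ hs _ hf
    have h0 : σ₁ 0 0 = d := by rw [hf 0 (by decide), hd0]
    refine seq (assign (by simp) fun hf₂ => seq (assign (by simp) fun hf₃ => ?_))
    refine forLoop (d + 1) (fun k σ' => (∀ i < d + 1, σ' 18 (i : ℤ) = a i) ∧ σ' 19 0 ≤ 0 ∧
      (∀ i < k, σ' 19 0 ≤ a i) ∧ (σ' 19 0 < 0 → ∃ i < d + 1, σ' 20 0 = i ∧ a i = σ' 19 0))
      (by decide) (by omega) hdβ'
      (fun σ' hf => by
        simp [Program.dimE, hf 0 (by decide) (by decide), Store.write, h0])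
      ⟨fun i hi => by simpa [Store.write] using hs i hi, by simp [Store.write], by simp,
        by simp [Store.write]⟩ ?_ (fun _ _ h => h)
    intro k hk σ' hf' hkx ⟨hI1, hI2, hI3, hI4⟩
    have hc : (Expr.var 19 - .get 18 (.var 24)).eval σ' = σ' 19 0 - a k := by
      simp [hkx, hI1 k hk]
    refine ite (fun h => ?_) fun h => ?_
    · rw [hc] at h
      have hv : (Expr.get 18 (.var 24)).eval σ' = a k := by simp [hkx, hI1 k hk]
      refine seq (assign (by rw [hv]; exact haβ k hk) fun _ => ?_)
      have hkβ : (k : ℤ) < 2 ^ β := lt_of_le_of_lt (by exact_mod_cast (by omega : k ≤ M)) hM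
      refine assign ?_ ?_
      · simpa [Store.write, hkx] using hkβ
      · rw [hv]
        have e18 : ∀ v₁ v₂ v₃ : ℤ, (((σ'.write 19 0 v₁).write 20 0 v₂).write 24 0 v₃) 18 = σ' 18 :=
          fun v₁ v₂ v₃ => by funext i; simp [Store.write]
        have e19 : ∀ v₁ v₂ v₃ : ℤ, (((σ'.write 19 0 v₁).write 20 0 v₂).write 24 0 v₃) 19 0 = v₁ :=
          fun v₁ v₂ v₃ => by simp [Store.write]
        have e20 : ∀ v₁ v₂ v₃ : ℤ, (((σ'.write 19 0 v₁).write 20 0 v₂).write 24 0 v₃) 20 0 = v₂ :=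
          fun v₁ v₂ v₃ => by simp [Store.write]
        simp only [e18, e19, e20]
        refine ⟨hI1, by linarith, fun i hi => ?_, fun _ => ⟨k, hk, ?_, rfl⟩⟩
        · rcases Nat.lt_succ_iff_lt_or_eq.1 hi with h' | rfl
          · linarith [hI3 i h']
          · exact le_rfl
        · simp [Store.write, hkx]
    · rw [hc] at h
      refine skip ?_
      simp only [Store.write_ne_array σ' (show 18 ≠ 24 by decide),
        Store.write_ne_array σ' (show 19 ≠ 24 by decide),
        Store.write_ne_array σ' (show 20 ≠ 24 by decide)]
      refine ⟨hI1, hI2, fun i hi => ?_, hI4⟩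
      rcases Nat.lt_succ_iff_lt_or_eq.1 hi with h' | rfl
      · exact hI3 i h'
      · linarith

/-- The ideal factor of edge `i`, with `m` the negative of the least cut value, is
`H m / (H m + a i)`. It is rounded up to the fraction `S i / K`. -/
theorem scale_spec (hdM : d + 2 ≤ M) (hM : (M : ℤ) < 2 ^ β) (hd0 : σ 0 0 = d) {H K : ℤ}
    (hH : H = 4 * ((d + 1) * (d + 1))) (hK : K = 4 * (d + 1) * H) {i₀ : ℕ} (hi₀ : σ 20 0 = i₀)
    {S : ℕ → ℤ} (hS : ∀ i < d + 1,
      S i = K * (0 - σ 19 0) * H / (H * (0 - σ 19 0) + σ 18 (i : ℤ)) + 1)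
    (hSβ : ∀ i < d + 1, |S i| < 2 ^ β)
    (hV0 : ∀ j < d, |σ 14 ((i₀ : ℤ) * d + (j : ℤ))| < 2 ^ β)
    (hVβ : ∀ i < d + 1, ∀ j < d, |(K - S i) * σ 14 ((i₀ : ℤ) * d + (j : ℤ))
      + S i * σ 14 ((i : ℤ) * d + (j : ℤ))| < 2 ^ β)
    (hdenβ : |K * σ 12 0| < 2 ^ β)
    (hQ : ∀ σ' : Store, (∀ y ∉ Program.scale.mods, σ' y = σ y) →
      (∀ i < d + 1, ∀ j < d, σ' 14 ((i : ℤ) * d + (j : ℤ))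
        = (K - S i) * σ 14 ((i₀ : ℤ) * d + (j : ℤ)) + S i * σ 14 ((i : ℤ) * d + (j : ℤ))) →
      σ' 12 0 = K * σ 12 0 → Q σ') :
    Runs O M β .scale Q σ := by
  have hdβ : (d : ℤ) < 2 ^ β := lt_of_le_of_lt (by exact_mod_cast (by omega : d ≤ M)) hM
  have hdβ' : ((d + 1 : ℕ) : ℤ) < 2 ^ β :=
    lt_of_le_of_lt (by exact_mod_cast (by omega : d + 1 ≤ M)) hM
  have eH : ∀ σ' : Store, σ' 0 0 = d → Program.flatE.eval σ' = H := fun σ' h => by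
    simp [Program.flatE, Program.dimE, h, hH]
  have eK : ∀ σ' : Store, σ' 0 0 = d → Program.denE.eval σ' = K := fun σ' h => by
    simp [Program.denE, eH σ' h, hK, Program.dimE, h]
  suffices h : Runs O M β .scale (fun σ' =>
      (∀ i < d + 1, ∀ j < d, σ' 14 ((i : ℤ) * d + (j : ℤ))
        = (K - S i) * σ 14 ((i₀ : ℤ) * d + (j : ℤ)) + S i * σ 14 ((i : ℤ) * d + (j : ℤ))) ∧
      σ' 12 0 = K * σ 12 0) σ from h.imp fun σ' hf h => hQ σ' hf h.1 h.2
  refine seq (fill (y := 21) d (fun k => k) (fun j => σ 14 ((i₀ : ℤ) * d + (j : ℤ)))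
    (fun k l _ h => natCast_ne_of_lt h) (by decide) (by decide) (by omega) hdβ
    (fun σ' hf => by simp [Program.dimE, hf 0 (by decide) (by decide), hd0]) ?_ ?_)
  · intro k hk σ' hf hkx _
    have hv : (Expr.get 14 (Program.cellE 20 25)).eval σ' = σ 14 ((i₀ : ℤ) * d + (k : ℤ)) := by
      simp [Program.dimE, Program.cellE, hf 0 (by decide) (by decide), hd0,
        hf 14 (by decide) (by decide), hf 20 (by decide) (by decide), hi₀, hkx]
    refine set (by rw [hv]; exact hV0 k hk) ?_
    rw [hv, Expr.eval_var, hkx]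
    exact ⟨Store.write_same _ _ _ _, fun i hi => Store.write_ne_cell _ _ hi _⟩
  intro σ₁ _ h21 _ hf₁
  have h0 : σ₁ 0 0 = d := by rw [hf₁ 0 (by decide), hd0]
  refine seq (fillRows (y := 14) (d + 1) d (fun i j => (K - S i) * σ 14 ((i₀ : ℤ) * d + (j : ℤ))
      + S i * σ 14 ((i : ℤ) * d + (j : ℤ))) (by decide) (by decide) (by omega) hdβ'
    (fun σ' hf => by simp [Program.dimE, hf 0 (by decide) (by decide), h0]) ?_ ?_)
  · intro k hk σ' hf hkx hrow
    have h0' : σ' 0 0 = d := by rw [hf 0 (by decide) (by decide), h0]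
    have h19 : σ' 19 0 = σ 19 0 := by rw [hf 19 (by decide) (by decide), hf₁ 19 (by decide)]
    have h18 : σ' 18 = σ 18 := by rw [hf 18 (by decide) (by decide), hf₁ 18 (by decide)]
    have hv : (Program.denE * (0 - .var 19) * Program.flatE /
        (Program.flatE * (0 - .var 19) + .get 18 (.var 24)) + 1 : Expr).eval σ' = S k := by
      rw [hS k hk]
      simp [eH σ' h0', eK σ' h0', h19, h18, hkx]
    refine seq (assign (by rw [hv]; exact hSβ k hk) fun hf₂ => ?_)
    rw [hv]
    refine fill (y := 14) d (fun j => (k : ℤ) * d + j)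
      (fun j => (K - S k) * σ 14 ((i₀ : ℤ) * d + (j : ℤ)) + S k * σ 14 ((k : ℤ) * d + (j : ℤ)))
      (fun j l _ h => by simpa using h.ne') (by decide) (by decide) (by omega) hdβ
      (fun σ'' hf'' => by
        simp [Program.dimE, hf'' 0 (by decide) (by decide), Store.write, h0']) ?_ ?_
    · intro j hj σ'' hf'' hjx hrest
      have h22 : σ'' 22 0 = S k := by
        rw [hf'' 22 (by decide) (by decide), Store.write_same]
      have h21' : σ'' 21 (j : ℤ) = σ 14 ((i₀ : ℤ) * d + (j : ℤ)) := by
        rw [hf'' 21 (by decide) (by decide), Store.write_ne_array _ (by decide),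
          hf 21 (by decide) (by decide), h21 j hj]
      have h24 : σ'' 24 0 = k := by
        rw [hf'' 24 (by decide) (by decide), Store.write_ne_array _ (by decide), hkx]
      have h00 : σ'' 0 0 = d := by
        rw [hf'' 0 (by decide) (by decide), Store.write_ne_array _ (by decide), h0']
      have h14 : σ'' 14 ((k : ℤ) * d + (j : ℤ)) = σ 14 ((k : ℤ) * d + (j : ℤ)) := by
        rw [hrest _ fun l hl => by simpa using hl.ne', Store.write_ne_array _ (by decide),
          hrow j hj, hf₁ 14 (by decide)]
      have hv' : ((Program.denE - .var 22) * .get 21 (.var 25)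
          + .var 22 * .get 14 (Program.cellE 24 25) : Expr).eval σ''
          = (K - S k) * σ 14 ((i₀ : ℤ) * d + (j : ℤ)) + S k * σ 14 ((k : ℤ) * d + (j : ℤ)) := by
        simp [eK σ'' h00, h22, h21', hjx, Program.cellE, h24, Program.dimE, h00, h14]
      have hcell : (Program.cellE 24 25).eval σ'' = (k : ℤ) * d + j := by
        simp [Program.cellE, Program.dimE, h24, h00, hjx]
      refine set (by rw [hv']; exact hVβ k hk j hj) ?_
      rw [hv', hcell]
      exact ⟨Store.write_same _ _ _ _, fun i hi => Store.write_ne_cell _ _ hi _⟩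
    · intro σ'' _ h1 h2
      refine ⟨h1, fun l hl j hj => ?_⟩
      rw [h2 _ fun i hi => row_cell_ne hj hi hl, Store.write_ne_array _ (by decide)]
  · intro σ₂ _ h2 hf₂
    have h12 : σ₂ 12 0 = σ 12 0 := by rw [hf₂ 12 (by decide), hf₁ 12 (by decide)]
    have hv : (Program.denE * .var 12).eval σ₂ = K * σ 12 0 := by
      rw [Expr.eval_mul, eK σ₂ (by rw [hf₂ 0 (by decide), h0]), Expr.eval_var, h12]
    refine assign (by rw [hv]; exact hdenβ) ?_
    rw [hv]
    refine ⟨fun i hi j hj => ?_, Store.write_same _ _ _ _⟩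
    rw [Store.write_ne_array _ (by decide), h2 i hi j hj]

end Runs

/-! ### The cut in integer arithmetic -/

section IntegerCut

variable {d : ℕ} {V : Fin (d + 1) → Fin d → ℤ} {q : ℤ} {g : Fin d → ℤ} {a : Fin (d + 1) → ℤ}

/-- The value of a cut through the center at a point of the simplex, in barycentric coordinates. -/
theorem sum_mul_cut (hq : 0 < q)
    (ha : ∀ i, a i = ∑ j, g j * ((d + 1) * V i j - ∑ l, V l j))
    {l : Fin (d + 1) → ℝ} (hl : ∑ i, l i = 1) {z : Fin d → ℝ}
    (hz : ∀ j, z j = ∑ i, l i * ((V i j : ℝ) / q)) :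
    ∑ i, l i * a i = (d + 1) * q *
      ∑ j, (g j : ℝ) * (z j - (∑ i, V i j : ℤ) / ((d + 1) * q : ℝ)) := by
  have hq' : (q : ℝ) ≠ 0 := by exact_mod_cast hq.ne'
  have hd' : (d : ℝ) + 1 ≠ 0 := by positivity
  have h1 : ∀ j, (d + 1) * q * ((g j : ℝ) * (z j - (∑ i, V i j : ℤ) / ((d + 1) * q : ℝ)))
      = ∑ i, l i * ((g j : ℝ) * ((d + 1) * V i j - (∑ i, V i j : ℤ))) := by
    intro j
    calc _ = (g j : ℝ) * ((d + 1) * ∑ i, l i * V i j - (∑ i, V i j : ℤ) * ∑ i, l i) := by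
          have h2 : z j = (∑ i, l i * (V i j : ℝ)) / q := by
            rw [hz, Finset.sum_div]
            exact Finset.sum_congr rfl fun i _ => by ring
          rw [h2, hl]
          field_simp
      _ = _ := by
          rw [Finset.mul_sum, Finset.mul_sum, ← Finset.sum_sub_distrib, Finset.mul_sum]
          exact Finset.sum_congr rfl fun i _ => by ring
  rw [Finset.mul_sum, Finset.sum_congr rfl fun j _ => h1 j, Finset.sum_comm]
  refine Finset.sum_congr rfl fun i _ => ?_
  rw [← Finset.mul_sum, ha]
  push_cast
  rfl

/-- A cut that keeps some point of the simplex is negative at some vertex. -/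
theorem exists_cut_neg (hq : 0 < q)
    (ha : ∀ i, a i = ∑ j, g j * ((d + 1) * V i j - ∑ l, V l j)) {z : Fin d → ℝ}
    (hz : InSimplex (fun i j => (V i j : ℝ) / q) z)
    (hcut : ∑ j, (g j : ℝ) * (z j - (∑ i, V i j : ℤ) / ((d + 1) * q : ℝ)) < 0) :
    ∃ i, a i < 0 := by
  obtain ⟨l, h0, h1, h2⟩ := hz
  by_contra! h
  have h3 := sum_mul_cut hq ha h1 h2
  have h4 : 0 ≤ ∑ i, l i * a i :=
    Finset.sum_nonneg fun i _ => mul_nonneg (h0 i) (by exact_mod_cast h i)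
  have hq' : (0 : ℝ) < q := by exact_mod_cast hq
  have h5 : ((d : ℝ) + 1) * q *
      ∑ j, (g j : ℝ) * (z j - (∑ i, V i j : ℤ) / ((d + 1) * q : ℝ)) < 0 :=
    mul_neg_of_pos_of_neg (by positivity) hcut
  linarith

variable {i₀ : Fin (d + 1)} {m H K : ℤ} {S : Fin (d + 1) → ℤ}

/-- The rounded scaling factors `S i / K` are positive, at most `3`, and exceed the ideal factors
`H m / (H m + a i)` by at most `1 / K`. -/
theorem scale_bounds (hm : 0 < m) (hmin : ∀ i, -m ≤ a i)
    (hH : H = 4 * ((d + 1) * (d + 1))) (hK : K = 4 * (d + 1) * H)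
    (hS : ∀ i, S i = K * m * H / (H * m + a i) + 1) (i : Fin (d + 1)) :
    0 < H * m + a i ∧ 0 < S i ∧ S i ≤ 3 * K ∧
      K * m * H < S i * (H * m + a i) ∧ S i * (H * m + a i) ≤ K * m * H + (H * m + a i) := by
  have hd : (0 : ℤ) ≤ d := by positivity
  have hH4 : 4 ≤ H := by rw [hH]; nlinarith
  have hK1 : 1 ≤ K := by rw [hK]; nlinarith
  have hpos : 0 < H * m + a i := by nlinarith [hmin i]
  have h1 := Int.mul_ediv_add_emod (K * m * H) (H * m + a i)
  have h2 := Int.emod_lt_of_pos (K * m * H) hpos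
  have h3 := Int.emod_nonneg (K * m * H) hpos.ne'
  have h4 : 0 ≤ K * m * H / (H * m + a i) := Int.ediv_nonneg (by positivity) hpos.le
  have h5 : K * m * H / (H * m + a i) ≤ 2 * K := by
    refine Int.ediv_le_of_le_mul hpos ?_
    have : m * H ≤ 2 * (H * m + a i) := by nlinarith [hmin i]
    nlinarith
  rw [hS]
  refine ⟨hpos, by linarith, by linarith, ?_, ?_⟩ <;> linarith

variable (i₀ K S) in
/-- The scaling factors of the edges at the apex, as real numbers. -/
noncomputable def edgeFactor (i : Fin (d + 1)) : ℝ := if i = i₀ then 1 else (S i : ℝ) / K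

theorem scaleEdges_edgeFactor (hK : 0 < K) (hq : 0 < q) :
    scaleEdges (fun i j => (V i j : ℝ) / q) i₀ (edgeFactor i₀ K S)
      = fun i j => (((K - S i) * V i₀ j + S i * V i j : ℤ) : ℝ) / (K * q : ℤ) := by
  have hK' : (K : ℝ) ≠ 0 := by exact_mod_cast hK.ne'
  have hq' : (q : ℝ) ≠ 0 := by exact_mod_cast hq.ne'
  funext i j
  rw [scaleEdges, edgeFactor]
  push_cast
  split_ifs with h
  · rw [h]
    field_simp
    ring
  · field_simp

/-- A cut through the center: the new simplex contains everything on the right side of the cut, and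
its volume is smaller by a definite factor. -/
theorem cut_step (hq : 0 < q)
    (ha : ∀ i, a i = ∑ j, g j * ((d + 1) * V i j - ∑ l, V l j)) (hm : 0 < m)
    (hi₀ : a i₀ = -m) (hmin : ∀ i, -m ≤ a i)
    (hH : H = 4 * ((d + 1) * (d + 1))) (hK : K = 4 * (d + 1) * H)
    (hS : ∀ i, S i = K * m * H / (H * m + a i) + 1) {V' : Fin (d + 1) → Fin d → ℤ}
    (hV' : ∀ i j, V' i j = (K - S i) * V i₀ j + S i * V i j) :
    (∀ z, InSimplex (fun i j => (V i j : ℝ) / q) z →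
      ∑ j, (g j : ℝ) * (z j - (∑ i, V i j : ℤ) / ((d + 1) * q : ℝ)) < 0 →
      InSimplex (fun i j => (V' i j : ℝ) / (K * q : ℤ)) z) ∧
    |(homogMatrix fun i j => (V' i j : ℝ) / (K * q : ℤ)).det|
      ≤ Real.exp (-(1 / (16 * ((d : ℝ) + 1) ^ 2))) *
        |(homogMatrix fun i j => (V i j : ℝ) / q).det| := by
  have hd : (0 : ℤ) ≤ d := by positivity
  have hHpos : 0 < H := by rw [hH]; nlinarith
  have hKpos : 0 < K := by rw [hK]; nlinarith
  have hq' : (0 : ℝ) < q := by exact_mod_cast hq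
  have hm' : (0 : ℝ) < m := by exact_mod_cast hm
  have hK' : (0 : ℝ) < K := by exact_mod_cast hKpos
  have hH' : (0 : ℝ) < H := by exact_mod_cast hHpos
  have hHr : (H : ℝ) = 4 * ((d : ℝ) + 1) ^ 2 := by
    rw [hH]
    push_cast
    ring
  have hKr : (K : ℝ) = 16 * ((d : ℝ) + 1) ^ 3 := by
    rw [hK]
    push_cast
    rw [hHr]
    ring
  have hH1 : (1 : ℝ) ≤ H := by exact_mod_cast hHpos
  have hsb := fun i => scale_bounds hm hmin hH hK hS i
  have hV : (fun i j => (V' i j : ℝ) / (K * q : ℤ))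
      = scaleEdges (fun i j => (V i j : ℝ) / q) i₀ (edgeFactor i₀ K S) := by
    rw [scaleEdges_edgeFactor hKpos hq]
    simp only [hV']
  have hs0 : edgeFactor i₀ K S i₀ = 1 := if_pos rfl
  have hspos : ∀ i, 0 < edgeFactor i₀ K S i := by
    intro i
    rw [edgeFactor]
    split_ifs
    · exact one_pos
    · exact div_pos (by exact_mod_cast (hsb i).2.1) hK'
  -- with `τ = 1 / H`, the ideal factor of an edge is the inverse of this number
  have hu : ∀ i, 1 + 1 / (H : ℝ) * ((a i : ℝ) / m) = (H * m + a i) / (H * m) := by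
    intro i
    field_simp
  have hupos : ∀ i, (0 : ℝ) < H * m + a i := fun i => by exact_mod_cast (hsb i).1
  rw [hV]
  refine ⟨fun z hz hcut => ?_, ?_⟩
  · obtain ⟨l, h0, h1, h2⟩ := hz
    have h3 := sum_mul_cut hq ha h1 h2
    have h4 : ((d : ℝ) + 1) * q *
        ∑ j, (g j : ℝ) * (z j - (∑ i, V i j : ℤ) / ((d + 1) * q : ℝ)) < 0 :=
      mul_neg_of_pos_of_neg (by positivity) hcut
    refine inSimplex_scaleEdges (a := fun i => (a i : ℝ)) (m := m) (τ := 1 / H) hs0 hm'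
      (by positivity) (by rw [div_le_one hH']; exact hH1) (by simp [hi₀]) hspos (fun i hi => ?_)
      h0 h1 (by rw [h3]; exact h4.le) h2
    rw [hu, edgeFactor, if_neg hi, one_div_div, div_le_div_iff₀
      (by exact_mod_cast (hsb i).2.1) (by positivity)]
    have := (hsb i).2.2.2.1.le
    have h5 : (K * m * H : ℝ) ≤ S i * (H * m + a i) := by exact_mod_cast this
    linarith
  · rw [det_scaleEdges _ _ _ hs0, abs_mul,
      abs_of_nonneg (Finset.prod_nonneg fun i _ => (hspos i).le)]
    refine mul_le_mul_of_nonneg_right ?_ (abs_nonneg _)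
    have ha0 : ∑ i, a i = 0 := by
      rw [Finset.sum_congr rfl fun i _ => ha i, Finset.sum_comm]
      refine Finset.sum_eq_zero fun j _ => ?_
      rw [← Finset.mul_sum, Finset.sum_sub_distrib, ← Finset.mul_sum]
      simp
    refine prod_scale_le (a := fun i => (a i : ℝ)) (m := m) (τ := 1 / H) (κ := 1 / K) hs0 hm'
      (by rw [hHr]) (by rw [hKr]) (by exact_mod_cast ha0) (by simp [hi₀])
      (fun i => by exact_mod_cast hmin i) hspos fun i hi => ?_
    rw [hu, edgeFactor, if_neg hi, one_div_div, div_add_div _ _ (hupos i).ne' hK'.ne',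
      div_le_div_iff₀ hK' (mul_pos (hupos i) hK')]
    have := (hsb i).2.2.2.2
    have h5 : (S i * (H * m + a i) : ℝ) ≤ K * m * H + (H * m + a i) := by exact_mod_cast this
    nlinarith

end IntegerCut

/-! ### The cutting plane method on the machine -/

/-- The numerators of the vertices. -/
def vertexNum (d : ℕ) (σ : Store) (i : Fin (d + 1)) (j : Fin d) : ℤ :=
  σ 14 (((i : ℕ) : ℤ) * d + ((j : ℕ) : ℤ))

/-- The vertices of the current simplex. -/
noncomputable def vertices (d : ℕ) (σ : Store) (i : Fin (d + 1)) (j : Fin d) : ℝ :=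
  (vertexNum d σ i j : ℝ) / σ 12 0

/-- The denominator `K = 16 (d + 1) ^ 3` of the scaling factors. -/
def scaleDen (d : ℕ) : ℤ := 4 * (d + 1) * (4 * ((d + 1) * (d + 1)))

/-- The integer approximation of `2 ^ p` times the gradient of the objective at `y`. -/
def approxGradient {d : ℕ} (O : Oracle d) (p : ℕ) (σ₀ : Store) (y : Fin d → ℚ) (j : Fin d) : ℤ :=
  σ₀ 10 0 * σ₀ 1 (j : ℕ) / σ₀ 2 (j : ℕ) + (O y p).2 j

theorem one_le_scaleDen (d : ℕ) : 1 ≤ scaleDen d := by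
  rw [scaleDen]
  have : (0 : ℤ) ≤ d := by positivity
  nlinarith [mul_nonneg this this, mul_nonneg this (mul_nonneg this this)]

/-- The data of a search: a small simplex `z` in the box `[-R, R]` which is never cut off, a bound
`N` on the number of rounds after which the volume would be smaller than that of `z`, and bounds
for all integers that occur. -/
structure SearchData {d : ℕ} (O : Oracle d) (M β : ℕ) (σ₀ : Store) where
  /-- the radius of the box -/
  R : ℕ
  /-- the precision of the oracle questions -/
  p : ℕ
  /-- the bound for the number of rounds -/
  N : ℕ
  /-- the threshold for the gradient -/
  Q : ℤ
  /-- a bound for the normal vectors of the cuts -/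
  GB : ℤ
  /-- a bound for the first vertices -/
  W : ℤ
  /-- the vertices of the small simplex -/
  z : Fin (d + 1) → Fin d → ℝ
  dim_eq : σ₀ 0 0 = d
  radius_eq : σ₀ 8 0 = R
  prec_eq : σ₀ 9 0 = p
  threshold_eq : σ₀ 11 0 = Q
  den_eq : σ₀ 12 0 = 1
  flag_eq : σ₀ 13 0 = 0
  one_le_W : 1 ≤ W
  one_le_GB : 1 ≤ GB
  abs_le_W : ∀ i < d + 1, ∀ j < d, |σ₀ 14 ((i : ℤ) * d + (j : ℤ))| ≤ W
  start : ∀ k, InSimplex (vertices d σ₀) (z k)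
  volume : Real.exp (-((N + 1 : ℕ) / (16 * ((d : ℝ) + 1) ^ 2))) *
    |(homogMatrix (vertices d σ₀)).det| < |(homogMatrix z).det|
  abs_z_le : ∀ k j, |z k j| ≤ R
  oracle_lt : ∀ y : Fin d → ℚ, (∀ j, |y j| ≤ R) → ∀ j, |(O y p).2 j| < 2 ^ β
  gradient_le : ∀ y : Fin d → ℚ, (∀ j, |y j| ≤ R) → ∀ j, |approxGradient O p σ₀ y j| ≤ GB
  cut : ∀ y : Fin d → ℚ, (∀ j, |y j| ≤ R) → (∀ j, |approxGradient O p σ₀ y j| ≤ Q) ∨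
    ∀ k, ∑ j, (approxGradient O p σ₀ y j : ℝ) * (z k j - y j) < 0
  dim_le : d + 2 ≤ M
  prec_le : p ≤ M
  radius_le : d * R ≤ M
  rounds_lt : N < M
  M_lt : (M : ℤ) < 2 ^ β
  bound : 2 * (d + 1) ^ 2 * GB * (W * (5 * scaleDen d) ^ (N + 1)) < 2 ^ β

namespace SearchData

variable {d : ℕ} {O : Oracle d} {M β : ℕ} {σ₀ : Store} (D : SearchData O M β σ₀)

/-- The memory after `t` rounds without a small gradient. -/
structure Running (t : ℕ) (σ : Store) : Prop where
  flag : σ 13 0 = 0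
  den : σ 12 0 = scaleDen d ^ t
  abs_le : ∀ i < d + 1, ∀ j < d,
    |σ 14 ((i : ℤ) * d + (j : ℤ))| ≤ D.W * (5 * scaleDen d) ^ t
  inSimplex : ∀ k, InSimplex (vertices d σ) (D.z k)
  volume : |(homogMatrix (vertices d σ)).det|
    ≤ Real.exp (-(t / (16 * ((d : ℝ) + 1) ^ 2))) * |(homogMatrix (vertices d σ₀)).det|

/-- The memory after a small gradient has been found. -/
structure Found (σ : Store) : Prop where
  flag : σ 13 0 = 1
  den_pos : 0 < σ 15 d
  den_le : σ 15 d ≤ (d + 1) * (D.W * (5 * scaleDen d) ^ (D.N + 1))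
  abs_le : ∀ j < d, |σ 15 (j : ℤ)| ≤ D.R * σ 15 d
  small : ∀ j, |approxGradient O D.p σ₀ (readVec d σ 15) j| ≤ D.Q

variable {D}

theorem Running.congr {t : ℕ} {σ σ' : Store} (h : D.Running t σ) (h13 : σ' 13 0 = 0)
    (h12 : σ' 12 = σ 12) (h14 : σ' 14 = σ 14) : D.Running t σ' := by
  have hv : vertices d σ' = vertices d σ := by
    funext i j
    simp [vertices, vertexNum, h12, h14]
  refine ⟨h13, ?_, ?_, ?_, ?_⟩
  · rw [h12, h.den]
  · rw [h14]
    exact h.abs_le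
  · rw [hv]
    exact h.inSimplex
  · rw [hv]
    exact h.volume

theorem running_zero : D.Running 0 σ₀ where
  flag := D.flag_eq
  den := by rw [D.den_eq, pow_zero]
  abs_le := by simpa using D.abs_le_W
  inSimplex := D.start
  volume := by simp

/-- After more than `N` rounds the simplex would have smaller volume than the simplex `z` inside. -/
theorem Running.le {t : ℕ} {σ : Store} (h : D.Running t σ) : t ≤ D.N := by
  by_contra! ht
  have h1 := abs_det_homogMatrix_le h.inSimplex
  have h2 : Real.exp (-((t : ℝ) / (16 * ((d : ℝ) + 1) ^ 2)))
      ≤ Real.exp (-((D.N + 1 : ℕ) / (16 * ((d : ℝ) + 1) ^ 2))) := by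
    rw [Real.exp_le_exp, neg_le_neg_iff]
    exact div_le_div_of_nonneg_right (by exact_mod_cast ht) (by positivity)
  have h3 := mul_le_mul_of_nonneg_right h2 (abs_nonneg (homogMatrix (vertices d σ₀)).det)
  linarith [h.volume, D.volume]

/-- The largest absolute value of a coordinate of a vertex. -/
def vertexBound (D : SearchData O M β σ₀) : ℤ := D.W * (5 * scaleDen d) ^ (D.N + 1)

theorem pow_le_vertexBound {t : ℕ} (ht : t ≤ D.N + 1) :
    D.W * (5 * scaleDen d) ^ t ≤ D.vertexBound :=
  mul_le_mul_of_nonneg_left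
    (pow_le_pow_right₀ (by have := one_le_scaleDen d; omega) ht)
    (by have := D.one_le_W; omega)

theorem scaleDen_pow_le {t : ℕ} (ht : t ≤ D.N + 1) : scaleDen d ^ t ≤ D.vertexBound := by
  refine le_trans ?_ (pow_le_vertexBound ht)
  have h1 := one_le_scaleDen d
  have h2 : scaleDen d ^ t ≤ (5 * scaleDen d) ^ t :=
    pow_le_pow_left₀ (by omega) (by omega) t
  have h3 : 0 ≤ (5 * scaleDen d) ^ t := pow_nonneg (by omega) t
  nlinarith [D.one_le_W]

theorem one_le_vertexBound : 1 ≤ D.vertexBound := by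
  have := scaleDen_pow_le (D := D) (t := 0) (by omega)
  simpa using this

theorem vertexBound_lt {a : ℤ} (ha : a ≤ 2 * (d + 1) ^ 2 * D.GB) :
    a * D.vertexBound < 2 ^ β :=
  lt_of_le_of_lt (mul_le_mul_of_nonneg_right ha (by have := one_le_vertexBound (D := D); omega))
    D.bound

theorem five_mul_scaleDen_le : 5 * scaleDen d ≤ D.vertexBound := by
  refine le_trans ?_ (pow_le_vertexBound (D := D) (t := 1) (by omega))
  rw [pow_one]
  have := one_le_scaleDen d
  nlinarith [D.one_le_W]

/-- The second half of a round: a cut through the center that keeps the small simplex. -/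
theorem Running.cutRound {t : ℕ} {σ : Store} (h : D.Running t σ) (hd0 : σ 0 0 = d)
    (hC : ∀ j < d, σ 15 (j : ℤ) = ∑ i ∈ Finset.range (d + 1), σ 14 ((i : ℤ) * d + (j : ℤ)))
    (hg : ∀ j < d, |σ 17 (j : ℤ)| ≤ D.GB)
    (hcut : ∀ k, ∑ j : Fin d, (σ 17 ((j : ℕ) : ℤ) : ℝ) *
      (D.z k j - (∑ i, vertexNum d σ i j : ℤ) / ((d + 1) * σ 12 0 : ℝ)) < 0) :
    Runs O M β (.seq .apex .scale) (D.Running (t + 1)) σ := by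
  have htN := h.le
  have hd : (0 : ℤ) ≤ d := by positivity
  have hK1 := one_le_scaleDen d
  have hG1 := D.one_le_GB
  have hW1 := one_le_vertexBound (D := D)
  have hq : 0 < σ 12 0 := by
    rw [h.den]
    exact pow_pos (by omega) t
  have hV : ∀ i < d + 1, ∀ j < d, |σ 14 ((i : ℤ) * d + (j : ℤ))| ≤ D.vertexBound :=
    fun i hi j hj => (h.abs_le i hi j hj).trans (pow_le_vertexBound (by omega))
  have hCb : ∀ j < d, |σ 15 (j : ℤ)| ≤ (d + 1) * D.vertexBound := fun j hj => by
    rw [hC j hj]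
    simpa using abs_sum_range_le (n := d + 1) (fun i hi => hV i hi j hj) le_rfl
  set a : ℕ → ℤ := fun i => ∑ j ∈ Finset.range d,
    σ 17 (j : ℤ) * ((d + 1) * σ 14 ((i : ℤ) * d + (j : ℤ)) - σ 15 (j : ℤ)) with ha
  have haF : ∀ i : Fin (d + 1), a i = ∑ j : Fin d, σ 17 ((j : ℕ) : ℤ) *
      ((d + 1) * vertexNum d σ i j - ∑ l, vertexNum d σ l j) := by
    intro i
    rw [ha]
    simp only
    rw [Finset.sum_range]
    refine Finset.sum_congr rfl fun j _ => ?_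
    rw [hC j j.isLt, Finset.sum_range]
    rfl
  refine Runs.seq (Runs.apex_spec D.dim_le D.M_lt hd0 (a := a) (fun i _ => rfl)
    (W := D.GB * (2 * (d + 1) * D.vertexBound)) (fun i hi j hj => ?_) ?_
    fun σ₁ hf₁ h18 h19 hmin hi₀ _ => ?_)
  · rw [abs_mul]
    refine mul_le_mul (hg j hj) ?_ (abs_nonneg _) (by omega)
    refine (abs_sub _ _).trans ?_
    rw [abs_mul, abs_of_nonneg (by omega : (0 : ℤ) ≤ d + 1)]
    nlinarith [hCb j hj, hV i hi j hj]
  · have := vertexBound_lt (D := D) (a := d * D.GB * (2 * (d + 1))) (by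
      have : 0 ≤ 2 * ((d : ℤ) + 1) * D.GB := by positivity
      nlinarith)
    linarith
  obtain ⟨i₁, hi₁⟩ := exists_cut_neg hq (a := fun i => a i) haF (h.inSimplex 0) (hcut 0)
  have hneg : σ₁ 19 0 < 0 := (hmin i₁ i₁.isLt).trans_lt hi₁
  obtain ⟨i₀, hi₀d, hi₀, hai₀⟩ := hi₀ hneg
  have e0 : σ₁ 0 0 = d := by rw [hf₁ 0 (by decide), hd0]
  have e12 : σ₁ 12 = σ 12 := hf₁ 12 (by decide)
  have e13 : σ₁ 13 = σ 13 := hf₁ 13 (by decide)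
  have e14 : σ₁ 14 = σ 14 := hf₁ 14 (by decide)
  set m := 0 - σ₁ 19 0 with hm
  have hmpos : 0 < m := by omega
  set H : ℤ := 4 * ((d + 1) * (d + 1)) with hH
  set K := scaleDen d with hK
  set S : ℕ → ℤ := fun i => K * m * H / (H * m + a i) + 1 with hS
  have hminF : ∀ i : Fin (d + 1), -m ≤ a i := fun i => by
    have := hmin i i.isLt
    omega
  have hsb := fun i : Fin (d + 1) => scale_bounds (a := fun i => a i) hmpos hminF hH
    (K := K) rfl (S := fun i => S i) (fun i => rfl) i
  have hSle : ∀ i < d + 1, 0 < S i ∧ S i ≤ 3 * K := fun i hi =>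
    ⟨(hsb ⟨i, hi⟩).2.1, (hsb ⟨i, hi⟩).2.2.1⟩
  have hone : D.vertexBound < 2 ^ β := by
    have := vertexBound_lt (D := D) (a := 1) (by nlinarith)
    simpa using this
  have hnew : ∀ i < d + 1, ∀ j < d, |(K - S i) * σ 14 ((i₀ : ℤ) * d + (j : ℤ))
      + S i * σ 14 ((i : ℤ) * d + (j : ℤ))| ≤ D.W * (5 * K) ^ (t + 1) := by
    intro i hi j hj
    obtain ⟨h1, h2⟩ := hSle i hi
    -- since `|K - S i| + |S i| ≤ 5 K`, the numerators grow by this factor at most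
    have h3 : |K - S i| ≤ 2 * K := _root_.abs_le.2 ⟨by omega, by omega⟩
    have h4 := h.abs_le i₀ hi₀d j hj
    have h5 := h.abs_le i hi j hj
    calc _ ≤ |K - S i| * |σ 14 ((i₀ : ℤ) * d + (j : ℤ))|
          + |S i| * |σ 14 ((i : ℤ) * d + (j : ℤ))| := by
          rw [← abs_mul, ← abs_mul]
          exact abs_add_le _ _
      _ ≤ 2 * K * (D.W * (5 * K) ^ t) + 3 * K * (D.W * (5 * K) ^ t) := by
          refine add_le_add (mul_le_mul h3 h4 (abs_nonneg _) (by omega))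
            (mul_le_mul ?_ h5 (abs_nonneg _) (by omega))
          rw [abs_of_pos h1]
          exact h2
      _ = _ := by ring
  refine Runs.scale_spec D.dim_le D.M_lt e0 hH (K := K) rfl hi₀ (S := S)
    (fun i hi => by rw [h18 i hi]) (fun i hi => ?_) (fun j hj => ?_) (fun i hi j hj => ?_) ?_
    fun σ₂ hf₂ h14 h12 => ?_
  · rw [abs_of_pos (hSle i hi).1]
    have := five_mul_scaleDen_le (D := D)
    have := (hSle i hi).2
    omega
  · rw [e14]
    exact (hV i₀ hi₀d j hj).trans_lt hone
  · rw [e14]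
    exact ((hnew i hi j hj).trans (pow_le_vertexBound (by omega))).trans_lt hone
  · rw [e12, h.den, ← pow_succ', abs_of_nonneg (pow_nonneg (by omega) _)]
    exact (scaleDen_pow_le (by omega)).trans_lt hone
  rw [e14] at h14
  rw [e12] at h12
  have hV' : ∀ i j, vertexNum d σ₂ i j
      = (K - S i) * vertexNum d σ ⟨i₀, hi₀d⟩ j + S i * vertexNum d σ i j :=
    fun i j => h14 i i.isLt j j.isLt
  obtain ⟨hin, hvol⟩ := cut_step (i₀ := ⟨i₀, hi₀d⟩) hq haF hmpos (by simp only; omega) hminF hH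
    (K := K) rfl (S := fun i => S i) (fun i => rfl) hV'
  have hvert : vertices d σ₂ = fun i j => (vertexNum d σ₂ i j : ℝ) / (K * σ 12 0 : ℤ) := by
    funext i j
    rw [vertices, h12]
  refine ⟨?_, ?_, fun i hi j hj => ?_, fun k => ?_, ?_⟩
  · rw [hf₂ 13 (by decide), e13, h.flag]
  · rw [h12, h.den, pow_succ']
  · rw [h14 i hi j hj]
    exact hnew i hi j hj
  · rw [hvert]
    exact hin _ (h.inSimplex k) (hcut k)
  · rw [hvert]
    refine hvol.trans ?_
    calc _ ≤ Real.exp (-(1 / (16 * ((d : ℝ) + 1) ^ 2))) *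
          (Real.exp (-(t / (16 * ((d : ℝ) + 1) ^ 2))) * |(homogMatrix (vertices d σ₀)).det|) :=
          mul_le_mul_of_nonneg_left h.volume (Real.exp_pos _).le
      _ = _ := by
          rw [← mul_assoc, ← Real.exp_add]
          push_cast
          ring_nf

/-- A center outside of the box is separated from it. -/
theorem boxCut_neg {R : ℝ} {q : ℤ} (hq : 0 < q) {r : ℤ} (hr : (r : ℝ) = R) {z : Fin d → ℝ}
    {c : Fin d → ℤ} (hz : ∀ j, |z j| ≤ R) (hc : ∃ j, ¬ |c j| ≤ r * q) :
    ∑ j, (boxNormal r q (c j) : ℝ) * (z j - c j / q) < 0 := by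
  have hq' : (0 : ℝ) < q := by exact_mod_cast hq
  have key : ∀ j, (boxNormal r q (c j) : ℝ) * (z j - c j / q) ≤ 0 ∧
      (¬ |c j| ≤ r * q → (boxNormal r q (c j) : ℝ) * (z j - c j / q) < 0) := by
    intro j
    obtain ⟨h1, h2⟩ := abs_le.1 (hz j)
    rw [← hr] at h1 h2
    rw [← boxNormal_eq_zero_iff, boxNormal]
    split_ifs with h3 h4
    · have h3 : (r : ℝ) < c j / q := by
        rw [lt_div_iff₀ hq']
        exact_mod_cast h3
      have : z j - c j / q < 0 := by linarith
      constructor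
      · push_cast
        linarith
      · intro _
        push_cast
        linarith
    · have h4 : (c j : ℝ) / q < -r := by
        rw [div_lt_iff₀ hq']
        have : ((r * q : ℤ) : ℝ) < (-c j : ℤ) := by exact_mod_cast h4
        push_cast at this
        linarith
      constructor
      · push_cast
        linarith
      · intro _
        push_cast
        linarith
    · simp
  obtain ⟨j, hj⟩ := hc
  exact Finset.sum_neg' (fun j _ => (key j).1) ⟨j, Finset.mem_univ j, (key j).2 hj⟩

/-- One round either finds a point with a small gradient or makes a cut: at a side of the box if the
center is outside, and by the gradient otherwise. -/
theorem Running.round {t : ℕ} {σ : Store} (h : D.Running t σ)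
    (hf : ∀ y ∉ Program.round.mods, σ y = σ₀ y) :
    Runs O M β .round (fun σ' => D.Running (t + 1) σ' ∨ D.Found σ') σ := by
  have htN := h.le
  have hd : (0 : ℤ) ≤ d := by positivity
  have hK1 := one_le_scaleDen d
  have hG1 := D.one_le_GB
  have hW1 := one_le_vertexBound (D := D)
  have hq : 0 < σ 12 0 := by
    rw [h.den]
    exact pow_pos (by omega) t
  have hqle : (d + 1) * σ 12 0 ≤ (d + 1) * D.vertexBound := by
    rw [h.den]
    exact mul_le_mul_of_nonneg_left (scaleDen_pow_le (by omega)) (by omega)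
  have hlt : ((d : ℤ) + 1) * D.vertexBound < 2 ^ β := vertexBound_lt (by nlinarith)
  have hMβ := D.M_lt
  have hd0 : σ 0 0 = d := by rw [hf 0 (by decide), D.dim_eq]
  have hp : σ 9 0 = D.p := by rw [hf 9 (by decide), D.prec_eq]
  refine Runs.seq (Runs.center_spec D.dim_le D.M_lt hd0 (W := D.vertexBound)
    (fun i hi j hj => (h.abs_le i hi j hj).trans (pow_le_vertexBound (by omega))) hlt ?_ ?_
    fun σ₁ hf₁ hC hCd hCp _ => ?_)
  · rw [abs_of_nonneg (by positivity)]
    omega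
  · rw [hp, abs_of_nonneg (by positivity)]
    exact lt_of_le_of_lt (by exact_mod_cast D.prec_le) hMβ
  have hd1 : σ₁ 0 0 = d := by rw [hf₁ 0 (by decide), hd0]
  refine Runs.seq (Runs.boxCut_spec D.dim_le D.M_lt hd1 fun σ₂ hf₂ hbn h23 h23' _ => ?_)
  have hfr : ∀ y ∉ Program.round.mods, σ₂ y = σ₀ y := by
    intro y hy
    have h1 : y ∉ Program.boxCut.mods ∧ y ∉ Program.center.mods := by
      simp only [Program.round, Program.mods, List.mem_append, not_or] at hy
      exact ⟨hy.2.1, hy.1⟩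
    rw [hf₂ y h1.1, hf₁ y h1.2, hf y hy]
  have hd2 : σ₂ 0 0 = d := by rw [hfr 0 (by decide), D.dim_eq]
  have e12 : σ₂ 12 = σ 12 := by rw [hf₂ 12 (by decide), hf₁ 12 (by decide)]
  have e13 : σ₂ 13 = σ 13 := by rw [hf₂ 13 (by decide), hf₁ 13 (by decide)]
  have e14 : σ₂ 14 = σ 14 := by rw [hf₂ 14 (by decide), hf₁ 14 (by decide)]
  have e15 : σ₂ 15 = σ₁ 15 := hf₂ 15 (by decide)
  have e8 : σ₁ 8 0 = D.R := by rw [hf₁ 8 (by decide), hf 8 (by decide), D.radius_eq]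
  have hrun₂ : D.Running t σ₂ := h.congr (by rw [e13, h.flag]) e12 e14
  have hqd : (0 : ℤ) < (d + 1) * σ 12 0 := by positivity
  have hCF : ∀ j : Fin d, σ₁ 15 ((j : ℕ) : ℤ) = ∑ i, vertexNum d σ i j := by
    intro j
    rw [hC j j.isLt, Finset.sum_range]
    rfl
  -- the common part: a cut with a normal vector stored in array `17`
  have hfinish : ∀ σ₃ : Store, σ₃ 0 = σ₂ 0 → σ₃ 12 = σ 12 → σ₃ 13 0 = 0 → σ₃ 14 = σ 14 →
      σ₃ 15 = σ₁ 15 → (∀ j < d, |σ₃ 17 (j : ℤ)| ≤ D.GB) →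
      (∀ k, ∑ j : Fin d, (σ₃ 17 ((j : ℕ) : ℤ) : ℝ) *
        (D.z k j - (σ₁ 15 ((j : ℕ) : ℤ) : ℝ) / (σ₁ 15 d : ℤ)) < 0) →
      Runs O M β (.ite (1 - .var 13) (.seq .apex .scale) .skip)
        (fun σ' => D.Running (t + 1) σ' ∨ D.Found σ') σ₃ := by
    intro σ₃ f0 f12 f13 f14 f15 hg hcut
    refine Runs.ite (fun _ => ?_) fun hc => ?_
    · refine ((h.congr f13 f12 f14).cutRound (by rw [f0, hd2]) ?_ hg fun k => ?_).imp
        fun _ _ hr => Or.inl hr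
      · rw [f14, f15]
        exact hC
      · refine lt_of_eq_of_lt (Finset.sum_congr rfl fun j _ => ?_) (hcut k)
        rw [hCF, hCd, f12]
        have : ∀ i, vertexNum d σ₃ i j = vertexNum d σ i j := fun i => by
          rw [vertexNum, f14, vertexNum]
        simp only [this]
        push_cast
        rfl
    · simp [f13] at hc
  refine Runs.seq (Runs.ite (fun hflag => ?_) fun hflag => ?_)
  · -- the center is in the box
    have h230 : σ₂ 23 0 = 0 := by
      rcases h23 with h | h
      · exact h
      · simp [h] at hflag
    have hbox := h23'.1 h230
    rw [e8] at hbox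
    set y := readVec d σ₂ 15 with hy
    have hyj : ∀ j : Fin d, y j = (σ₁ 15 ((j : ℕ) : ℤ) : ℚ) / (σ₁ 15 d : ℤ) := fun j => by
      rw [hy, readVec, e15]
    have hqd' : 0 < σ₁ 15 d := by rw [hCd]; exact hqd
    have hybox : ∀ j, |y j| ≤ D.R := by
      intro j
      have hq' : (0 : ℚ) < (σ₁ 15 d : ℤ) := by exact_mod_cast hqd'
      rw [hyj, abs_div, abs_of_pos hq', div_le_iff₀ hq']
      exact_mod_cast hbox j j.isLt
    have hprec : readPrec d σ₂ 15 = D.p := by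
      rw [readPrec, e15, hCp, hp]
      simp
    have hG : ∀ j : Fin d, σ₂ 10 0 * σ₂ 1 (j : ℕ) / σ₂ 2 (j : ℕ)
        + (O y (readPrec d σ₂ 15)).2 j = approxGradient O D.p σ₀ y j := fun j => by
      rw [approxGradient, hfr 10 (by decide), hfr 1 (by decide), hfr 2 (by decide), hprec]
    set G : ℕ → ℤ := fun j => if h : j < d then approxGradient O D.p σ₀ y ⟨j, h⟩ else 0 with hGdef
    have hGF : ∀ j : Fin d, G j = approxGradient O D.p σ₀ y j := fun j => by
      simp [hGdef, j.isLt]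
    have hGle : ∀ j < d, |G j| ≤ D.GB := fun j hj => by
      rw [hGF ⟨j, hj⟩]
      exact D.gradient_le y hybox _
    have hGβ : D.GB < 2 ^ β := by
      have := vertexBound_lt (D := D) (a := D.GB) (by
        have h1 : (1 : ℤ) ≤ (d + 1) ^ 2 := by nlinarith
        nlinarith)
      nlinarith
    refine Runs.gradientCut_spec D.dim_le D.M_lt hd2 (by rw [hprec]; exact D.prec_le) ?_ ?_
      (G := G) (fun j => by rw [hGF, ← hG]) (fun j hj => (hGle j hj).trans_lt hGβ)
      fun σ₃ hf₃ h17 h13 h13' _ => ?_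
    · refine le_trans ?_ D.radius_le
      calc ∑ i, ⌈|y i|⌉₊ ≤ ∑ _i : Fin d, D.R :=
            Finset.sum_le_sum fun i _ => Nat.ceil_le.2 (hybox i)
        _ = d * D.R := by simp
    · intro i
      rw [hprec]
      exact D.oracle_lt y hybox i
    · have g12 : σ₃ 12 = σ 12 := by rw [hf₃ 12 (by decide), e12]
      have g14 : σ₃ 14 = σ 14 := by rw [hf₃ 14 (by decide), e14]
      have g15 : σ₃ 15 = σ₁ 15 := by rw [hf₃ 15 (by decide), e15]
      have h11 : σ₂ 11 0 = D.Q := by rw [hfr 11 (by decide), D.threshold_eq]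
      rcases h13 with h130 | h131
      · refine hfinish σ₃ (hf₃ 0 (by decide)) g12 h130 g14 g15
          (fun j hj => by rw [h17 j hj]; exact hGle j hj) fun k => ?_
        rcases D.cut y hybox with hs | hc
        · exfalso
          have := h13'.2 fun j hj => by
            rw [hGF ⟨j, hj⟩, h11]
            exact hs _
          omega
        · refine lt_of_eq_of_lt (Finset.sum_congr rfl fun j _ => ?_) (hc k)
          rw [h17 j j.isLt, hGF, hyj]
          push_cast
          rfl
      · refine Runs.ite (fun hc => ?_) fun _ => Runs.skip (Or.inr ⟨h131, ?_, ?_, ?_, ?_⟩)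
        · simp [h131] at hc
        · rw [g15]
          exact hqd'
        · rw [g15, hCd]
          exact hqle
        · rw [g15]
          exact hbox
        · intro j
          have hy3 : readVec d σ₃ 15 = y := by
            rw [hy]
            funext i
            rw [readVec, readVec, g15, e15]
          rw [hy3, ← hGF, ← h11]
          exact h13'.1 h131 j j.isLt
  · -- the center is outside of the box
    have h231 : σ₂ 23 0 = 1 := by
      rcases h23 with h | h
      · simp [h] at hflag
      · exact h
    have hout : ∃ j : Fin d, ¬ |σ₁ 15 ((j : ℕ) : ℤ)| ≤ σ₁ 8 0 * σ₁ 15 d := by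
      by_contra! hall
      have := h23'.2 fun j hj => hall ⟨j, hj⟩
      omega
    refine Runs.skip fun _ => hfinish σ₂ rfl e12 (by rw [e13, h.flag]) e14 e15
      (fun j hj => ?_) fun k => ?_
    · rw [hbn j hj, boxNormal]
      split_ifs <;> simp <;> omega
    · rw [Finset.sum_congr rfl fun (j : Fin d) _ => by rw [hbn j j.isLt]]
      exact boxCut_neg (c := fun j => σ₁ 15 ((j : ℕ) : ℤ)) (by rw [hCd]; exact hqd)
        (by rw [e8]; simp) (D.abs_z_le k) hout

/-- The search halts, and finds a point of the box with a small gradient. -/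
theorem search_spec (D : SearchData O M β σ₀) {Q : Store → Prop}
    (hQ : ∀ σ' : Store, (∀ y ∉ Program.round.mods, σ' y = σ₀ y) → D.Found σ' → Q σ') :
    Runs O M β (.loop (1 - .var 13) .round) Q σ₀ := by
  refine Runs.loop (fun t σ => D.Running t σ ∨ D.Found σ) (Or.inl running_zero) ?_ ?_ ?_
  · rintro t σ _ (h | h) hc
    · exact h.le.trans_lt D.rounds_lt
    · simp [h.flag] at hc
  · rintro t σ hf (h | h) hc
    · exact h.round hf
    · simp [h.flag] at hc
  · rintro t σ hf (h | h) hc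
    · simp [h.flag] at hc
    · exact hQ σ hf h

end SearchData

/-! ### The parameters and the first simplex -/

/-- The radius of the box. The first summand bounds the norm of the minimizer, and the second leaves
room for a small simplex at it. -/
def boxRadius (c k h d : ℕ) : ℕ := 2 * h * (c * (4 * h + d + 1) ^ k) + 2

/-- The search stops when all coordinates of the gradient are below `2 ^ (-gradientExp)`,
approximately. Two points of the box differ by at most `2 R` in each coordinate, so by convexity such
a gradient allows the objective to exceed its minimum by at most `2 ^ (-e)`. -/
def gradientExp (d R e : ℕ) : ℕ := e + d * R + 2

/-- The precision of the oracle questions. If the gradient is not small, the objective exceeds its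
minimum by a multiple of `2 ^ (-2 gradientExp - 2 ρ)`, and the rounding errors, summed over the
coordinates and multiplied by the diameter of the box, have to be smaller than this. -/
def oraclePrec (d R e ρ : ℕ) : ℕ := 2 * gradientExp d R e + 2 * ρ + d * R + 9

theorem eval_powE (σ : Store) (x : Expr) (k : ℕ) :
    (Program.powE x k).eval σ = x.eval σ ^ k := by
  induction k with
  | zero => simp [Program.powE]
  | succ k ih => simp [Program.powE, ih, pow_succ]

namespace Runs

variable {d : ℕ} {O : Oracle d} {M β : ℕ} {σ : Store} {Q : Store → Prop}

/-- The first simplex is the corner simplex at `(-R, …, -R)` with legs `2 d R`, which contains the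
box. -/
theorem setup_spec {c k h e ρ : ℕ} (hdM : d + 2 ≤ M) (hM : (M : ℤ) < 2 ^ β) (h0 : σ 0 0 = d)
    (h2 : σ 0 2 = h) (h3 : σ 0 3 = e) (h4 : σ 0 4 = ρ) {R p : ℕ} (hR : R = boxRadius c k h d)
    (hp : p = oraclePrec d R e ρ) (hpM : p ≤ M) (hpβ : p < β)
    (hRβ : (2 * d * R + R : ℤ) < 2 ^ β)
    (hQ : ∀ σ' : Store, (∀ y ∉ (Program.setup c k).mods, σ' y = σ y) → σ' 8 0 = R → σ' 9 0 = p →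
      σ' 10 0 = 2 ^ p → σ' 11 0 = 2 ^ (p - gradientExp d R e) → σ' 12 0 = 1 →
      (∀ i < d + 1, ∀ j < d, σ' 14 ((i : ℤ) * d + (j : ℤ)) =
        -(R : ℤ) + if i = j then 2 * (d : ℤ) * R else 0) → Q σ') :
    Runs O M β (.setup c k) Q σ := by
  have hdβ : (d : ℤ) < 2 ^ β := lt_of_le_of_lt (by exact_mod_cast (by omega : d ≤ M)) hM
  have hdβ' : ((d + 1 : ℕ) : ℤ) < 2 ^ β :=
    lt_of_le_of_lt (by exact_mod_cast (by omega : d + 1 ≤ M)) hM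
  have h1β : (1 : ℤ) < 2 ^ β := lt_of_le_of_lt (by exact_mod_cast (by omega : 1 ≤ M)) hM
  have hpβ' : (p : ℤ) < 2 ^ β := lt_of_le_of_lt (by exact_mod_cast hpM) hM
  have hR0 : (0 : ℤ) ≤ R := by positivity
  have hdR : (0 : ℤ) ≤ 2 * d * R := by positivity
  have hRlt : (R : ℤ) < 2 ^ β := by linarith
  set th := gradientExp d R e with hth
  have hthp : th ≤ p := by
    rw [hp, oraclePrec]
    omega
  have hpow : ∀ l ≤ p, |(2 : ℤ) ^ l| < 2 ^ β := fun l hl => by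
    rw [abs_of_pos (by positivity)]
    exact pow_lt_pow_right₀ (by norm_num) (by omega)
  suffices hS : Runs O M β (.setup c k) (fun σ' => σ' 8 0 = R ∧ σ' 9 0 = p ∧
      σ' 10 0 = 2 ^ p ∧ σ' 11 0 = 2 ^ (p - th) ∧ σ' 12 0 = 1 ∧
      ∀ i < d + 1, ∀ j < d, σ' 14 ((i : ℤ) * d + (j : ℤ)) =
        -(R : ℤ) + if i = j then 2 * (d : ℤ) * R else 0) σ from
    hS.imp fun σ' hf ⟨a1, a2, a3, a4, a5, a6⟩ => hQ σ' hf a1 a2 a3 a4 a5 a6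
  have eR : (Program.radiusE c k).eval σ = R := by
    rw [hR, boxRadius]
    simp [Program.radiusE, eval_powE, Program.dimE, h0, h2]
  refine seq (assign (by rwa [eR, abs_of_nonneg hR0]) fun _ => ?_)
  rw [eR]
  set σ₁ := σ.write 8 0 R with hσ₁
  have a8 : σ₁ 8 0 = R := Store.write_same _ _ _ _
  have a0 : σ₁ 0 = σ 0 := Store.write_ne_array _ (by decide) _ _
  have eth : (.get 0 3 + Program.dimE * .var 8 + 2 : Expr).eval σ₁ = th := by
    rw [hth, gradientExp]
    simp [Program.dimE, a8, a0, h0, h3]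
  refine seq (assign (by
    rw [eth, abs_of_nonneg (by positivity)]
    exact lt_of_le_of_lt (by exact_mod_cast hthp) hpβ') fun _ => ?_)
  rw [eth]
  set σ₂ := σ₁.write 34 0 th with hσ₂
  have b34 : σ₂ 34 0 = th := Store.write_same _ _ _ _
  have b8 : σ₂ 8 0 = R := by rw [hσ₂, Store.write_ne_array _ (by decide), a8]
  have b0 : σ₂ 0 = σ 0 := by rw [hσ₂, Store.write_ne_array _ (by decide), a0]
  have ep : (2 * .var 34 + 2 * .get 0 4 + Program.dimE * .var 8 + 9 : Expr).eval σ₂ = p := by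
    rw [hp, oraclePrec, ← hth]
    simp [Program.dimE, b8, b0, h0, h4, b34]
  refine seq (assign (by rwa [ep, abs_of_nonneg (by positivity)]) fun _ => ?_)
  rw [ep]
  set σ₃ := σ₂.write 9 0 p with hσ₃
  have c9 : σ₃ 9 0 = p := Store.write_same _ _ _ _
  have c34 : σ₃ 34 0 = th := by rw [hσ₃, Store.write_ne_array _ (by decide), b34]
  have c8 : σ₃ 8 0 = R := by rw [hσ₃, Store.write_ne_array _ (by decide), b8]
  have c0 : σ₃ 0 = σ 0 := by rw [hσ₃, Store.write_ne_array _ (by decide), b0]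
  refine seq (accLoop p (fun l => 2 ^ l) (by decide) hpM hpβ'
    (fun σ' hf => by rw [Expr.eval_var, hf 9 (by decide) (by decide), c9]) (by simp)
    (fun l _ σ' _ _ h => by simp [h, pow_succ']) hpow fun σ₄ hf₄ h10 _ => ?_)
  refine seq (accLoop (p - th) (fun l => 2 ^ l) (by decide) (by omega)
    (lt_of_le_of_lt (by exact_mod_cast Nat.sub_le _ _) hpβ')
    (fun σ' hf => by
      rw [Expr.eval_sub, Expr.eval_var, Expr.eval_var, hf 9 (by decide) (by decide),
        hf₄ 9 (by decide) (by decide), c9, hf 34 (by decide) (by decide),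
        hf₄ 34 (by decide) (by decide), c34]
      omega) (by simp)
    (fun l _ σ' _ _ h => by simp [h, pow_succ']) (fun l hl => hpow l (by omega))
    fun σ₅ hf₅ h11 _ => ?_)
  have d0 : σ₅ 0 0 = d := by
    rw [hf₅ 0 (by decide) (by decide), hf₄ 0 (by decide) (by decide), c0, h0]
  have d8 : σ₅ 8 0 = R := by
    rw [hf₅ 8 (by decide) (by decide), hf₄ 8 (by decide) (by decide), c8]
  have d9 : σ₅ 9 0 = p := by
    rw [hf₅ 9 (by decide) (by decide), hf₄ 9 (by decide) (by decide), c9]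
  have d10 : σ₅ 10 0 = 2 ^ p := by rw [hf₅ 10 (by decide) (by decide), h10]
  refine seq (assign (by simpa using h1β) fun hf₆ => ?_)
  refine seq (fillRows (y := 14) (d + 1) d (fun _ _ => -(R : ℤ)) (by decide) (by decide)
    (by omega) hdβ' (fun σ' hf => by
      simp [Program.dimE, hf 0 (by decide) (by decide), Store.write, d0])
    (fun i hi σ' hf hix _ => ?_) fun σ₇ _ hfill hf₇ => ?_)
  · refine fill (y := 14) d (fun j => (i : ℤ) * d + j) (fun _ => -(R : ℤ))
      (fun j l _ h => by simpa using h.ne') (by decide) (by decide) (by omega) hdβ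
      (fun σ'' hf'' => by
        simp [Program.dimE, hf'' 0 (by decide) (by decide), hf 0 (by decide) (by decide),
          Store.write, d0]) ?_ ?_
    · intro j hj σ'' hf'' hjx _
      have hv : (0 - .var 8 : Expr).eval σ'' = -(R : ℤ) := by
        simp [hf'' 8 (by decide) (by decide), hf 8 (by decide) (by decide), Store.write, d8]
      have hcell : (Program.cellE 24 25).eval σ'' = (i : ℤ) * d + j := by
        simp [Program.cellE, Program.dimE, hf'' 0 (by decide) (by decide),
          hf 0 (by decide) (by decide), Store.write, d0, hf'' 24 (by decide) (by decide), hix, hjx]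
      refine set (by rwa [hv, abs_neg, abs_of_nonneg hR0]) ?_
      rw [hv, hcell]
      exact ⟨Store.write_same _ _ _ _, fun i hi => Store.write_ne_cell _ _ hi _⟩
    · intro σ'' _ h1 h2
      exact ⟨h1, fun l hl j hj => h2 _ fun i hi => row_cell_ne hj hi hl⟩
  have e0 : σ₇ 0 0 = d := by rw [hf₇ 0 (by decide), hf₆ 0 (by decide), d0]
  have e8 : σ₇ 8 0 = R := by rw [hf₇ 8 (by decide), hf₆ 8 (by decide), d8]
  refine fill (y := 14) d (fun j => (j : ℤ) * d + j) (fun _ => 2 * d * R - R)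
    (fun j l hj h => row_cell_ne hj (by omega) h.ne') (by decide) (by decide) (by omega) hdβ
    (fun σ' hf => by simp [Program.dimE, hf 0 (by decide) (by decide), e0]) ?_ ?_
  · intro j hj σ' hf hjx _
    have hv : (2 * Program.dimE * .var 8 - .var 8 : Expr).eval σ' = 2 * d * R - R := by
      simp [hf 8 (by decide) (by decide), e8, Program.dimE, hf 0 (by decide) (by decide), e0]
    have hcell : (Program.cellE 25 25).eval σ' = (j : ℤ) * d + j := by
      simp [Program.cellE, Program.dimE, hf 0 (by decide) (by decide), e0, hjx]
    refine set (by rw [hv, abs_lt]; constructor <;> linarith) ?_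
    rw [hv, hcell]
    exact ⟨Store.write_same _ _ _ _, fun i hi => Store.write_ne_cell _ _ hi _⟩
  · intro σ₈ hf₈ hdiag hrest
    have hf : ∀ y, y ≠ 25 → y ≠ 24 → y ≠ 14 → y ≠ 12 → σ₈ y = σ₅ y := by
      intro y y1 y2 y3 y4
      rw [hf₈ y y1 (by simp [Program.mods, y3]),
        hf₇ y (by simp [Program.mods, Program.forLoop, Program.assign, y1, y2, y3]),
        hf₆ y (by simp [Program.mods, Program.assign, y4])]
    refine ⟨?_, ?_, ?_, ?_, ?_, fun i hi j hj => ?_⟩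
    · rw [hf 8 (by decide) (by decide) (by decide) (by decide), d8]
    · rw [hf 9 (by decide) (by decide) (by decide) (by decide), d9]
    · rw [hf 10 (by decide) (by decide) (by decide) (by decide), d10]
    · rw [hf 11 (by decide) (by decide) (by decide) (by decide), h11]
    · rw [hf₈ 12 (by decide) (by decide), hf₇ 12 (by decide), Store.write_same]
      rfl
    · split_ifs with hij
      · subst hij
        rw [hdiag i hj]
        ring
      · rw [hrest _ fun l hl => ?_, hfill i hi j hj, add_zero]
        by_cases hil : i = l
        · subst hil
          intro h
          have : (j : ℤ) = i := by linarith
          exact hij (by exact_mod_cast this.symm)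
        · exact row_cell_ne hj hl hil

end Runs

/-! ### The projection on the machine -/

/-- The common denominator of row `k` of the matrix with numerators in array `3` and denominators
in array `4`. -/
def rowDen (d : ℕ) (σ : Store) (k : ℕ) : ℤ := ∏ j ∈ Finset.range d, σ 4 ((k : ℤ) * d + (j : ℤ))

/-- Row `k` of the matrix with numerators in array `3` and denominators in array `4`, multiplied by
its common denominator. -/
def rowInt (d : ℕ) (σ : Store) (k j : ℕ) : ℤ :=
  σ 3 ((k : ℤ) * d + (j : ℤ)) * (rowDen d σ k / σ 4 ((k : ℤ) * d + (j : ℤ)))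

namespace Runs

variable {d : ℕ} {O : Oracle d} {M β : ℕ} {σ : Store} {Q : Store → Prop}

/-- The update of `IsProjectionData.step` on the machine, before it is known that the division is
exact. -/
theorem projectRow_spec {k : ℕ} (hdM : d ≤ M) (hM : (M : ℤ) < 2 ^ β) (h0 : σ 0 0 = d)
    (h27 : σ 27 0 = k) {E DB : ℤ} (hden : ∀ j < d, 0 < σ 4 ((k : ℤ) * d + (j : ℤ)))
    (hdenE : rowDen d σ k ≤ E) (hE : E < 2 ^ β) (ha : ∀ j < d, |rowInt d σ k j| ≤ E)
    (hP : ∀ i < d, ∀ j < d, |σ 30 ((i : ℤ) * d + (j : ℤ))| ≤ DB)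
    (hβ₁ : d * (DB * E) < 2 ^ β) (hβ₂ : d * (E * (d * (DB * E))) < 2 ^ β) {w : ℕ → ℤ}
    (hw : ∀ i, w i = ∑ j ∈ Finset.range d, σ 30 ((i : ℤ) * d + (j : ℤ)) * rowInt d σ k j) {D' : ℤ}
    (hD' : D' = ∑ j ∈ Finset.range d, rowInt d σ k j * w j)
    (hnew : ∀ i < d, ∀ j < d,
      |(σ 30 ((i : ℤ) * d + (j : ℤ)) * D' - w i * w j) / σ 32 0| < 2 ^ β)
    (hQ : ∀ σ' : Store, (∀ y ∉ Program.projectRow.mods, σ' y = σ y) →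
      (∀ i < d, ∀ j < d, σ' 30 ((i : ℤ) * d + (j : ℤ)) =
        (σ 30 ((i : ℤ) * d + (j : ℤ)) * D' - w i * w j) / σ 32 0) → σ' 32 0 = D' → Q σ') :
    Runs O M β .projectRow Q σ := by
  have hdβ : (d : ℤ) < 2 ^ β := lt_of_le_of_lt (by exact_mod_cast hdM) hM
  have hd0 : (0 : ℤ) ≤ d := by positivity
  have hmul : ∀ i < d, ∀ j < d, |σ 30 ((i : ℤ) * d + (j : ℤ)) * rowInt d σ k j| ≤ DB * E :=
    fun i hi j hj => by
      rw [abs_mul]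
      exact mul_le_mul (hP i hi j hj) (ha j hj) (abs_nonneg _) ((abs_nonneg _).trans (hP i hi j hj))
  have hwle : ∀ i < d, |w i| ≤ d * (DB * E) := fun i hi => by
    rw [hw]
    exact abs_sum_range_le (hmul i hi) le_rfl
  have hmul' : ∀ j < d, |rowInt d σ k j * w j| ≤ E * (d * (DB * E)) := fun j hj => by
    rw [abs_mul]
    exact mul_le_mul (ha j hj) (hwle j hj) (abs_nonneg _) ((abs_nonneg _).trans (ha j hj))
  have hD'lt : |D'| < 2 ^ β := by
    rw [hD']
    exact (abs_sum_range_le hmul' le_rfl).trans_lt hβ₂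
  suffices hS : Runs O M β .projectRow (fun σ' => (∀ i < d, ∀ j < d,
      σ' 30 ((i : ℤ) * d + (j : ℤ)) =
        (σ 30 ((i : ℤ) * d + (j : ℤ)) * D' - w i * w j) / σ 32 0) ∧ σ' 32 0 = D') σ from
    hS.imp fun σ' hf h => hQ σ' hf h.1 h.2
  -- the common denominator of the row
  refine seq (accLoop d (fun l => ∏ j ∈ Finset.range l, σ 4 ((k : ℤ) * d + (j : ℤ))) (by decide)
    hdM hdβ (fun σ' hf => by simp [Program.dimE, hf 0 (by decide) (by decide), h0]) (by simp)
    (fun l hl σ' hf hlx h => ?_) (fun l hl => ?_) fun σ₁ hf₁ h28 _ => ?_)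
  · simp [Program.dimE, Program.cellE, hf 0 (by decide) (by decide), h0, hlx, h,
      hf 4 (by decide) (by decide), hf 27 (by decide) (by decide), h27, Finset.prod_range_succ]
  · have hpos : ∀ s ⊆ Finset.range d, 0 < ∏ j ∈ s, σ 4 ((k : ℤ) * d + (j : ℤ)) := fun s hs =>
      Finset.prod_pos fun j hj => hden j (Finset.mem_range.1 (hs hj))
    have hsub : Finset.range l ⊆ Finset.range d := Finset.range_mono hl
    rw [abs_of_pos (hpos _ hsub)]
    refine lt_of_le_of_lt (le_trans ?_ hdenE) hE
    rw [rowDen, ← Finset.prod_sdiff hsub]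
    exact le_mul_of_one_le_left (hpos _ hsub).le
      (Int.add_one_le_iff.2 (hpos _ Finset.sdiff_subset))
  have f1 : ∀ y, y ≠ 28 → y ≠ 25 → σ₁ y = σ y := fun y h1 h2 => hf₁ y h2 h1
  have h28 : σ₁ 28 0 = rowDen d σ k := h28
  -- the integer row
  refine seq (fill (y := 29) d (fun j => j) (rowInt d σ k) (fun _ _ _ h => natCast_ne_of_lt h)
    (by decide) (by decide) hdM hdβ (fun σ' hf => by
      simp [Program.dimE, hf 0 (by decide) (by decide), f1 0 (by decide) (by decide), h0])
    (fun j hj σ' hf hjx _ => ?_) fun σ₂ hf₂ h29 _ _ => ?_)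
  · have g : ∀ y, y ≠ 29 → y ≠ 25 → σ' y = σ₁ y := fun y h1 h2 =>
      hf y h2 (by simp [Program.mods, h1])
    have hv : (.get 3 (Program.cellE 27 25) * (.var 28 / .get 4 (Program.cellE 27 25)) :
        Expr).eval σ' = rowInt d σ k j := by
      simp [Program.dimE, Program.cellE, g 0 (by decide) (by decide), f1 0 (by decide) (by decide),
        g 3 (by decide) (by decide), f1 3 (by decide) (by decide), g 4 (by decide) (by decide),
        f1 4 (by decide) (by decide), g 27 (by decide) (by decide), f1 27 (by decide) (by decide),
        g 28 (by decide) (by decide), h28, hjx, h27, h0, rowInt]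
    refine set (by rw [hv]; exact (ha j hj).trans_lt hE) ?_
    rw [hv, Expr.eval_var, hjx]
    exact ⟨Store.write_same _ _ _ _, fun i hi => Store.write_ne_cell _ _ hi _⟩
  have f2 : ∀ y, y ≠ 28 → y ≠ 25 → y ≠ 29 → σ₂ y = σ y := fun y h1 h2 h3 => by
    rw [hf₂ y h2 (by simp [Program.mods, h3]), f1 y h1 h2]
  -- the image of the row
  refine seq (fill (y := 31) d (fun i => i) w (fun _ _ _ h => natCast_ne_of_lt h)
    (by decide) (by decide) hdM hdβ (fun σ' hf => by
      simp [Program.dimE, hf 0 (by decide) (by decide), f2 0 (by decide) (by decide) (by decide),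
        h0])
    (fun i hi σ' hf hix _ => ?_) fun σ₃ hf₃ h31 _ _ => ?_)
  · have g : ∀ y, y ∉ [24, 31, 26, 25] → σ' y = σ₂ y := fun y h => by
      simp only [List.mem_cons, List.not_mem_nil, or_false, not_or] at h
      exact hf y h.1 (by simp [Program.mods, Program.accLoop, Program.forLoop, Program.assign, h])
    refine seq (sumLoop d _ (DB * E) (by decide) hdM hdβ (fun σ'' hf'' => ?_)
      (fun j hj σ'' hf'' hjx => ?_) (hmul i hi) hβ₁ fun σ'' hf'' hs _ => ?_)
    · simp [Program.dimE, hf'' 0 (by decide) (by decide), g 0 (by decide),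
        f2 0 (by decide) (by decide) (by decide), h0]
    · simp [Program.dimE, Program.cellE, hf'' 0 (by decide) (by decide), g 0 (by decide),
        f2 0 (by decide) (by decide) (by decide), h0, hf'' 30 (by decide) (by decide),
        g 30 (by decide), f2 30 (by decide) (by decide) (by decide), hf'' 24 (by decide) (by decide),
        hix, hf'' 29 (by decide) (by decide), g 29 (by decide), hjx, h29 j hj]
    · rw [← hw] at hs
      have hix'' : σ'' 24 0 = i := by rw [hf'' 24 (by decide) (by decide), hix]
      refine set ?_ ?_
      · rw [Expr.eval_var, hs]
        exact (hwle i hi).trans_lt hβ₁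
      · simp only [Expr.eval_var, hix'', hs]
        refine ⟨Store.write_same _ _ _ _, fun l hl => ?_⟩
        rw [Store.write_ne_cell _ _ hl, hf'' 31 (by decide) (by decide)]
  have f3 : ∀ y, y ∉ [24, 31, 26, 25] → σ₃ y = σ₂ y := fun y h => by
    simp only [List.mem_cons, List.not_mem_nil, or_false, not_or] at h
    exact hf₃ y h.1 (by simp [Program.mods, Program.accLoop, Program.forLoop, Program.assign, h])
  have c0 : σ₃ 0 0 = d := by
    rw [f3 0 (by decide), f2 0 (by decide) (by decide) (by decide), h0]
  -- the next Gram determinant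
  refine seq (sumLoop d _ (E * (d * (DB * E))) (by decide) hdM hdβ (fun σ' hf => ?_)
    (fun j hj σ' hf hjx => ?_) hmul' hβ₂ fun σ₄ hf₄ h33 _ => ?_)
  · simp [Program.dimE, hf 0 (by decide) (by decide), c0]
  · simp [hf 29 (by decide) (by decide), f3 29 (by decide), hjx, h29 j hj,
      hf 31 (by decide) (by decide), h31 j hj]
  rw [← hD'] at h33
  have d0 : σ₄ 0 0 = d := by rw [hf₄ 0 (by decide) (by decide), c0]
  have d30 : σ₄ 30 = σ 30 := by
    rw [hf₄ 30 (by decide) (by decide), f3 30 (by decide), f2 30 (by decide) (by decide) (by decide)]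
  have d31 : ∀ i < d, σ₄ 31 i = w i := fun i hi => by
    rw [hf₄ 31 (by decide) (by decide), h31 i hi]
  have d32 : σ₄ 32 = σ 32 := by
    rw [hf₄ 32 (by decide) (by decide), f3 32 (by decide), f2 32 (by decide) (by decide) (by decide)]
  -- the rank one update
  refine seq (fillRows (y := 30) d d
    (fun i j => (σ 30 ((i : ℤ) * d + (j : ℤ)) * D' - w i * w j) / σ 32 0) (by decide) (by decide)
    hdM hdβ (fun σ' hf => by simp [Program.dimE, hf 0 (by decide) (by decide), d0])
    (fun i hi σ' hf hix hrow => ?_) fun σ₅ hf₅ hfill hf₅' => ?_)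
  · have g : ∀ y, y ∉ [24, 30, 25] → σ' y = σ₄ y := fun y h => by
      simp only [List.mem_cons, List.not_mem_nil, or_false, not_or] at h
      exact hf y h.1 (by simp [Program.mods, Program.forLoop, Program.assign, h])
    refine fill (y := 30) d (fun j => (i : ℤ) * d + j)
      (fun j => (σ 30 ((i : ℤ) * d + (j : ℤ)) * D' - w i * w j) / σ 32 0)
      (fun j l _ h => by simpa using h.ne') (by decide) (by decide) hdM hdβ
      (fun σ'' hf'' => by simp [Program.dimE, hf'' 0 (by decide) (by decide), g 0 (by decide), d0])
      ?_ ?_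
    · intro j hj σ'' hf'' hjx h30
      have g' : ∀ y, y ≠ 25 → y ≠ 30 → σ'' y = σ' y := fun y h1 h2 =>
        hf'' y h1 (by simp [Program.mods, h2])
      have hcell : (Program.cellE 24 25).eval σ'' = (i : ℤ) * d + j := by
        simp [Program.cellE, Program.dimE, g' 0 (by decide) (by decide), g 0 (by decide), d0,
          g' 24 (by decide) (by decide), hix, hjx]
      have hold : σ'' 30 ((i : ℤ) * d + j) = σ 30 ((i : ℤ) * d + (j : ℤ)) := by
        rw [h30 _ fun l hl => by simpa using hl.ne', hrow j hj, d30]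
      have hv : ((.get 30 (Program.cellE 24 25) * .var 33 -
          .get 31 (.var 24) * .get 31 (.var 25)) / .var 32 : Expr).eval σ'' =
          (σ 30 ((i : ℤ) * d + (j : ℤ)) * D' - w i * w j) / σ 32 0 := by
        simp only [Expr.eval_div, Expr.eval_sub, Expr.eval_mul, Expr.eval_get, Expr.eval_var, hcell,
          hold, hjx, g' 33 (by decide) (by decide), g 33 (by decide), h33,
          g' 31 (by decide) (by decide), g 31 (by decide), g' 24 (by decide) (by decide), hix,
          d31 i hi, d31 j hj, g' 32 (by decide) (by decide), g 32 (by decide), d32]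
      refine set (by rw [hv]; exact hnew i hi j hj) ?_
      rw [hv, hcell]
      exact ⟨Store.write_same _ _ _ _, fun l hl => Store.write_ne_cell _ _ hl _⟩
    · intro σ'' _ h1 h2
      exact ⟨h1, fun l hl j hj => h2 _ fun i' hi' => row_cell_ne hj hi' hl⟩
  have e33 : σ₅ 33 0 = D' := by rw [hf₅' 33 (by decide), h33]
  refine assign (by rwa [Expr.eval_var, e33]) ?_
  refine ⟨fun i hi j hj => ?_, ?_⟩
  · rw [Store.write_ne_array _ (by decide), hfill i hi j hj]
  · rw [Store.write_same, Expr.eval_var, e33]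

/-- The projection is computed row by row. The Gram determinants multiply by at most
`(d + 1) ^ 2 * E ^ 2` with each row, so that all integers have polynomially many bits. -/
theorem projection_spec {m : ℕ} (hdM : d ≤ M) (hmM : m ≤ M) (hM : (M : ℤ) < 2 ^ β)
    (h0 : σ 0 0 = d) (h1 : σ 0 1 = m) (h30 : σ 30 = fun _ => 0) {E : ℤ} (hE1 : 1 ≤ E)
    (hden : ∀ k < m, ∀ j < d, 0 < σ 4 ((k : ℤ) * d + (j : ℤ)))
    (hdenE : ∀ k < m, rowDen d σ k ≤ E) (ha : ∀ k < m, ∀ j < d, |rowInt d σ k j| ≤ E)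
    (hind : ∀ k < m, ∃ x : Fin d → ℝ, (∀ l < k, ∑ j : Fin d, (rowInt d σ l j : ℝ) * x j = 0) ∧
      ∑ j : Fin d, (rowInt d σ k j : ℝ) * x j ≠ 0)
    (hβ : ((d + 1) ^ 2 * E ^ 2) ^ (m + 1) < (2 : ℤ) ^ β)
    (hQ : ∀ σ' : Store, (∀ y ∉ Program.projection.mods, σ' y = σ y) →
      σ' 32 0 ≤ ((d + 1) ^ 2 * E ^ 2) ^ m →
      IsProjectionData (fun k (j : Fin d) => rowInt d σ k j) m (σ' 32 0)
        (fun i j => σ' 30 (((i : ℕ) : ℤ) * d + ((j : ℕ) : ℤ))) → Q σ') :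
    Runs O M β .projection Q σ := by
  have hdβ : (d : ℤ) < 2 ^ β := lt_of_le_of_lt (by exact_mod_cast hdM) hM
  have hmβ : (m : ℤ) < 2 ^ β := lt_of_le_of_lt (by exact_mod_cast hmM) hM
  have hd0 : (0 : ℤ) ≤ d := by positivity
  set G : ℤ := (d + 1) ^ 2 * E ^ 2 with hG
  have hEG : E ≤ G := by
    rw [hG]
    nlinarith [mul_nonneg hd0 hd0, sq_nonneg E, mul_nonneg hd0 (sq_nonneg E)]
  have hG1 : 1 ≤ G := hE1.trans hEG
  have hGpow : ∀ k ≤ m + 1, G ^ k < 2 ^ β := fun k hk =>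
    (pow_le_pow_right₀ hG1 hk).trans_lt hβ
  have h1β : (1 : ℤ) < 2 ^ β := by simpa using hGpow 0 (by omega)
  have hEβ : E < 2 ^ β := hEG.trans_lt (by simpa using hGpow 1 (by omega))
  suffices hS : Runs O M β .projection (fun σ' => σ' 32 0 ≤ G ^ m ∧
      IsProjectionData (fun k (j : Fin d) => rowInt d σ k j) m (σ' 32 0)
        (fun i j => σ' 30 (((i : ℕ) : ℤ) * d + ((j : ℕ) : ℤ)))) σ from
    hS.imp fun σ' hf h => hQ σ' hf h.1 h.2
  refine seq (assign (by simpa using h1β) fun hf₀ => ?_)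
  have g0 : (σ.write 32 0 1) 0 = σ 0 := hf₀ 0 (by decide)
  refine seq (fill (y := 30) d (fun j => (j : ℤ) * d + j) (fun _ => 1)
    (fun j l hj h => row_cell_ne hj (by omega) h.ne') (by decide) (by decide) hdM hdβ
    (fun σ' hf => by simp [Program.dimE, hf 0 (by decide) (by decide), g0, h0])
    (fun j hj σ' hf hjx _ => ?_) fun σ₁ hf₁ hdiag hrest hf₁' => ?_)
  · have hcell : (Program.cellE 24 24).eval σ' = (j : ℤ) * d + j := by
      simp [Program.cellE, Program.dimE, hf 0 (by decide) (by decide), g0, h0, hjx]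
    refine set (by simpa using h1β) ?_
    rw [hcell]
    exact ⟨Store.write_same _ _ _ _, fun i hi => Store.write_ne_cell _ _ hi _⟩
  have f1 : ∀ y, y ∉ [24, 30, 32] → σ₁ y = σ y := fun y h => by
    simp only [List.mem_cons, List.not_mem_nil, or_false, not_or] at h
    rw [hf₁ y h.1 (by simp [Program.mods, h]), Store.write_ne_array _ h.2.2]
  have h32 : σ₁ 32 0 = 1 := by
    rw [hf₁ 32 (by decide) (by decide), Store.write_same]
    rfl
  have hP0 : (fun i j : Fin d => σ₁ 30 (((i : ℕ) : ℤ) * d + ((j : ℕ) : ℤ))) =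
      fun i j => if i = j then 1 else 0 := by
    funext i j
    split_ifs with hij
    · rw [hij, hdiag j j.2]
    · rw [hrest, Store.write_ne_array _ (by decide), h30]
      intro l hl
      by_cases hil : (i : ℕ) = l
      · subst hil
        intro h
        have : ((j : ℕ) : ℤ) = (i : ℕ) := by linarith
        exact hij (Fin.ext (by exact_mod_cast this.symm))
      · exact row_cell_ne j.2 hl hil
  refine forLoop m (fun k σ' => σ' 32 0 ≤ G ^ k ∧
    IsProjectionData (fun k (j : Fin d) => rowInt d σ k j) k (σ' 32 0)
      (fun i j => σ' 30 (((i : ℕ) : ℤ) * d + ((j : ℕ) : ℤ)))) (by decide) hmM hmβ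
    (fun σ' hf => by simp [hf 0 (by decide) (by decide), f1 0 (by decide), h1]) ?_ ?_
    fun σ' _ h => h
  · rw [Store.write_ne_array _ (by decide), Store.write_ne_array _ (by decide), h32, hP0]
    exact ⟨by simp, isProjectionData_zero _⟩
  · intro k hk σ' hf hkx ⟨hDle, hdata⟩
    have f : ∀ y, y ∉ 27 :: 24 :: 30 :: 32 :: Program.projectRow.mods → σ' y = σ y := fun y h => by
      simp only [List.mem_cons, not_or] at h
      rw [hf y h.1 h.2.2.2.2, f1 y (by simp [h])]
    have hrow : ∀ l j, rowInt d σ' l j = rowInt d σ l j := fun l j => by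
      rw [rowInt, rowDen, f 3 (by decide), f 4 (by decide), ← rowDen, ← rowInt]
    have hrowDen : rowDen d σ' k = rowDen d σ k := by
      rw [rowDen, f 4 (by decide), ← rowDen]
    have h4 : σ' 4 = σ 4 := f 4 (by decide)
    set D := σ' 32 0 with hD
    set w : ℕ → ℤ := fun i => ∑ j ∈ Finset.range d,
      σ' 30 ((i : ℤ) * d + (j : ℤ)) * rowInt d σ' k j with hw
    set D' : ℤ := ∑ j ∈ Finset.range d, rowInt d σ' k j * w j with hD'
    have hDpos : 0 < D := hdata.pos
    have hP : ∀ i < d, ∀ j < d, |σ' 30 ((i : ℤ) * d + (j : ℤ))| ≤ D := fun i hi j hj =>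
      hdata.abs_le ⟨i, hi⟩ ⟨j, hj⟩
    have hdata' := hdata.step (hind k hk) (w := fun i => w i) (D' := D')
      (fun i => by simp only [hw, hrow, Finset.sum_range]) (by
        simp only [hD', hrow, Finset.sum_range])
    have hrowE : ∀ j < d, |rowInt d σ' k j| ≤ E := fun j hj => by
      rw [hrow]
      exact ha k hk j hj
    have hw_le : ∀ i < d, |w i| ≤ d * (D * E) := fun i hi =>
      abs_sum_range_le (fun j hj => by
        rw [abs_mul]
        exact mul_le_mul (hP i hi j hj) (hrowE j hj) (abs_nonneg _) hDpos.le) le_rfl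
    have hstep : ((d : ℤ) ^ 2 * E ^ 2) * D ≤ G ^ (k + 1) := by
      rw [pow_succ' G k]
      refine mul_le_mul ?_ hDle hDpos.le (by omega)
      rw [hG]
      gcongr
      omega
    have hd1 : (d : ℤ) * (D * E) ≤ G ^ (k + 1) := by
      refine le_trans ?_ hstep
      have : (d : ℤ) * E ≤ d ^ 2 * E ^ 2 := by
        have h := mul_nonneg hd0 (by omega : 0 ≤ E)
        rcases h.eq_or_lt with h' | h'
        · nlinarith
        · nlinarith
      nlinarith
    have hD'le : D' ≤ G ^ (k + 1) := by
      refine le_trans ((le_abs_self _).trans (abs_sum_range_le (B := E * (d * (D * E)))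
        (fun j hj => ?_) le_rfl)) (le_trans (le_of_eq ?_) hstep)
      · rw [abs_mul]
        exact mul_le_mul (hrowE j hj) (hw_le j hj) (abs_nonneg _) (by omega)
      · ring
    refine projectRow_spec (k := k) (E := E) (DB := D) (w := w) (D' := D') hdM hM
      (by rw [f 0 (by decide), h0]) hkx (fun j hj => by rw [h4]; exact hden k hk j hj)
      (by rw [hrowDen]; exact hdenE k hk) hEβ hrowE hP (hd1.trans_lt (hGpow _ (by omega)))
      (lt_of_le_of_lt (le_trans (le_of_eq (by ring)) hstep) (hGpow (k + 1) (by omega)))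
      (fun i => rfl) rfl (fun i hi j hj => ?_) fun σ'' hf'' h30'' h32'' => ?_
    · exact (hdata'.abs_le ⟨i, hi⟩ ⟨j, hj⟩).trans_lt (hD'le.trans_lt (hGpow _ (by omega)))
    · rw [Store.write_ne_array _ (by decide), Store.write_ne_array _ (by decide), h32'']
      refine ⟨hD'le, ?_⟩
      convert hdata' using 3 with i j
      exact h30'' i i.2 j j.2

/-- The output is the projection of the point in array `15`, with the product of the Gram determinant
and the denominator of the point as common denominator. -/
theorem output_spec (hdM : d ≤ M) (hM : (M : ℤ) < 2 ^ β) (h0 : σ 0 0 = d) {DB C : ℤ}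
    (hP : ∀ i < d, ∀ j < d, |σ 30 ((i : ℤ) * d + (j : ℤ))| ≤ DB) (hC : ∀ j < d, |σ 15 (j : ℤ)| ≤ C)
    (hβ₁ : d * (DB * C) < 2 ^ β) (hβ₂ : |σ 32 0 * σ 15 d| < 2 ^ β)
    (hQ : ∀ σ' : Store, (∀ i < d, σ' 7 (i : ℤ) =
      ∑ j ∈ Finset.range d, σ 30 ((i : ℤ) * d + (j : ℤ)) * σ 15 j) →
      σ' 7 d = σ 32 0 * σ 15 d → Q σ') :
    Runs O M β .output Q σ := by
  have hdβ : (d : ℤ) < 2 ^ β := lt_of_le_of_lt (by exact_mod_cast hdM) hM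
  have hmul : ∀ i < d, ∀ j < d, |σ 30 ((i : ℤ) * d + (j : ℤ)) * σ 15 j| ≤ DB * C :=
    fun i hi j hj => by
      rw [abs_mul]
      exact mul_le_mul (hP i hi j hj) (hC j hj) (abs_nonneg _) ((abs_nonneg _).trans (hP i hi j hj))
  refine seq (fill (y := 7) d (fun i => i) (fun i => ∑ j ∈ Finset.range d,
    σ 30 ((i : ℤ) * d + (j : ℤ)) * σ 15 j) (fun _ _ _ h => natCast_ne_of_lt h)
    (by decide) (by decide) hdM hdβ (fun σ' hf => by
      simp [Program.dimE, hf 0 (by decide) (by decide), h0])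
    (fun i hi σ' hf hix _ => ?_) fun σ₁ hf₁ h7 _ _ => ?_)
  · have g : ∀ y, y ∉ [24, 7, 26, 25] → σ' y = σ y := fun y h => by
      simp only [List.mem_cons, List.not_mem_nil, or_false, not_or] at h
      exact hf y h.1 (by simp [Program.mods, Program.accLoop, Program.forLoop, Program.assign, h])
    refine seq (sumLoop d _ (DB * C) (by decide) hdM hdβ (fun σ'' hf'' => ?_)
      (fun j hj σ'' hf'' hjx => ?_) (hmul i hi) hβ₁ fun σ'' hf'' hs _ => ?_)
    · simp [Program.dimE, hf'' 0 (by decide) (by decide), g 0 (by decide), h0]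
    · simp [Program.dimE, Program.cellE, hf'' 0 (by decide) (by decide), g 0 (by decide),
        h0, hf'' 30 (by decide) (by decide), g 30 (by decide), hf'' 24 (by decide) (by decide),
        hix, hf'' 15 (by decide) (by decide), g 15 (by decide), hjx]
    · have hix'' : σ'' 24 0 = i := by rw [hf'' 24 (by decide) (by decide), hix]
      refine set ?_ ?_
      · rw [Expr.eval_var, hs]
        exact (abs_sum_range_le (hmul i hi) le_rfl).trans_lt hβ₁
      · simp only [Expr.eval_var, hix'', hs]
        refine ⟨Store.write_same _ _ _ _, fun l hl => ?_⟩
        rw [Store.write_ne_cell _ _ hl, hf'' 7 (by decide) (by decide)]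
  · have f : ∀ y, y ∉ [24, 7, 26, 25] → σ₁ y = σ y := fun y h => by
      simp only [List.mem_cons, List.not_mem_nil, or_false, not_or] at h
      exact hf₁ y h.1 (by simp [Program.mods, Program.accLoop, Program.forLoop, Program.assign, h])
    have hv : (.var 32 * .get 15 Program.dimE : Expr).eval σ₁ = σ 32 0 * σ 15 d := by
      simp [Program.dimE, f 0 (by decide), f 32 (by decide), f 15 (by decide), h0]
    have hcell : Program.dimE.eval σ₁ = d := by simp [Program.dimE, f 0 (by decide), h0]
    refine set (by rwa [hv]) ?_
    rw [hv, hcell]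
    refine hQ _ (fun i hi => ?_) (Store.write_same _ _ _ _)
    rw [Store.write_ne_cell _ _ (by exact_mod_cast hi.ne), h7 i hi]

end Runs

/-! ### Gradients with rounding errors -/

section Rounding

open scoped RealInnerProductSpace

variable {d : ℕ} {μ : Measure (Space d)} [IsFiniteMeasure μ] {Ω : Set (Space d)}

theorem sum_mul_le_of_abs_le {n : ℕ} {a b : Fin n → ℝ} {x y : ℝ} (ha : ∀ j, |a j| ≤ x)
    (hb : ∀ j, |b j| ≤ y) : |∑ j, a j * b j| ≤ n * (x * y) := by
  calc |∑ j, a j * b j| ≤ ∑ j, |a j * b j| := Finset.abs_sum_le_sum_abs _ _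
    _ ≤ ∑ _j : Fin n, x * y := Finset.sum_le_sum fun j _ => by
        rw [abs_mul]
        exact mul_le_mul (ha j) (hb j) (abs_nonneg _) ((abs_nonneg _).trans (ha j))
    _ = n * (x * y) := by simp

/-- The integer part of `2 ^ p * A j`, plus the answer of the oracle, is `2 ^ p` times the gradient,
up to rounding errors. -/
theorem abs_approx_sub_tiltedMean_le (hμ : μ ≠ 0) (hΩ : μ Ωᶜ = 0) {s : ℝ} (hs : 0 < s)
    {A : Fin d → ℚ} (hb : ∀ X ∈ Ω, ‖ofRat A - X‖ ≤ s) {O : Oracle d}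
    (hO : IsStrongCountingOracle μ Ω O) (y : Fin d → ℚ) (p : ℕ) (j : Fin d) :
    |((2 ^ p * (A j).num / (A j).den + (O y p).2 j : ℤ) : ℝ)
      - 2 ^ p * tiltedMean μ (ofRat A) (ofRat y) j| ≤ 2 := by
  have h1 := (hO y p).2 j
  rw [gradient_expIntegral hμ hΩ hs hb] at h1
  set g := tiltedMean μ (ofRat A) (ofRat y) with hg
  have hq : (0 : ℝ) < 2 ^ p := by positivity
  have h2 : |((O y p).2 j : ℝ) - 2 ^ p * (g j - A j)| ≤ 1 := by
    have e : ((O y p).2 j : ℝ) - 2 ^ p * (g j - A j)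
        = 2 ^ p * (((O y p).2 j : ℝ) / 2 ^ p - (g - ofRat A) j) := by
      have : (g - ofRat A) j = g j - A j := rfl
      rw [this]
      field_simp
    rw [e, abs_mul, abs_of_pos hq]
    calc (2 : ℝ) ^ p * _ ≤ 2 ^ p * (1 / 2 ^ p) := mul_le_mul_of_nonneg_left h1 hq.le
      _ = 1 := by field_simp
  have hden : (0 : ℤ) < (A j).den := by exact_mod_cast (A j).den_pos
  have hden' : (0 : ℝ) < (A j).den := by exact_mod_cast (A j).den_pos
  have h3 : |((2 ^ p * (A j).num / (A j).den : ℤ) : ℝ) - 2 ^ p * A j| ≤ 1 := by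
    have h4 := Int.emod_nonneg (2 ^ p * (A j).num) hden.ne'
    have h5 := Int.emod_lt_of_pos (2 ^ p * (A j).num) hden
    have h6 := Int.mul_ediv_add_emod (2 ^ p * (A j).num) (A j).den
    set r := 2 ^ p * (A j).num % (A j).den with hr
    set k := 2 ^ p * (A j).num / (A j).den with hk
    have h7 : ((A j).den : ℝ) * k + r = 2 ^ p * (A j).num := by exact_mod_cast h6
    have h8 : (0 : ℝ) ≤ r := by exact_mod_cast h4
    have h9 : (r : ℝ) < (A j).den := by exact_mod_cast h5
    have e : (A j : ℝ) = (A j).num / (A j).den := by exact_mod_cast (Rat.num_div_den (A j)).symm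
    have e2 : (k : ℝ) - 2 ^ p * A j = -(r / (A j).den) := by
      rw [e]
      field_simp
      linarith
    rw [e2, abs_neg, abs_of_nonneg (by positivity), div_le_one hden']
    exact h9.le
  have e : ((2 ^ p * (A j).num / (A j).den + (O y p).2 j : ℤ) : ℝ) - 2 ^ p * g j
      = (((2 ^ p * (A j).num / (A j).den : ℤ) : ℝ) - 2 ^ p * A j)
        + (((O y p).2 j : ℝ) - 2 ^ p * (g j - A j)) := by
    rw [Int.cast_add]
    ring
  rw [e]
  linarith [abs_add_le (((2 ^ p * (A j).num / (A j).den : ℤ) : ℝ) - 2 ^ p * A j)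
    (((O y p).2 j : ℝ) - 2 ^ p * (g j - A j))]

theorem abs_apply_le_norm (g : Space d) (j : Fin d) : |g j| ≤ ‖g‖ := by
  simpa using PiLp.norm_apply_le g j

theorem inner_eq_sum (x y : Space d) : ⟪x, y⟫ = ∑ j, y j * x j := by
  simp [PiLp.inner_apply]

variable {A : Space d} {ρ th R : ℕ}

/-- Either the approximate gradient `G` at `y` is small, or it separates `y` from all points `z` near
the minimizer: if the gradient is not small, then the objective at `y` is so much above its minimum
that it exceeds the objective at `z` by more than all rounding errors, and the tangent at `y` lies
below the objective at `z`. -/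
theorem abs_le_or_sum_mul_sub_neg (hμ : μ ≠ 0) (hΩ : μ Ωᶜ = 0)
    (hb : ∀ X ∈ Ω, ‖A - X‖ ≤ 2 ^ (ρ + 1)) {Y : Space d}
    (hY : ∀ x, dualObjective μ Ω A Y ≤ dualObjective μ Ω A x) {y : Space d}
    (hy : ∀ j, |y j| ≤ R) {p : ℕ} (hp : p = 2 * th + 2 * ρ + d * R + 9) {G : Fin d → ℤ}
    (hG : ∀ j, |(G j : ℝ) - 2 ^ p * tiltedMean μ A y j| ≤ 2) :
    (∀ j, |G j| ≤ 2 ^ (p - th)) ∨ ∀ z : Space d, (∀ j, |z j| ≤ R) →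
      ‖z - Y‖ ≤ 1 / 2 ^ (2 * th + 3 * ρ + 9) → ∑ j, (G j : ℝ) * (z j - y j) < 0 := by
  rw [or_iff_not_imp_left]
  intro hbig z hz hzY
  push Not at hbig
  obtain ⟨j, hj⟩ := hbig
  have hs : (0 : ℝ) < 2 ^ (ρ + 1) := by positivity
  set g := tiltedMean μ A y with hg
  have hT : (1 : ℝ) ≤ 2 ^ th := one_le_pow₀ (by norm_num)
  have hP : (1 : ℝ) ≤ 2 ^ ρ := one_le_pow₀ (by norm_num)
  have hdR : ((d * R : ℕ) : ℝ) ≤ 2 ^ (d * R) := by exact_mod_cast (d * R).lt_two_pow_self.le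
  have hdR1 : (1 : ℝ) ≤ 2 ^ (d * R) := one_le_pow₀ (by norm_num)
  have hpT : (2 : ℝ) ^ (p - th) * 2 ^ th = 2 ^ p := by
    rw [← pow_add, Nat.sub_add_cancel (by omega)]
  have hq : (2 : ℝ) ^ p = 512 * ((2 ^ th) ^ 2 * (2 ^ ρ) ^ 2) * 2 ^ (d * R) := by
    rw [hp]
    ring
  have hδ : (2 : ℝ) ^ (2 * th + 3 * ρ + 9) = 512 * ((2 ^ th) ^ 2 * (2 ^ ρ) ^ 3) := by ring
  have hs2 : (2 : ℝ) ^ (ρ + 1) = 2 * 2 ^ ρ := by ring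
  have hj' : (2 : ℝ) ^ (p - th) < |(G j : ℝ)| := by exact_mod_cast hj
  have hFz : dualObjective μ Ω A z - dualObjective μ Ω A Y
      ≤ 2 ^ (ρ + 1) * (1 / 2 ^ (2 * th + 3 * ρ + 9)) := by
    have h1 := dualObjective_add_ge_tiltedMean hμ hΩ hb z (Y - z)
    rw [add_sub_cancel] at h1
    have h2 := neg_le_of_abs_le (abs_real_inner_le_norm (Y - z) (tiltedMean μ A z))
    have h3 : ‖Y - z‖ * ‖tiltedMean μ A z‖ ≤ (1 / 2 ^ (2 * th + 3 * ρ + 9)) * 2 ^ (ρ + 1) :=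
      mul_le_mul (by rwa [norm_sub_rev]) (norm_tiltedMean_le hμ hΩ hb z) (norm_nonneg _)
        (by positivity)
    linarith
  have hzy : ⟪z - y, g⟫ ≤ dualObjective μ Ω A z - dualObjective μ Ω A y := by
    have h1 := dualObjective_add_ge_tiltedMean hμ hΩ hb y (z - y)
    rw [add_sub_cancel] at h1
    linarith
  have hgsq := norm_tiltedMean_sq_le hμ hΩ hs hb y hY
  have hgj : g j ^ 2 ≤ ‖g‖ ^ 2 := by
    rw [← sq_abs]
    exact pow_le_pow_left₀ (abs_nonneg _) (abs_apply_le_norm g j) 2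
  have herr : |∑ j, ((G j : ℝ) - 2 ^ p * g j) * (z j - y j)| ≤ d * (2 * (2 * R)) :=
    sum_mul_le_of_abs_le hG fun j => (abs_sub _ _).trans (by linarith [hz j, hy j])
  have hsum : ∑ j, (G j : ℝ) * (z j - y j)
      = 2 ^ p * ⟪z - y, g⟫ + ∑ j, ((G j : ℝ) - 2 ^ p * g j) * (z j - y j) := by
    rw [inner_eq_sum, Finset.mul_sum, ← Finset.sum_add_distrib]
    exact Finset.sum_congr rfl fun j _ => by
      have : (z - y) j = z j - y j := rfl
      rw [this]
      ring
  rw [hsum]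
  push_cast at hdR
  have hGj := hG j
  rw [hs2] at hFz hgsq
  rw [hδ] at hFz
  rw [hq] at hGj hpT
  rw [hq]
  rw [hq] at herr
  set T : ℝ := 2 ^ th
  set P : ℝ := 2 ^ ρ
  set E : ℝ := 2 ^ (d * R)
  set U : ℝ := 2 ^ (p - th)
  have hTP : 0 < T ^ 2 * P ^ 2 := by positivity
  have hU : U = 512 * (T * P ^ 2) * E := by
    have : T ≠ 0 := by positivity
    apply mul_right_cancel₀ this
    rw [hpT]
    ring
  -- the gradient is at least `1 / (2 T)`
  have hU4 : 4 ≤ U := by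
    rw [hU]
    have h1 : 1 ≤ P ^ 2 := one_le_pow₀ hP
    have h2 : 1 ≤ T * P ^ 2 := one_le_mul_of_one_le_of_one_le hT h1
    have h3 : 1 ≤ T * P ^ 2 * E := one_le_mul_of_one_le_of_one_le h2 hdR1
    linarith
  have h1 : U / 2 ≤ |512 * (T ^ 2 * P ^ 2) * E * g j| := by
    have := abs_sub_abs_le_abs_sub (G j : ℝ) (512 * (T ^ 2 * P ^ 2) * E * g j)
    linarith
  have h2 : 1 / (2 * T) ≤ |g j| := by
    rw [abs_mul, abs_of_pos (by positivity), hU] at h1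
    rw [div_le_iff₀ (by positivity)]
    have hc : 0 < 256 * (T * P ^ 2) * E := by positivity
    have : 256 * (T * P ^ 2) * E * 1 ≤ 256 * (T * P ^ 2) * E * (|g j| * (2 * T)) := by linarith
    exact le_of_mul_le_mul_left this hc
  have h3 : (1 / (2 * T)) ^ 2 ≤ g j ^ 2 := by
    rw [← sq_abs (g j)]
    exact pow_le_pow_left₀ (by positivity) h2 2
  have h4 : 1 / (64 * (T ^ 2 * P ^ 2)) ≤ dualObjective μ Ω A y - dualObjective μ Ω A Y := by
    have h5 := (h3.trans hgj).trans hgsq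
    have e : 4 * (2 * P) ^ 2 * (1 / (64 * (T ^ 2 * P ^ 2))) = (1 / (2 * T)) ^ 2 := by
      field_simp
      norm_num
    rw [← e] at h5
    exact le_of_mul_le_mul_left h5 (by positivity)
  have h5 : 2 * P * (1 / (512 * (T ^ 2 * P ^ 3))) = 1 / (256 * (T ^ 2 * P ^ 2)) := by
    field_simp
    norm_num
  rw [h5] at hFz
  have h6 : ⟪z - y, g⟫ ≤ 1 / (256 * (T ^ 2 * P ^ 2)) - 1 / (64 * (T ^ 2 * P ^ 2)) := by linarith
  have h7 := mul_le_mul_of_nonneg_left h6 (by positivity : 0 ≤ 512 * (T ^ 2 * P ^ 2) * E)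
  have h8 : 512 * (T ^ 2 * P ^ 2) * E *
      (1 / (256 * (T ^ 2 * P ^ 2)) - 1 / (64 * (T ^ 2 * P ^ 2))) = -(6 * E) := by
    field_simp
    norm_num
  rw [h8] at h7
  have h9 := (abs_le.1 herr).2
  linarith

/-- Where the approximate gradient is small, the objective is almost minimal. -/
theorem dualObjective_le_of_abs_le (hμ : μ ≠ 0) (hΩ : μ Ωᶜ = 0) {s : ℝ}
    (hb : ∀ X ∈ Ω, ‖A - X‖ ≤ s) {Y y : Space d} (hY : ∀ j, |Y j| ≤ R)
    (hy : ∀ j, |y j| ≤ R) {p e : ℕ} (hth : th = e + d * R + 2) (hp : th + 1 ≤ p) {G : Fin d → ℤ}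
    (hG : ∀ j, |(G j : ℝ) - 2 ^ p * tiltedMean μ A y j| ≤ 2) (hsmall : ∀ j, |G j| ≤ 2 ^ (p - th)) :
    dualObjective μ Ω A y ≤ dualObjective μ Ω A Y + 1 / 2 ^ e := by
  set g := tiltedMean μ A y with hg
  have hdR : ((d * R : ℕ) : ℝ) ≤ 2 ^ (d * R) := by exact_mod_cast (d * R).lt_two_pow_self.le
  have hpT : (2 : ℝ) ^ (p - th) * 2 ^ th = 2 ^ p := by
    rw [← pow_add, Nat.sub_add_cancel (by omega)]
  have hU2 : (2 : ℝ) ≤ 2 ^ (p - th) := by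
    calc (2 : ℝ) = 2 ^ 1 := by norm_num
      _ ≤ 2 ^ (p - th) := pow_le_pow_right₀ (by norm_num) (by omega)
  have hT : (2 : ℝ) ^ th = 4 * (2 ^ e * 2 ^ (d * R)) := by
    rw [hth]
    ring
  have hgj : ∀ j, |g j| ≤ 2 / 2 ^ th := fun j => by
    have h1 : |(G j : ℝ)| ≤ 2 ^ (p - th) := by exact_mod_cast hsmall j
    have h2 := abs_sub_abs_le_abs_sub (2 ^ p * g j) (G j : ℝ)
    rw [abs_sub_comm] at h2
    rw [abs_mul, abs_of_pos (by positivity : (0 : ℝ) < 2 ^ p), ← hpT] at h2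
    rw [le_div_iff₀ (by positivity)]
    have h3 : (2 : ℝ) ^ (p - th) * (|g j| * 2 ^ th) ≤ 2 ^ (p - th) * 2 := by
      linarith [hG j, hpT ▸ hG j]
    exact le_of_mul_le_mul_left h3 (by positivity)
  have h1 := dualObjective_add_ge_tiltedMean hμ hΩ hb y (Y - y)
  rw [add_sub_cancel, inner_eq_sum] at h1
  have h2 : |∑ j, g j * (Y - y) j| ≤ d * (2 / 2 ^ th * (2 * R)) :=
    sum_mul_le_of_abs_le hgj fun j => by
      have : (Y - y) j = Y j - y j := rfl
      rw [this]
      exact (abs_sub _ _).trans (by linarith [hY j, hy j])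
  have h3 : (d : ℝ) * (2 / 2 ^ th * (2 * R)) ≤ 1 / 2 ^ e := by
    rw [hT, le_div_iff₀ (by positivity)]
    push_cast at hdR
    calc (d : ℝ) * (2 / (4 * (2 ^ e * 2 ^ (d * R))) * (2 * R)) * 2 ^ e
        = d * R / 2 ^ (d * R) := by
          field_simp
          norm_num
      _ ≤ 1 := (div_le_one (by positivity)).2 hdR
  linarith [(abs_le.1 h2).1]

end Rounding

/-! ### The data of the search -/

/-- A number of rounds after which the volume of the simplex would be too small. -/
def roundBound (d R e ρ : ℕ) : ℕ :=
  16 * (d + 1) ^ 2 * (d * (2 * gradientExp d R e + 3 * ρ + 9 + 2 * d * R))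

theorem gradientExp_le_oraclePrec (d R e ρ : ℕ) : gradientExp d R e + 1 ≤ oraclePrec d R e ρ := by
  rw [oraclePrec]
  omega

/-- The vertices of a corner simplex with legs `δ` are within `δ` of the corner. -/
theorem norm_cornerSimplex_sub_le {d : ℕ} (Y : Space d) {δ : ℝ} (hδ : 0 ≤ δ) (k : Fin (d + 1)) :
    ‖WithLp.toLp 2 (cornerSimplex (fun j => Y j) δ k) - Y‖ ≤ δ := by
  have h : ∀ j, (WithLp.toLp 2 (cornerSimplex (fun j => Y j) δ k) - Y : Space d) j
      = if (k : ℕ) = j then δ else 0 := fun j => by simp [cornerSimplex]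
  rw [EuclideanSpace.norm_eq]
  refine Real.sqrt_le_iff.2 ⟨hδ, ?_⟩
  simp only [h]
  refine Fin.lastCases ?_ (fun i => ?_) k
  · rw [Finset.sum_eq_zero]
    · positivity
    · intro j _
      simp [j.isLt.ne']
  · rw [Finset.sum_eq_single i]
    · simp
    · intro j _ hj
      simp [Fin.val_ne_of_ne hj.symm]
    · simp

/-- After `roundBound + 1` rounds the volume of the first simplex, with legs `2 d R`, falls below that
of the small simplex at the minimizer (both up to the factor `d !`). -/
theorem exp_neg_roundBound_mul_lt (d R e ρ : ℕ) :
    Real.exp (-((roundBound d R e ρ + 1 : ℕ) / (16 * ((d : ℝ) + 1) ^ 2))) * (2 * d * R) ^ d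
      < (1 / 2 ^ (2 * gradientExp d R e + 3 * ρ + 9)) ^ d := by
  set s := 2 * gradientExp d R e + 3 * ρ + 9 with hs
  have h2 : Real.exp (-((roundBound d R e ρ + 1 : ℕ) / (16 * ((d : ℝ) + 1) ^ 2)))
      < 1 / 2 ^ (d * (s + 2 * d * R)) := by
    have h3 : ((d * (s + 2 * d * R) : ℕ) : ℝ)
        < (roundBound d R e ρ + 1 : ℕ) / (16 * ((d : ℝ) + 1) ^ 2) := by
      rw [lt_div_iff₀ (by positivity), roundBound, ← hs]
      push_cast
      linarith
    have h4 : Real.exp (-((d * (s + 2 * d * R) : ℕ) : ℝ)) ≤ 1 / 2 ^ (d * (s + 2 * d * R)) := by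
      rw [Real.exp_neg, ← one_div]
      refine one_div_le_one_div_of_le (by positivity) ?_
      have h5 : (2 : ℝ) ≤ Real.exp 1 := by
        have := Real.add_one_le_exp (1 : ℝ)
        linarith
      calc (2 : ℝ) ^ (d * (s + 2 * d * R)) ≤ Real.exp 1 ^ (d * (s + 2 * d * R)) :=
            pow_le_pow_left₀ (by norm_num) h5 _
        _ = _ := by rw [← Real.exp_nat_mul, mul_one]
    exact (Real.exp_lt_exp.2 (neg_lt_neg h3)).trans_le h4
  have h6 : (2 * d * R : ℝ) ^ d ≤ 2 ^ (d * (2 * d * R)) := by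
    rw [mul_comm d, pow_mul]
    refine pow_le_pow_left₀ (by positivity) ?_ d
    exact_mod_cast (2 * d * R).lt_two_pow_self.le
  calc _ ≤ Real.exp (-((roundBound d R e ρ + 1 : ℕ) / (16 * ((d : ℝ) + 1) ^ 2)))
        * 2 ^ (d * (2 * d * R)) := mul_le_mul_of_nonneg_left h6 (Real.exp_pos _).le
    _ < 1 / 2 ^ (d * (s + 2 * d * R)) * 2 ^ (d * (2 * d * R)) :=
        mul_lt_mul_of_pos_right h2 (by positivity)
    _ = (1 / 2 ^ s) ^ d := by
        rw [one_div_pow, ← pow_mul, mul_add, pow_add, mul_comm d s]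
        field_simp

/-- The memory after `Program.setup`, for the input `A`. -/
structure IsSetUp {d : ℕ} (A : Fin d → ℚ) (R e ρ : ℕ) (σ : Store) : Prop where
  dim : σ 0 0 = d
  num : ∀ j : Fin d, σ 1 (j : ℕ) = (A j).num
  den : ∀ j : Fin d, σ 2 (j : ℕ) = (A j).den
  radius : σ 8 0 = R
  prec : σ 9 0 = oraclePrec d R e ρ
  two_pow : σ 10 0 = 2 ^ oraclePrec d R e ρ
  threshold : σ 11 0 = 2 ^ (oraclePrec d R e ρ - gradientExp d R e)
  vertexDen : σ 12 0 = 1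
  flag : σ 13 0 = 0
  vertex : ∀ i < d + 1, ∀ j < d, σ 14 ((i : ℤ) * d + (j : ℤ)) =
    -(R : ℤ) + if i = j then 2 * (d : ℤ) * R else 0

section

variable {d : ℕ} {μ : Measure (Space d)} [IsFiniteMeasure μ] {Ω : Set (Space d)} {A : Fin d → ℚ}
  {O : Oracle d} {R e ρ : ℕ} {σ : Store}

theorem IsSetUp.abs_approxGradient_sub_le (hσ : IsSetUp A R e ρ σ) (hμ : μ ≠ 0) (hΩ : μ Ωᶜ = 0)
    (hb : ∀ X ∈ Ω, ‖ofRat A - X‖ ≤ 2 ^ (ρ + 1)) (hO : IsStrongCountingOracle μ Ω O)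
    (y : Fin d → ℚ) (j : Fin d) :
    |(approxGradient O (oraclePrec d R e ρ) σ y j : ℝ)
      - 2 ^ oraclePrec d R e ρ * tiltedMean μ (ofRat A) (ofRat y) j| ≤ 2 := by
  rw [approxGradient, hσ.two_pow, hσ.num, hσ.den]
  exact abs_approx_sub_tiltedMean_le hμ hΩ (by positivity) hb hO y _ j

theorem IsSetUp.abs_approxGradient_le (hσ : IsSetUp A R e ρ σ) (hμ : μ ≠ 0) (hΩ : μ Ωᶜ = 0)
    (hb : ∀ X ∈ Ω, ‖ofRat A - X‖ ≤ 2 ^ (ρ + 1)) (hO : IsStrongCountingOracle μ Ω O)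
    (y : Fin d → ℚ) (j : Fin d) :
    |approxGradient O (oraclePrec d R e ρ) σ y j| ≤ 2 ^ (oraclePrec d R e ρ + ρ + 2) := by
  have h1 := hσ.abs_approxGradient_sub_le hμ hΩ hb hO y j
  set p := oraclePrec d R e ρ with hp
  have h2 : |2 ^ p * tiltedMean μ (ofRat A) (ofRat y) j| ≤ 2 ^ p * 2 ^ (ρ + 1) := by
    rw [abs_mul, abs_of_pos (by positivity : (0 : ℝ) < 2 ^ p)]
    exact mul_le_mul_of_nonneg_left
      ((abs_apply_le_norm _ _).trans (norm_tiltedMean_le hμ hΩ hb _)) (by positivity)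
  have h3 := abs_sub_abs_le_abs_sub (approxGradient O p σ y j : ℝ)
    (2 ^ p * tiltedMean μ (ofRat A) (ofRat y) j)
  have h4 : (2 : ℝ) ≤ 2 ^ p * 2 ^ (ρ + 1) := by
    rw [← pow_add]
    calc (2 : ℝ) = 2 ^ 1 := by norm_num
      _ ≤ _ := pow_le_pow_right₀ (by norm_num) (by omega)
  have h5 : (|approxGradient O p σ y j| : ℝ) ≤ 2 ^ (p + ρ + 2) := by
    rw [add_assoc, pow_add, show ρ + 2 = (ρ + 1) + 1 by ring, pow_succ (2 : ℝ) (ρ + 1)]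
    linarith
  exact_mod_cast h5

/-- The search data for the dual program with minimizer `Y`: the small simplex is the corner
simplex at `Y`. -/
noncomputable def searchData {M β b : ℕ} (hσ : IsSetUp A R e ρ σ) (hμ : μ ≠ 0) (hΩ : μ Ωᶜ = 0)
    (hb : ∀ X ∈ Ω, ‖ofRat A - X‖ ≤ 2 ^ (ρ + 1)) (hO : IsStrongCountingOracle μ Ω O)
    {Y : Space d} (hY : ∀ x, dualObjective μ Ω (ofRat A) Y ≤ dualObjective μ Ω (ofRat A) x)
    (hYR : ‖Y‖ + 1 ≤ R) (hAb : ∀ j, |(A j).num| < 2 ^ b) (hdM : d + 2 ≤ M)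
    (hpM : oraclePrec d R e ρ ≤ M) (hRM : d * R ≤ M) (hNM : roundBound d R e ρ < M)
    (hM : (M : ℤ) < 2 ^ β) (hβ : oraclePrec d R e ρ + ρ + b + 3 ≤ β)
    (hbound : 2 * (d + 1) ^ 2 * 2 ^ (oraclePrec d R e ρ + ρ + 2) *
      ((2 * d * R + R + 1) * (5 * scaleDen d) ^ (roundBound d R e ρ + 1)) < 2 ^ β) :
    SearchData O M β σ :=
  have hδ : (1 : ℝ) / 2 ^ (2 * gradientExp d R e + 3 * ρ + 9) ≤ 1 := by
    rw [div_le_one (by positivity)]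
    exact one_le_pow₀ (by norm_num)
  have hz : ∀ k j, |cornerSimplex (fun j => Y j)
      (1 / 2 ^ (2 * gradientExp d R e + 3 * ρ + 9)) k j| ≤ R := fun k j => by
    have h1 := abs_apply_le_norm Y j
    have h2 : |if (k : ℕ) = j then (1 : ℝ) / 2 ^ (2 * gradientExp d R e + 3 * ρ + 9) else 0|
        ≤ 1 := by
      split_ifs
      · rwa [abs_of_nonneg (by positivity)]
      · simp
    rw [cornerSimplex]
    exact (abs_add_le _ _).trans (by linarith)
  have hv : vertices d σ = cornerSimplex (fun _ => -(R : ℝ)) (2 * d * R) := by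
    funext i j
    rw [vertices, vertexNum, hσ.vertexDen, hσ.vertex i i.2 j j.2, cornerSimplex]
    split_ifs <;> simp
  { R := R
    p := oraclePrec d R e ρ
    N := roundBound d R e ρ
    Q := 2 ^ (oraclePrec d R e ρ - gradientExp d R e)
    GB := 2 ^ (oraclePrec d R e ρ + ρ + 2)
    W := 2 * d * R + R + 1
    z := cornerSimplex (fun j => Y j) (1 / 2 ^ (2 * gradientExp d R e + 3 * ρ + 9))
    dim_eq := hσ.dim
    radius_eq := hσ.radius
    prec_eq := hσ.prec
    threshold_eq := hσ.threshold
    den_eq := hσ.vertexDen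
    flag_eq := hσ.flag
    one_le_W := by
      have : (0 : ℤ) ≤ 2 * d * R + R := by positivity
      omega
    one_le_GB := one_le_pow₀ (by norm_num)
    abs_le_W := fun i hi j hj => by
      have h1 : (0 : ℤ) ≤ 2 * d * R := by positivity
      have h2 : (0 : ℤ) ≤ R := by positivity
      rw [hσ.vertex i hi j hj, abs_le]
      split_ifs <;> constructor <;> linarith
    start := fun k => by
      rw [hv]
      exact inSimplex_cornerSimplex_of_abs_le (hz k)
    volume := by
      rw [hv, det_cornerSimplex, det_cornerSimplex, abs_of_nonneg (by positivity),
        abs_of_nonneg (by positivity)]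
      exact exp_neg_roundBound_mul_lt d R e ρ
    abs_z_le := hz
    oracle_lt := fun y _ j => by
      have h1 := hσ.abs_approxGradient_le hμ hΩ hb hO y j
      rw [approxGradient, hσ.two_pow, hσ.num, hσ.den] at h1
      set p := oraclePrec d R e ρ with hp
      have h2 : |2 ^ p * (A j).num / ((A j).den : ℤ)| ≤ 2 ^ (p + b) := by
        have h3 : |2 ^ p * (A j).num| ≤ 2 ^ (p + b) := by
          rw [abs_mul, abs_of_pos (by positivity : (0 : ℤ) < 2 ^ p), pow_add]
          exact mul_le_mul_of_nonneg_left (hAb j).le (by positivity)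
        exact (Int.abs_ediv_le_abs _ _).trans h3
      have h3 := abs_sub_abs_le_abs_sub ((O y p).2 j) (-(2 ^ p * (A j).num / ((A j).den : ℤ)))
      rw [abs_neg, sub_neg_eq_add, add_comm ((O y p).2 j)] at h3
      have h4 : (2 : ℤ) ^ (p + b) ≤ 2 ^ (p + ρ + b + 2) :=
        pow_le_pow_right₀ (by norm_num) (by omega)
      have h5 : (2 : ℤ) ^ (p + ρ + 2) ≤ 2 ^ (p + ρ + b + 2) :=
        pow_le_pow_right₀ (by norm_num) (by omega)
      have h6 : (2 : ℤ) ^ (p + ρ + b + 3) ≤ 2 ^ β := pow_le_pow_right₀ (by norm_num) hβ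
      have h7 : (2 : ℤ) ^ (p + ρ + b + 3) = 2 * 2 ^ (p + ρ + b + 2) := by ring
      have h8 : (2 : ℤ) ^ (p + b) < 2 ^ (p + ρ + b + 2) :=
        pow_lt_pow_right₀ (by norm_num) (by omega)
      linarith
    gradient_le := fun y _ j => hσ.abs_approxGradient_le hμ hΩ hb hO y j
    cut := fun y hy => by
      have hy' : ∀ j, |(ofRat y) j| ≤ (R : ℝ) := fun j => by
        change |((y j : ℚ) : ℝ)| ≤ R
        exact_mod_cast hy j
      refine (abs_le_or_sum_mul_sub_neg hμ hΩ hb hY hy' rfl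
        (hσ.abs_approxGradient_sub_le hμ hΩ hb hO y)).imp id fun h k => ?_
      exact h (WithLp.toLp 2 (cornerSimplex (fun j => Y j) _ k)) (hz k)
        (norm_cornerSimplex_sub_le Y (by positivity) k)
    dim_le := hdM
    prec_le := hpM
    radius_le := hRM
    rounds_lt := hNM
    M_lt := hM
    bound := hbound }

end

/-! ### The input -/

theorem cells_apply {n : ℕ} (v : Fin n → ℤ) (i : Fin n) : cells v ((i : ℕ) : ℤ) = v i := by
  have h : (0 : ℤ) ≤ (i : ℕ) ∧ ((i : ℕ) : ℤ) < n := ⟨by positivity, by exact_mod_cast i.2⟩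
  simp [cells]

theorem bits_cells_le {n β : ℕ} {v : Fin n → ℤ} (hv : ∀ i, bits (v i) ≤ β) (i : ℤ) :
    bits (cells v i) ≤ β := by
  unfold cells
  split_ifs
  · exact hv _
  · simp [bits]

theorem cells_finProdFinEquiv {d m : ℕ} (v : Fin m → Fin d → ℤ) (k : Fin m) (j : Fin d) :
    cells (fun i : Fin (m * d) => v (finProdFinEquiv.symm i).1 (finProdFinEquiv.symm i).2)
      (((k : ℕ) : ℤ) * d + ((j : ℕ) : ℤ)) = v k j := by
  have h : ((k : ℕ) : ℤ) * d + ((j : ℕ) : ℤ) = ((finProdFinEquiv (k, j) : ℕ) : ℤ) := by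
    rw [finProdFinEquiv_apply_val]
    push_cast
    ring
  rw [h, cells_apply, Equiv.symm_apply_apply]

section

variable {d m : ℕ} {h e ρ : ℕ} {L : Matrix (Fin m) (Fin d) ℚ} {B : Fin m → ℚ} {A : Fin d → ℚ}

theorem ratBits_vector_le (L : Matrix (Fin m) (Fin d) ℚ) (B : Fin m → ℚ) (A : Fin d → ℚ)
    (j : Fin d) : ratBits (A j) ≤ inputBits L B A :=
  (Finset.single_le_sum (f := fun j => ratBits (A j)) (fun _ _ => Nat.zero_le _)
    (Finset.mem_univ j)).trans ((Nat.le_add_right _ _).trans (Nat.le_add_right _ _))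

theorem sum_ratBits_row_le (L : Matrix (Fin m) (Fin d) ℚ) (B : Fin m → ℚ) (A : Fin d → ℚ)
    (k : Fin m) : ∑ j, ratBits (L k j) ≤ inputBits L B A :=
  (Finset.single_le_sum (f := fun k => ∑ j, ratBits (L k j)) (fun _ _ => Nat.zero_le _)
    (Finset.mem_univ k)).trans ((Nat.le_add_left _ _).trans (Nat.le_add_right _ _))

theorem ratBits_matrix_le (L : Matrix (Fin m) (Fin d) ℚ) (B : Fin m → ℚ) (A : Fin d → ℚ)
    (k : Fin m) (j : Fin d) : ratBits (L k j) ≤ inputBits L B A :=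
  (Finset.single_le_sum (f := fun j => ratBits (L k j)) (fun _ _ => Nat.zero_le _)
    (Finset.mem_univ j)).trans (sum_ratBits_row_le L B A k)

theorem ratBits_right_le (L : Matrix (Fin m) (Fin d) ℚ) (B : Fin m → ℚ) (A : Fin d → ℚ)
    (k : Fin m) : ratBits (B k) ≤ inputBits L B A :=
  (Finset.single_le_sum (f := fun k => ratBits (B k)) (fun _ _ => Nat.zero_le _)
    (Finset.mem_univ k)).trans (Nat.le_add_left _ _)

theorem bits_num_le (q : ℚ) : bits q.num ≤ ratBits q := Nat.le_add_right _ _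

theorem bits_den_le (q : ℚ) : bits q.den ≤ ratBits q := Nat.le_add_left _ _

theorem abs_num_lt_two_pow {q : ℚ} {b : ℕ} (hq : ratBits q ≤ b) : |q.num| < 2 ^ b :=
  bits_le_iff.1 ((bits_num_le q).trans hq)

theorem memBound_inputStore {β : ℕ} (hd : bits d ≤ β) (hm : bits m ≤ β) (hh : bits h ≤ β)
    (he : bits e ≤ β) (hρ : bits ρ ≤ β) (hin : inputBits L B A ≤ β) :
    MemBound β (inputStore h e ρ L B A) := by
  rintro (_ | _ | _ | _ | _ | _ | _ | x) i
  · refine bits_cells_le (fun i => ?_) i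
    fin_cases i
    exacts [hd, hm, hh, he, hρ]
  · exact bits_cells_le (fun j =>
      (bits_num_le _).trans ((ratBits_vector_le L B A j).trans hin)) i
  · exact bits_cells_le (fun j =>
      (bits_den_le _).trans ((ratBits_vector_le L B A j).trans hin)) i
  · exact bits_cells_le (fun i : Fin (m * d) => (bits_num_le _).trans
      ((ratBits_matrix_le L B A (finProdFinEquiv.symm i).1 (finProdFinEquiv.symm i).2).trans hin)) i
  · exact bits_cells_le (fun i : Fin (m * d) => (bits_den_le _).trans
      ((ratBits_matrix_le L B A (finProdFinEquiv.symm i).1 (finProdFinEquiv.symm i).2).trans hin)) i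
  · exact bits_cells_le (fun j =>
      (bits_num_le _).trans ((ratBits_right_le L B A j).trans hin)) i
  · exact bits_cells_le (fun j =>
      (bits_den_le _).trans ((ratBits_right_le L B A j).trans hin)) i
  · simp [inputStore, bits]

/-- The memory holds the matrix `L` in the arrays `3` and `4`. -/
def HoldsMatrix (L : Matrix (Fin m) (Fin d) ℚ) (σ : Store) : Prop :=
  ∀ (k : Fin m) (j : Fin d), σ 3 (((k : ℕ) : ℤ) * d + ((j : ℕ) : ℤ)) = (L k j).num ∧
    σ 4 (((k : ℕ) : ℤ) * d + ((j : ℕ) : ℤ)) = (L k j).den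

theorem holdsMatrix_inputStore : HoldsMatrix L (inputStore h e ρ L B A) := fun k j =>
  ⟨cells_finProdFinEquiv (fun k j => (L k j).num) k j,
    cells_finProdFinEquiv (fun k j => ((L k j).den : ℤ)) k j⟩

variable {σ : Store}

theorem HoldsMatrix.den_pos (hσ : HoldsMatrix L σ) {k j : ℕ} (hk : k < m) (hj : j < d) :
    0 < σ 4 ((k : ℤ) * d + (j : ℤ)) := by
  rw [(hσ ⟨k, hk⟩ ⟨j, hj⟩).2]
  exact_mod_cast (L ⟨k, hk⟩ ⟨j, hj⟩).den_pos

theorem HoldsMatrix.rowDen_eq (hσ : HoldsMatrix L σ) (k : Fin m) :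
    rowDen d σ k = ∏ j, ((L k j).den : ℤ) := by
  rw [rowDen, Finset.prod_range]
  exact Finset.prod_congr rfl fun j _ => (hσ k j).2

theorem HoldsMatrix.rowDen_pos (hσ : HoldsMatrix L σ) (k : Fin m) : 0 < rowDen d σ k := by
  rw [hσ.rowDen_eq]
  exact Finset.prod_pos fun j _ => by exact_mod_cast (L k j).den_pos

theorem HoldsMatrix.rowDen_le (hσ : HoldsMatrix L σ) (B : Fin m → ℚ) (A : Fin d → ℚ) (k : Fin m) :
    rowDen d σ k ≤ 2 ^ inputBits L B A := by
  rw [hσ.rowDen_eq]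
  calc ∏ j, ((L k j).den : ℤ) ≤ ∏ j, (2 : ℤ) ^ ratBits (L k j) :=
        Finset.prod_le_prod (fun _ _ => by positivity) fun j _ => by
          have := bits_le_iff.1 (bits_den_le (L k j))
          rw [abs_of_nonneg (by positivity)] at this
          exact this.le
    _ = 2 ^ ∑ j, ratBits (L k j) := Finset.prod_pow_eq_pow_sum _ _ _
    _ ≤ _ := pow_le_pow_right₀ (by norm_num) (sum_ratBits_row_le L B A k)

theorem HoldsMatrix.abs_rowInt_le (hσ : HoldsMatrix L σ) (B : Fin m → ℚ) (A : Fin d → ℚ)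
    (k : Fin m) (j : Fin d) : |rowInt d σ k j| ≤ 2 ^ (2 * inputBits L B A) := by
  rw [rowInt, (hσ k j).1, abs_mul, two_mul, pow_add]
  refine mul_le_mul (abs_num_lt_two_pow (ratBits_matrix_le L B A k j)).le ?_ (abs_nonneg _)
    (by positivity)
  refine (Int.abs_ediv_le_abs _ _).trans ?_
  rw [abs_of_pos (hσ.rowDen_pos k)]
  exact hσ.rowDen_le B A k

theorem HoldsMatrix.rowInt_eq (hσ : HoldsMatrix L σ) (k : Fin m) (j : Fin d) :
    (rowInt d σ k j : ℝ) = rowDen d σ k * L k j := by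
  have hden : ((L k j).den : ℤ) ≠ 0 := by exact_mod_cast (L k j).den_pos.ne'
  have hdvd : ((L k j).den : ℤ) ∣ rowDen d σ k := by
    rw [hσ.rowDen_eq]
    exact Finset.dvd_prod_of_mem (fun j => ((L k j).den : ℤ)) (Finset.mem_univ j)
  obtain ⟨t, ht⟩ := hdvd
  have e : (L k j : ℝ) = (L k j).num / (L k j).den := by
    exact_mod_cast (Rat.num_div_den (L k j)).symm
  have hden' : ((L k j).den : ℝ) ≠ 0 := by exact_mod_cast hden
  rw [rowInt, (hσ k j).1, (hσ k j).2, ht, Int.mul_ediv_cancel_left _ hden, e]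
  push_cast
  field_simp

theorem HoldsMatrix.sum_rowInt_eq (hσ : HoldsMatrix L σ) (k : Fin m) (x : Fin d → ℝ) :
    ∑ j : Fin d, (rowInt d σ k j : ℝ) * x j = rowDen d σ k * ∑ j, (L k j : ℝ) * x j := by
  rw [Finset.mul_sum]
  exact Finset.sum_congr rfl fun j _ => by rw [hσ.rowInt_eq, mul_assoc]

/-- Clearing denominators does not change the kernel of a row. -/
theorem HoldsMatrix.sum_rowInt_eq_zero_iff (hσ : HoldsMatrix L σ) (k : Fin m) (x : Fin d → ℝ) :
    ∑ j : Fin d, (rowInt d σ k j : ℝ) * x j = 0 ↔ ∑ j, (L k j : ℝ) * x j = 0 := by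
  have : (rowDen d σ k : ℝ) ≠ 0 := by exact_mod_cast (hσ.rowDen_pos k).ne'
  rw [hσ.sum_rowInt_eq, mul_eq_zero, or_iff_right this]

theorem card_le_of_linearIndependent_row (hL : LinearIndependent ℚ L.row) : m ≤ d := by
  have := hL.rank_matrix
  rw [Fintype.card_fin] at this
  rw [← this]
  exact L.rank_le_width

/-- A linear system with independent rows separates its rows. -/
theorem exists_mulVec_eq_single (hL : LinearIndependent ℚ L.row) (k : Fin m) :
    ∃ x : Fin d → ℝ, ∀ l, ∑ j, (L l j : ℝ) * x j = if l = k then 1 else 0 := by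
  have h1 : LinearMap.range L.mulVecLin = ⊤ := by
    apply Submodule.eq_top_of_finrank_eq
    rw [Module.finrank_fin_fun]
    simpa [Matrix.rank] using hL.rank_matrix
  obtain ⟨x, hx⟩ := LinearMap.range_eq_top.1 h1 (Pi.single k 1)
  refine ⟨fun j => x j, fun l => ?_⟩
  have h2 := congrFun hx l
  rw [Matrix.mulVecLin_apply, Matrix.mulVec, dotProduct, Pi.single_apply] at h2
  have h3 := congrArg (fun q : ℚ => (q : ℝ)) h2
  push_cast at h3
  rw [h3]
  split_ifs <;> simp

/-- No row lies in the span of the previous ones, in the form needed for `IsProjectionData.step`. -/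
theorem HoldsMatrix.exists_separating (hσ : HoldsMatrix L σ) (hL : LinearIndependent ℚ L.row)
    {k : ℕ} (hk : k < m) :
    ∃ x : Fin d → ℝ, (∀ l < k, ∑ j : Fin d, (rowInt d σ l j : ℝ) * x j = 0) ∧
      ∑ j : Fin d, (rowInt d σ k j : ℝ) * x j ≠ 0 := by
  obtain ⟨x, hx⟩ := exists_mulVec_eq_single hL ⟨k, hk⟩
  refine ⟨x, fun l hl => ?_, fun h => ?_⟩
  · rw [hσ.sum_rowInt_eq_zero_iff ⟨l, hl.trans hk⟩, hx, if_neg]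
    simpa using hl.ne
  · rw [hσ.sum_rowInt_eq_zero_iff ⟨k, hk⟩, hx, if_pos rfl] at h
    exact one_ne_zero h

end

/-! ### The run of the program -/

/-- The arrays changed by `setup` do not depend on its parameters, so membership can be decided. -/
theorem Program.mods_setup (c k : ℕ) : (setup c k).mods = (setup 0 0).mods := rfl

/-- A bound for the number of rounds of each loop. -/
def stepBound (c k d h e ρ : ℕ) : ℕ :=
  d + oraclePrec d (boxRadius c k h d) e ρ + d * boxRadius c k h d
    + roundBound d (boxRadius c k h d) e ρ + 3

/-- The numerators of the vertices have at most this number of bits. -/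
def vertexBits (d R e ρ : ℕ) : ℕ := 2 * d * R + R + (3 * d + 7) * (roundBound d R e ρ + 1)

/-- The Gram determinants have at most this number of bits. -/
def gramBits (d b : ℕ) : ℕ := (2 * d + 4 * b) * (d + 1)

/-- A bound for the bits of the integers in memory. -/
def bitBound (c k d h e ρ b : ℕ) : ℕ :=
  stepBound c k d h e ρ + h + e + ρ + b + boxRadius c k h d + 2 * d + 10
    + vertexBits d (boxRadius c k h d) e ρ + gramBits d b

theorem natCast_le_two_pow (n : ℕ) : (n : ℤ) ≤ 2 ^ n := by
  exact_mod_cast n.lt_two_pow_self.le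

theorem natCast_add_one_le_two_pow (n : ℕ) : (n : ℤ) + 1 ≤ 2 ^ n := by
  exact_mod_cast n.lt_two_pow_self

theorem vertex_le_two_pow (d R e ρ : ℕ) :
    (2 * d * R + R + 1 : ℤ) * (5 * scaleDen d) ^ (roundBound d R e ρ + 1)
      ≤ 2 ^ vertexBits d R e ρ := by
  rw [vertexBits, pow_add 2 (2 * d * R + R), pow_mul 2 (3 * d + 7)]
  refine mul_le_mul ?_ (pow_le_pow_left₀ ?_ ?_ _) (pow_nonneg ?_ _) (by positivity)
  · exact_mod_cast natCast_add_one_le_two_pow (2 * d * R + R)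
  · have := one_le_scaleDen d
    omega
  · rw [scaleDen, pow_add, mul_comm 3 d, pow_mul]
    have h1 : ((d : ℤ) + 1) ^ 3 ≤ (2 ^ d) ^ 3 :=
      pow_le_pow_left₀ (by positivity) (natCast_add_one_le_two_pow d) 3
    have h2 : (0 : ℤ) ≤ (2 ^ d) ^ 3 := by positivity
    calc 5 * (4 * ((d : ℤ) + 1) * (4 * ((d + 1) * (d + 1)))) = 80 * ((d : ℤ) + 1) ^ 3 := by ring
      _ ≤ (2 ^ d) ^ 3 * 2 ^ 7 := by linarith
  · have := one_le_scaleDen d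
    omega

theorem gram_le_two_pow {d b m : ℕ} (hm : m ≤ d + 1) :
    (((d : ℤ) + 1) ^ 2 * (2 ^ (2 * b)) ^ 2) ^ m ≤ 2 ^ gramBits d b := by
  have h1 : ((d : ℤ) + 1) ^ 2 * (2 ^ (2 * b)) ^ 2 ≤ 2 ^ (2 * d + 4 * b) := by
    rw [pow_add, mul_comm 2 d, pow_mul 2 d 2, ← pow_mul 2 (2 * b), show 2 * b * 2 = 4 * b by ring]
    exact mul_le_mul_of_nonneg_right
      (pow_le_pow_left₀ (by positivity) (natCast_add_one_le_two_pow d) 2) (by positivity)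
  calc _ ≤ ((2 : ℤ) ^ (2 * d + 4 * b)) ^ m := pow_le_pow_left₀ (by positivity) h1 m
    _ ≤ ((2 : ℤ) ^ (2 * d + 4 * b)) ^ (d + 1) :=
        pow_le_pow_right₀ (one_le_pow₀ (by norm_num)) hm
    _ = 2 ^ gramBits d b := by rw [← pow_mul, gramBits]

section

open scoped RealInnerProductSpace

variable {d m : ℕ} {μ : Measure (Space d)} [IsFiniteMeasure μ] {Ω : Set (Space d)}
  {L : Matrix (Fin m) (Fin d) ℚ}

theorem HoldsMatrix.projection_mem_solutions {σ : Store} (hσ : HoldsMatrix L σ) {D : ℤ}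
    {P : Fin d → Fin d → ℤ}
    (hP : IsProjectionData (fun k (j : Fin d) => rowInt d σ k j) m D P) (C : Fin d → ℤ) (q : ℤ) :
    ofRat (fun i => ((∑ j, P i j * C j : ℤ) : ℚ) / ((D * q : ℤ) : ℚ)) ∈ solutions L 0 := by
  intro k
  have h1 : ((∑ i : Fin d, rowInt d σ k i * ∑ j, P i j * C j : ℤ) : ℝ) = 0 := by
    exact_mod_cast hP.sum_row_eq_zero k.2 C
  rw [Int.cast_sum] at h1
  simp only [Int.cast_mul (rowInt _ _ _ _)] at h1
  rw [hσ.sum_rowInt_eq_zero_iff k (fun i => ((∑ j, P i j * C j : ℤ) : ℝ))] at h1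
  have h2 : ∀ i, (ofRat (fun i => ((∑ j, P i j * C j : ℤ) : ℚ) / ((D * q : ℤ) : ℚ)) : Space d) i
      = ((∑ j, P i j * C j : ℤ) : ℝ) * ((D * q : ℤ) : ℝ)⁻¹ := fun i => by
    change (((((∑ j, P i j * C j : ℤ) : ℚ) / ((D * q : ℤ) : ℚ) : ℚ)) : ℝ) = _
    rw [Rat.cast_div, Rat.cast_intCast, Rat.cast_intCast, div_eq_mul_inv]
  simp only [h2, ← mul_assoc, ← Finset.sum_mul, h1, zero_mul, Pi.zero_apply, Rat.cast_zero]

/-- The objective does not change under the projection onto the solution space, because `A - X` lies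
in this space for all `X ∈ Ω`. -/
theorem HoldsMatrix.dualObjective_projection {σ : Store} (hσ : HoldsMatrix L σ) {D : ℤ}
    {P : Fin d → Fin d → ℤ}
    (hP : IsProjectionData (fun k (j : Fin d) => rowInt d σ k j) m D P) {A : Space d} {s : ℝ}
    (hμ : μ ≠ 0) (hΩ : μ Ωᶜ = 0) (hb : ∀ X ∈ Ω, ‖A - X‖ ≤ s)
    (hA : ∀ X ∈ Ω, A - X ∈ solutions L 0) (C : Fin d → ℤ) {q : ℤ} (hq : 0 < q) :
    dualObjective μ Ω A (ofRat (fun i => ((∑ j, P i j * C j : ℤ) : ℚ) / ((D * q : ℤ) : ℚ)))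
      = dualObjective μ Ω A (ofRat (fun i => (C i : ℚ) / q)) := by
  set x : Space d := ofRat (fun i => ((∑ j, P i j * C j : ℤ) : ℚ) / ((D * q : ℤ) : ℚ)) with hx
  set y : Space d := ofRat (fun i => (C i : ℚ) / q) with hy
  rw [← add_sub_cancel x y]
  refine (dualObjective_add_of_orthogonal hμ hΩ hb x (y - x) fun X hX => ?_).symm
  have hD : (D : ℝ) ≠ 0 := by exact_mod_cast hP.pos.ne'
  have hq' : (q : ℝ) ≠ 0 := by exact_mod_cast hq.ne'
  have h1 := hP.sum_mul_sub_eq_zero (x := fun j => (A - X) j) (fun l hl => by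
    have := hA X hX ⟨l, hl⟩
    rw [Pi.zero_apply, Rat.cast_zero] at this
    exact (hσ.sum_rowInt_eq_zero_iff ⟨l, hl⟩ _).2 this) C
  have h2 : ∀ i, (y - x) i
      = ((D * C i - ∑ j, P i j * C j : ℤ) : ℝ) * ((D : ℝ) * q)⁻¹ := fun i => by
    have h3 : (y - x) i = (((C i : ℚ) / q : ℚ) : ℝ)
      - ((((∑ j, P i j * C j : ℤ) : ℚ) / ((D * q : ℤ) : ℚ) : ℚ) : ℝ) := rfl
    rw [h3, Rat.cast_div, Rat.cast_div, Rat.cast_intCast, Rat.cast_intCast, Rat.cast_intCast,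
      Rat.cast_intCast, Int.cast_sub, Int.cast_mul, Int.cast_mul]
    field_simp
  rw [inner_eq_sum]
  simp only [h2, ← mul_assoc, ← Finset.sum_mul, h1, zero_mul]

variable {B : Fin m → ℚ} {A : Fin d → ℚ} {O : Oracle d} {c k h e ρ : ℕ}

/-- The program halts with a nearly optimal point of `V_𝓛`, with explicit bounds for the number of
steps and the size of the integers. -/
theorem runs_dualSolver (hμ : μ ≠ 0) (hΩ : μ Ωᶜ = 0)
    (hb : ∀ X ∈ Ω, ‖ofRat A - X‖ ≤ 2 ^ (ρ + 1)) (hO : IsStrongCountingOracle μ Ω O)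
    (hL : LinearIndependent ℚ L.row) (hA : ∀ X ∈ Ω, ofRat A - X ∈ solutions L 0)
    {Y : Space d} (hY : ∀ x, dualObjective μ Ω (ofRat A) Y ≤ dualObjective μ Ω (ofRat A) x)
    (hYR : ‖Y‖ + 1 ≤ boxRadius c k h d) :
    Runs O (stepBound c k d h e ρ) (bitBound c k d h e ρ (inputBits L B A))
      (Program.dualSolver c k)
      (fun σ' => ofRat (readVec d σ' outputArray) ∈ solutions L 0 ∧
        dualObjective μ Ω (ofRat A) (ofRat (readVec d σ' outputArray))
          ≤ dualObjective μ Ω (ofRat A) Y + 1 / 2 ^ e)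
      (inputStore h e ρ L B A) := by
  set R := boxRadius c k h d with hR
  set p := oraclePrec d R e ρ with hp
  set N := roundBound d R e ρ with hN
  set b := inputBits L B A with hbdef
  set M := stepBound c k d h e ρ with hMdef
  set β := bitBound c k d h e ρ b with hβdef
  have eM : M = d + p + d * R + N + 3 := rfl
  have eβ : β = M + h + e + ρ + b + R + 2 * d + 10 + vertexBits d R e ρ + gramBits d b := rfl
  have hpow : ∀ n, n < β → (2 : ℤ) ^ n < 2 ^ β := fun n hn => pow_lt_pow_right₀ (by norm_num) hn
  have hM : (M : ℤ) < 2 ^ β := (natCast_le_two_pow M).trans_lt (hpow _ (by omega))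
  have hm := card_le_of_linearIndependent_row hL
  have hV := vertex_le_two_pow d R e ρ
  rw [← hN] at hV
  set V : ℤ := (2 * d * R + R + 1 : ℤ) * (5 * scaleDen d) ^ (N + 1) with hVdef
  have hV0 : 0 ≤ V := by
    have := one_le_scaleDen d
    exact mul_nonneg (by positivity) (pow_nonneg (by omega) _)
  have hd1 := natCast_add_one_le_two_pow d
  set σ₀ := inputStore h e ρ L B A with hσ₀
  have hmat : HoldsMatrix L σ₀ := holdsMatrix_inputStore
  refine Runs.seq (Runs.setup_spec (h := h) (e := e) (ρ := ρ) (R := R) (p := p) (by omega) hM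
    ?_ ?_ ?_ ?_ hR hp (by omega) (by omega) ?_ fun σ₁ hf₁ h8 h9 h10 h11 h12 h14 _ => ?_)
  · exact cells_apply ![(d : ℤ), m, h, e, ρ] 0
  · exact cells_apply ![(d : ℤ), m, h, e, ρ] 2
  · exact cells_apply ![(d : ℤ), m, h, e, ρ] 3
  · exact cells_apply ![(d : ℤ), m, h, e, ρ] 4
  · have h1 : (2 * d * R + R : ℤ) ≤ 2 ^ (2 * d * R + R) := by
      exact_mod_cast natCast_le_two_pow (2 * d * R + R)
    refine h1.trans_lt (hpow _ ?_)
    rw [eβ, vertexBits]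
    omega
  have hσ₁ : IsSetUp A R e ρ σ₁ :=
    { dim := by
        rw [hf₁ 0 (by rw [Program.mods_setup]; decide)]
        exact cells_apply ![(d : ℤ), m, h, e, ρ] 0
      num := fun j => by
        rw [hf₁ 1 (by rw [Program.mods_setup]; decide)]
        exact cells_apply (fun j => (A j).num) j
      den := fun j => by
        rw [hf₁ 2 (by rw [Program.mods_setup]; decide)]
        exact cells_apply (fun j => ((A j).den : ℤ)) j
      radius := h8
      prec := h9
      two_pow := h10
      threshold := h11
      vertexDen := h12
      flag := by
        rw [hf₁ 13 (by rw [Program.mods_setup]; decide)]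
        rfl
      vertex := h14 }
  let D := searchData (M := M) (β := β) (b := b) hσ₁ hμ hΩ hb hO hY hYR
    (fun j => abs_num_lt_two_pow (ratBits_vector_le L B A j)) (by omega) (by omega)
    (by omega) (by omega) hM (by omega) (by
      rw [← hp, ← hN, ← hVdef]
      calc 2 * ((d : ℤ) + 1) ^ 2 * 2 ^ (p + ρ + 2) * V
          ≤ 2 * (2 ^ d) ^ 2 * 2 ^ (p + ρ + 2) * 2 ^ vertexBits d R e ρ := by gcongr
        _ = 2 ^ (1 + 2 * d + (p + ρ + 2) + vertexBits d R e ρ) := by ring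
        _ < 2 ^ β := hpow _ (by omega))
  refine Runs.seq (D.search_spec fun σ₂ hf₂ hfound _ => ?_)
  have f₂ : ∀ y, y ∉ Program.round.mods → y ∉ (Program.setup c k).mods → σ₂ y = σ₀ y :=
    fun y h1 h2 => by rw [hf₂ y h1, hf₁ y h2]
  have hmat₂ : HoldsMatrix L σ₂ := fun k j => by
    rw [f₂ 3 (by decide) (by rw [Program.mods_setup]; decide),
      f₂ 4 (by decide) (by rw [Program.mods_setup]; decide)]
    exact hmat k j
  have g0 : σ₂ 0 = σ₀ 0 := f₂ 0 (by decide) (by rw [Program.mods_setup]; decide)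
  have h0 : σ₂ 0 0 = d := by
    rw [g0]
    exact cells_apply ![(d : ℤ), m, h, e, ρ] 0
  refine Runs.seq (Runs.projection_spec (m := m) (E := 2 ^ (2 * b)) (by omega) (by omega) hM h0
    ?_ ?_ (one_le_pow₀ (by norm_num)) (fun k hk j hj => hmat₂.den_pos hk hj)
    (fun k hk => (hmat₂.rowDen_le B A ⟨k, hk⟩).trans
      (pow_le_pow_right₀ (by norm_num) (by omega)))
    (fun k hk j hj => hmat₂.abs_rowInt_le B A ⟨k, hk⟩ ⟨j, hj⟩)
    (fun k hk => hmat₂.exists_separating hL hk)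
    ((gram_le_two_pow (by omega)).trans_lt (hpow _ (by omega)))
    fun σ₃ hf₃ hDle hdata _ => ?_)
  · rw [g0]
    exact cells_apply ![(d : ℤ), m, h, e, ρ] 1
  · rw [f₂ 30 (by decide) (by rw [Program.mods_setup]; decide)]
    rfl
  have hDle' : σ₃ 32 0 ≤ 2 ^ gramBits d b := hDle.trans (gram_le_two_pow (by omega))
  have h15 : σ₃ 15 = σ₂ 15 := hf₃ 15 (by decide)
  have hq : 0 < σ₂ 15 d := hfound.den_pos
  have hqle : σ₂ 15 d ≤ (d + 1) * V := hfound.den_le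
  have hC : ∀ j < d, |σ₂ 15 (j : ℤ)| ≤ R * σ₂ 15 d := hfound.abs_le
  have hqle' : σ₂ 15 d ≤ 2 ^ d * 2 ^ vertexBits d R e ρ :=
    hqle.trans (mul_le_mul hd1 hV hV0 (by positivity))
  have hRle : (R : ℤ) ≤ 2 ^ R := natCast_le_two_pow R
  refine Runs.output_spec (DB := 2 ^ gramBits d b)
    (C := 2 ^ R * (2 ^ d * 2 ^ vertexBits d R e ρ)) (by omega) hM
    (by rw [hf₃ 0 (by decide), h0])
    (fun i hi j hj => (hdata.abs_le ⟨i, hi⟩ ⟨j, hj⟩).trans hDle') (fun j hj => ?_) ?_ ?_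
    fun σ₄ hnum hden => ?_
  · rw [h15]
    exact (hC j hj).trans (mul_le_mul hRle hqle' hq.le (by positivity))
  · calc (d : ℤ) * (2 ^ gramBits d b * (2 ^ R * (2 ^ d * 2 ^ vertexBits d R e ρ)))
        ≤ 2 ^ d * (2 ^ gramBits d b * (2 ^ R * (2 ^ d * 2 ^ vertexBits d R e ρ))) := by
          have : (d : ℤ) ≤ 2 ^ d := natCast_le_two_pow d
          gcongr
      _ = 2 ^ (2 * d + gramBits d b + R + vertexBits d R e ρ) := by ring
      _ < 2 ^ β := hpow _ (by omega)
  · rw [h15, abs_of_pos (mul_pos hdata.pos hq)]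
    calc σ₃ 32 0 * σ₂ 15 d ≤ 2 ^ gramBits d b * (2 ^ d * 2 ^ vertexBits d R e ρ) :=
          mul_le_mul hDle' hqle' hq.le (by positivity)
      _ = 2 ^ (d + gramBits d b + vertexBits d R e ρ) := by ring
      _ < 2 ^ β := hpow _ (by omega)
  have hread : readVec d σ₄ outputArray = fun i : Fin d => ((∑ j : Fin d,
      σ₃ 30 (((i : ℕ) : ℤ) * d + ((j : ℕ) : ℤ)) * σ₂ 15 (j : ℕ) : ℤ) : ℚ)
        / ((σ₃ 32 0 * σ₂ 15 d : ℤ) : ℚ) := by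
    funext i
    rw [readVec, outputArray, hnum i i.2, hden, h15, Finset.sum_range]
  rw [hread]
  refine ⟨hmat₂.projection_mem_solutions hdata (fun j => σ₂ 15 (j : ℕ)) _, ?_⟩
  rw [hmat₂.dualObjective_projection hdata hμ hΩ hb hA (fun j => σ₂ 15 (j : ℕ)) hq]
  refine dualObjective_le_of_abs_le (R := R) hμ hΩ hb (fun j => ?_) (fun j => ?_) rfl
    (gradientExp_le_oraclePrec d R e ρ)
    (hσ₁.abs_approxGradient_sub_le hμ hΩ hb hO (readVec d σ₂ 15)) hfound.small
  · linarith [abs_apply_le_norm Y j]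
  · have hq' : (0 : ℝ) < σ₂ 15 d := by exact_mod_cast hq
    change |(((σ₂ 15 (j : ℕ) : ℚ) / (σ₂ 15 d : ℚ) : ℚ) : ℝ)| ≤ R
    rw [Rat.cast_div, Rat.cast_intCast, Rat.cast_intCast, abs_div, abs_of_pos hq',
      div_le_iff₀ hq']
    exact_mod_cast hC j j.2

end

/-! ### Polynomial running time -/

/-- A function of natural numbers which is given by a polynomial with natural coefficients. -/
def IsPolynomial {n : ℕ} (F : (Fin n → ℕ) → ℕ) : Prop :=
  ∃ T : MvPolynomial (Fin n) ℕ, ∀ v, MvPolynomial.eval v T = F v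

namespace IsPolynomial

variable {n : ℕ} {F G : (Fin n → ℕ) → ℕ}

theorem const (a : ℕ) : IsPolynomial fun _ : Fin n → ℕ => a :=
  ⟨MvPolynomial.C a, fun v => by simp⟩

theorem coord (i : Fin n) : IsPolynomial fun v => v i := ⟨MvPolynomial.X i, fun v => by simp⟩

theorem add (hF : IsPolynomial F) (hG : IsPolynomial G) : IsPolynomial fun v => F v + G v := by
  obtain ⟨S, hS⟩ := hF
  obtain ⟨T, hT⟩ := hG
  exact ⟨S + T, fun v => by simp [hS, hT]⟩

theorem mul (hF : IsPolynomial F) (hG : IsPolynomial G) : IsPolynomial fun v => F v * G v := by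
  obtain ⟨S, hS⟩ := hF
  obtain ⟨T, hT⟩ := hG
  exact ⟨S * T, fun v => by simp [hS, hT]⟩

theorem pow (hF : IsPolynomial F) (k : ℕ) : IsPolynomial fun v => F v ^ k := by
  obtain ⟨S, hS⟩ := hF
  exact ⟨S ^ k, fun v => by simp [hS]⟩

theorem work (hF : IsPolynomial F) (P : Program) : IsPolynomial fun v => P.work (F v) := by
  obtain ⟨S, hS⟩ := hF
  exact ⟨P.work S, fun v => by rw [Program.map_work, hS]⟩

end IsPolynomial

/-- The bound for the number of steps is a polynomial in the parameters `d`, `h`, `e`, `ρ`. -/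
theorem isPolynomial_stepBound (c k : ℕ) :
    IsPolynomial fun v : Fin 5 → ℕ => stepBound c k (v 0) (v 1) (v 2) (v 3) := by
  simp only [stepBound, oraclePrec, roundBound, gradientExp, boxRadius]
  repeat' first
    | exact .const _
    | exact .coord _
    | apply IsPolynomial.add
    | apply IsPolynomial.mul
    | apply IsPolynomial.pow

/-- The bound for the number of bits is a polynomial in the parameters `d`, `h`, `e`, `ρ` and in the
number of bits of the input. -/
theorem isPolynomial_bitBound (c k : ℕ) :
    IsPolynomial fun v : Fin 5 → ℕ => bitBound c k (v 0) (v 1) (v 2) (v 3) (v 4) := by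
  simp only [bitBound, vertexBits, gramBits, roundBound, gradientExp, boxRadius]
  repeat' first
    | exact isPolynomial_stepBound c k
    | exact .const _
    | exact .coord _
    | apply IsPolynomial.add
    | apply IsPolynomial.mul
    | apply IsPolynomial.pow

theorem le_two_pow_ceilLog (x : ℝ) : x ≤ 2 ^ ceilLog x := by
  have h1 : (0 : ℝ) < max 1 x := lt_max_of_lt_left one_pos
  have h2 := (Real.logb_le_iff_le_rpow (by norm_num : (1 : ℝ) < 2) h1).1
    (Nat.le_ceil (Real.logb 2 (max 1 x)))
  rw [Real.rpow_natCast] at h2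
  exact (le_max_right _ _).trans h2

theorem InEtaInterior.mem {d : ℕ} {η : ℝ} {S : Set (Space d)} {A : Space d} (hη : 0 < η)
    (hA : InEtaInterior η S A) : A ∈ S :=
  hA.2 ⟨Metric.mem_ball_self hη, hA.1⟩

end MaxEnt

theorem mainTheorem4 (f : MvPolynomial (Fin 2) ℝ) :
    ∃ (P : MaxEnt.Program) (T : MvPolynomial (Fin 5) ℕ),
      ∀ (d m : ℕ) (Ω : Set (MaxEnt.Space d)) (μ : Measure (MaxEnt.Space d)) [IsFiniteMeasure μ]
        (c : MaxEnt.Space d) (r η ε : ℝ)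
        (L : Matrix (Fin m) (Fin d) ℚ) (B : Fin m → ℚ) (A : Fin d → ℚ) (O : MaxEnt.Oracle d),
        μ ≠ 0 → μ Ωᶜ = 0 →
        MaxEnt.IsBalanced f μ Ω →
        Ω ⊆ Metric.closedBall c r →
        LinearIndependent ℚ L.row →
        (affineSpan ℝ Ω : Set (MaxEnt.Space d)) = MaxEnt.solutions L B →
        0 < η → MaxEnt.InEtaInterior η (convexHull ℝ Ω) (MaxEnt.ofRat A) →
        0 < ε →
        MaxEnt.IsStrongCountingOracle μ Ω O →
        ∃ (σ : MaxEnt.Store) (t : ℕ),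
          MaxEnt.Exec O P
            (MaxEnt.inputStore (MaxEnt.ceilInv η) (MaxEnt.ceilLog ε⁻¹) (MaxEnt.ceilLog r) L B A)
            σ t ∧
          t ≤ MvPolynomial.eval
            ![d, MaxEnt.ceilInv η, MaxEnt.ceilLog ε⁻¹, MaxEnt.ceilLog r,
              MaxEnt.inputBits L B A] T ∧
          MaxEnt.ofRat (MaxEnt.readVec d σ MaxEnt.outputArray) ∈ MaxEnt.solutions L 0 ∧
          ∃ Ystar ∈ MaxEnt.solutions L 0,
            IsMinOn (MaxEnt.dualObjective μ Ω (MaxEnt.ofRat A)) (MaxEnt.solutions L 0) Ystar ∧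
            MaxEnt.dualObjective μ Ω (MaxEnt.ofRat A)
                (MaxEnt.ofRat (MaxEnt.readVec d σ MaxEnt.outputArray))
              ≤ MaxEnt.dualObjective μ Ω (MaxEnt.ofRat A) Ystar + ε := by
  obtain ⟨c₀, k, hf⟩ := MaxEnt.exists_eval_le_mul_pow f
  obtain ⟨T, hT⟩ := ((MaxEnt.isPolynomial_stepBound c₀ k).work (MaxEnt.Program.dualSolver c₀ k)).mul
    (((MaxEnt.isPolynomial_bitBound c₀ k).add (.const 1)).pow 2)
  refine ⟨MaxEnt.Program.dualSolver c₀ k, T, ?_⟩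
  intro d m Ω μ _ c r η ε L B A O hμ hΩ hbal hr hL hspan hη hA hε hO
  set h := MaxEnt.ceilInv η with hh
  set e := MaxEnt.ceilLog ε⁻¹ with he
  set ρ := MaxEnt.ceilLog r with hρ
  set A' := MaxEnt.ofRat A with hA'
  have hrρ : r ≤ 2 ^ ρ := MaxEnt.le_two_pow_ceilLog r
  have hAr : A' ∈ Metric.closedBall c r :=
    convexHull_min hr (convex_closedBall c r) (hA.mem hη)
  -- `A` lies in the ball that contains `Ω`, which gives the diameter `2 r`
  have hb : ∀ X ∈ Ω, ‖A' - X‖ ≤ 2 ^ (ρ + 1) := fun X hX => by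
    rw [← dist_eq_norm, pow_succ]
    have h1 := dist_triangle_right A' X c
    have h2 := Metric.mem_closedBall.1 hAr
    have h3 := Metric.mem_closedBall.1 (hr hX)
    linarith
  have hdir : ∀ X ∈ Ω, A' - X ∈ MaxEnt.solutions L 0 := fun X hX => by
    have h1 : A' ∈ MaxEnt.solutions L B := by
      rw [← hspan, ← affineSpan_convexHull]
      exact hA.1
    have h2 : X ∈ MaxEnt.solutions L B := by
      rw [← hspan]
      exact subset_affineSpan ℝ Ω hX
    exact MaxEnt.sub_mem_solutionSpace h1 h2
  have hh0 : 0 < h := Nat.ceil_pos.2 (inv_pos.2 hη)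
  have hh0' : (0 : ℝ) < h := by exact_mod_cast hh0
  have hhη : 1 / (h : ℝ) ≤ η := by
    rw [one_div, inv_le_comm₀ hh0' hη]
    exact Nat.le_ceil _
  obtain ⟨Y, hYL, hYR, hY⟩ := MaxEnt.exists_minimizer hμ hΩ (by positivity) hb hbal hspan hA hh0 hhη
    (R := 2 * h * (c₀ * (4 * h + d + 1) ^ k)) (by positivity) (by
      have := hf (4 * h) d
      push_cast at this ⊢
      exact mul_le_mul_of_nonneg_left this (by positivity))
  have hYR' : ‖Y‖ + 1 ≤ MaxEnt.boxRadius c₀ k h d := by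
    rw [MaxEnt.boxRadius]
    push_cast
    linarith
  have hm := MaxEnt.card_le_of_linearIndependent_row hL
  have hbits : ∀ n : ℕ, n ≤ MaxEnt.bitBound c₀ k d h e ρ (MaxEnt.inputBits L B A) →
      MaxEnt.bits n ≤ MaxEnt.bitBound c₀ k d h e ρ (MaxEnt.inputBits L B A) := fun n hn => by
    rw [MaxEnt.bits_le_iff, abs_of_nonneg (by positivity)]
    exact_mod_cast hn.trans_lt Nat.lt_two_pow_self
  obtain ⟨σ, t, hexec, ht, -, hsol, hle⟩ := MaxEnt.runs_dualSolver (B := B) (c := c₀) (k := k)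
    (h := h) (e := e) (ρ := ρ) hμ hΩ hb hO hL hdir hY hYR'
    (MaxEnt.memBound_inputStore (hbits _ (by rw [MaxEnt.bitBound, MaxEnt.stepBound]; omega))
      (hbits _ (by rw [MaxEnt.bitBound, MaxEnt.stepBound]; omega))
      (hbits _ (by rw [MaxEnt.bitBound]; omega)) (hbits _ (by rw [MaxEnt.bitBound]; omega))
      (hbits _ (by rw [MaxEnt.bitBound]; omega)) (by rw [MaxEnt.bitBound]; omega))
  refine ⟨σ, t, hexec, ?_, hsol, Y, hYL, fun x _ => hY x, hle.trans ?_⟩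
  · rw [hT]
    exact ht
  · have h1 := MaxEnt.le_two_pow_ceilLog ε⁻¹
    rw [← he, inv_le_comm₀ hε (by positivity), ← one_div] at h1
    linarith
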